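/- Conventions. Homomorphisms of $C^*$-algebras are $*$-homomorphisms and ideals are closed and two-sided. For a sequence $(B_n)_{n\in\mathbb N}$ of $C^*$-algebras let $\prod_n B_n$ be the $C^*$-algebra of bounded sequences, $\bigoplus_n B_n$ its ideal of sequences converging to $0$ in norm, and $\eta\colon \prod_n B_n\to\prod_n B_n/\bigoplus_n B_n$ the quotient map. When all $B_n$ equal $B$, write $\ell^\infty(\mathbb N,B)$ and $B_\infty$ for $\prod_n B_n$ and $\prod_n B_n/\bigoplus_n B_n$. Weak semiprojectivity. A $C^*$-algebra $C$ is weakly semiprojective if for every $C^*$-algebra $B$, every homomorphism $\psi\colon C\to B_\infty$ has the form $\psi=\eta\circ\varphi$ for some homomorphism $\varphi\colon C\to \ell^\infty(\mathbb N,B)$. A unital $C^*$-algebra $C$ is weakly semiprojective in the unital category if for every sequence $(B_n)$ of unital $C^*$-algebras, every unital homomorphism $\psi\colon C\to \prod_n B_n/\bigoplus_n B_n$ has the form $\psi=\eta\circ\varphi$ for some homomorphism $\varphi\colon C\to\prod_n B_n$ all but finitely many of whose coordinates $C\to B_n$ are unital. Classes. Let $\mathcal C$ be a class of $C^*$-algebras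 (of unital $C^*$-algebras in the unital case). A (unital) approximate $\mathcal C$-algebra is a (unital) $C^*$-algebra isomorphic to the direct limit of a sequence of algebras in $\mathcal C$ (with unital connecting maps). A (unital) $C^*$-algebra $A$ is a (unital) local $\mathcal C$-algebra if for every finite $F\subseteq A$ and every $\varepsilon>0$ there are $B\in\mathcal C$ and a (unital), not necessarily injective, homomorphism $\varphi\colon B\to A$ with $\mathrm{dist}(a,\varphi(B))<\varepsilon$ for all $a\in F$. The class $\mathcal C$ has approximate quotients if $B/I$ is an approximate $\mathcal C$-algebra for every $B\in\mathcal C$ and every ideal $I$ of $B$; it has unital approximate quotients if $B/I$ is a unital approximate $\mathcal C$-algebra for every $B\in\mathcal C$ and every proper ideal $I$ of $B$. Rokhlin property. Let $G$ be a second-countable compact Hausdorff group, and let $\alpha\colon G\to\mathrm{Aut}(A)$ be an action on a $C^*$-algebra $A$ such that $g\mapsto\alpha_g(a)$ is norm-continuous for every $a\in A$. Let $A_{\infty,\alpha}\subseteq A_\infty$ be the image of the set of all $x\in\ell^\infty(\mathbb N,A)$ for which $g\mapsto(\alpha_g(x_n))_n$ is norm-continuous. For an $\alpha$-invariant $C^*$-subalgebra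 $D\subseteq A$, regarded as constant sequences in $A_\infty$, let $F(D,A)$ be the quotient of the relative commutant $A_\infty\cap D'$ by its ideal $\{x : xd=dx=0 \text{ for all } d\in D\}$, let $F_\alpha(D,A)$ be the image of $A_{\infty,\alpha}\cap D'$ in $F(D,A)$, and let $F(\alpha)$ be the action induced by $\alpha$. The action $\alpha$ has the Rokhlin property if for every separable $\alpha$-invariant $C^*$-subalgebra $D\subseteq A$ there is a unital homomorphism $C(G)\to F_\alpha(D,A)$ that is equivariant for left translation on $C(G)$ and $F(\alpha)$. Write $A^\alpha=\{a\in A: \alpha_g(a)=a \text{ for all } g\in G\}$. Theorem. (a) Let $\mathcal C$ be a class of separable, weakly semiprojective $C^*$-algebras that has approximate quotients. Let $A$ be a separable local $\mathcal C$-algebra, let $G$ be a second-countable compact group, and let $\alpha\colon G\to\mathrm{Aut}(A)$ be an action with the Rokhlin property. Then $A^\alpha$ is an approximate $\mathcal C$-algebra. (b) Let $\mathcal C$ be a class of separable unital $C^*$-algebras that are weakly semiprojective in the unital category, and suppose that $\mathcal C$ has unital approximate quotients. Let $A$ be a nonzero separable unital local $\mathcal C$-algebra, and let $G$ and $\alpha$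 be as in (a). Then $A^\alpha$ is a unital approximate $\mathcal C$-algebra. -/

import Mathlib

open Filter Topology
open scoped ENNReal

universe u v

noncomputable section

set_option linter.unusedSectionVars false

namespace CStarRokhlin

/-! ### Quotients of star-algebras -/

/-- A two-sided star-invariant ideal of a (non-unital) complex star-algebra. -/
structure StarIdeal (R : Type*) [NonUnitalRing R] [StarRing R] [Module ℂ R] extends
    Submodule ℂ R where
  mul_left_mem : ∀ (r : R) {x : R}, x ∈ carrier → r * x ∈ carrier
  mul_right_mem : ∀ (r : R) {x : R}, x ∈ carrier → x * r ∈ carrier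
  star_mem : ∀ {x : R}, x ∈ carrier → star x ∈ carrier

namespace StarIdeal

variable {R S : Type*} [NonUnitalRing R] [StarRing R] [Module ℂ R]
  [IsScalarTower ℂ R R] [SMulCommClass ℂ R R] [StarModule ℂ R]
  [NonUnitalRing S] [StarRing S] [Module ℂ S]
  [IsScalarTower ℂ S S] [SMulCommClass ℂ S S] [StarModule ℂ S]

/-- The quotient star-algebra `R / I`; as a complex vector space it is the usual quotient. -/
def Quot (I : StarIdeal R) : Type _ := R ⧸ I.toSubmodule

instance (I : StarIdeal R) : AddCommGroup I.Quot :=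
  inferInstanceAs (AddCommGroup (R ⧸ I.toSubmodule))

instance (I : StarIdeal R) : Module ℂ I.Quot :=
  inferInstanceAs (Module ℂ (R ⧸ I.toSubmodule))

/-- The quotient map as a function. -/
def cls (I : StarIdeal R) (x : R) : I.Quot := Submodule.Quotient.mk x

theorem cls_eq_iff (I : StarIdeal R) {x y : R} :
    I.cls x = I.cls y ↔ x - y ∈ I.toSubmodule :=
  Submodule.Quotient.eq I.toSubmodule

theorem cls_surjective (I : StarIdeal R) : Function.Surjective I.cls :=
  Submodule.Quotient.mk_surjective I.toSubmodule

theorem cls_add (I : StarIdeal R) (x y : R) : I.cls (x + y) = I.cls x + I.cls y := rfl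

theorem cls_zero (I : StarIdeal R) : I.cls 0 = 0 := rfl

theorem cls_smul (I : StarIdeal R) (c : ℂ) (x : R) : I.cls (c • x) = c • I.cls x := rfl

instance (I : StarIdeal R) : Mul I.Quot where
  mul a b := Quotient.liftOn₂' a b (fun x y => I.cls (x * y)) (by
    intro x y x' y' h h'
    have h1 : x - x' ∈ I.toSubmodule := (Submodule.quotientRel_def I.toSubmodule).1 h
    have h2 : y - y' ∈ I.toSubmodule := (Submodule.quotientRel_def I.toSubmodule).1 h'
    refine (I.cls_eq_iff).2 ?_
    have e : x * y - x' * y' = (x - x') * y + x' * (y - y') := by noncomm_ring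
    rw [e]
    exact I.toSubmodule.add_mem (I.mul_right_mem y h1) (I.mul_left_mem x' h2))

theorem cls_mul (I : StarIdeal R) (x y : R) : I.cls (x * y) = I.cls x * I.cls y := rfl

instance (I : StarIdeal R) : Star I.Quot where
  star a := Quotient.liftOn' a (fun x => I.cls (star x)) (by
    intro x x' h
    have h1 : x - x' ∈ I.toSubmodule := (Submodule.quotientRel_def I.toSubmodule).1 h
    refine (I.cls_eq_iff).2 ?_
    rw [← star_sub]
    exact I.star_mem h1)

theorem cls_star (I : StarIdeal R) (x : R) : I.cls (star x) = star (I.cls x) := rfl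

instance (I : StarIdeal R) : NonUnitalRing I.Quot where
  left_distrib a b c := by
    obtain ⟨x, rfl⟩ := I.cls_surjective a
    obtain ⟨y, rfl⟩ := I.cls_surjective b
    obtain ⟨z, rfl⟩ := I.cls_surjective c
    simp only [← cls_add, ← cls_mul, mul_add]
  right_distrib a b c := by
    obtain ⟨x, rfl⟩ := I.cls_surjective a
    obtain ⟨y, rfl⟩ := I.cls_surjective b
    obtain ⟨z, rfl⟩ := I.cls_surjective c
    simp only [← cls_add, ← cls_mul, add_mul]
  zero_mul a := by
    obtain ⟨x, rfl⟩ := I.cls_surjective a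
    simp only [← cls_zero, ← cls_mul, zero_mul]
  mul_zero a := by
    obtain ⟨x, rfl⟩ := I.cls_surjective a
    simp only [← cls_zero, ← cls_mul, mul_zero]
  mul_assoc a b c := by
    obtain ⟨x, rfl⟩ := I.cls_surjective a
    obtain ⟨y, rfl⟩ := I.cls_surjective b
    obtain ⟨z, rfl⟩ := I.cls_surjective c
    simp only [← cls_mul, mul_assoc]

instance (I : StarIdeal R) : StarRing I.Quot where
  star_involutive a := by
    obtain ⟨x, rfl⟩ := I.cls_surjective a
    simp only [← cls_star, star_star]
  star_mul a b := by
    obtain ⟨x, rfl⟩ := I.cls_surjective a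
    obtain ⟨y, rfl⟩ := I.cls_surjective b
    simp only [← cls_star, ← cls_mul, star_mul]
  star_add a b := by
    obtain ⟨x, rfl⟩ := I.cls_surjective a
    obtain ⟨y, rfl⟩ := I.cls_surjective b
    simp only [← cls_star, ← cls_add, star_add]

instance (I : StarIdeal R) : IsScalarTower ℂ I.Quot I.Quot where
  smul_assoc c a b := by
    obtain ⟨x, rfl⟩ := I.cls_surjective a
    obtain ⟨y, rfl⟩ := I.cls_surjective b
    simp only [smul_eq_mul, ← cls_smul, ← cls_mul, smul_mul_assoc]

instance (I : StarIdeal R) : SMulCommClass ℂ I.Quot I.Quot where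
  smul_comm c a b := by
    obtain ⟨x, rfl⟩ := I.cls_surjective a
    obtain ⟨y, rfl⟩ := I.cls_surjective b
    simp only [smul_eq_mul, ← cls_smul, ← cls_mul, mul_smul_comm]

instance (I : StarIdeal R) : StarModule ℂ I.Quot where
  star_smul c a := by
    obtain ⟨x, rfl⟩ := I.cls_surjective a
    simp only [← cls_star, ← cls_smul, star_smul]

/-- The quotient map as a star-homomorphism. -/
def proj (I : StarIdeal R) : R →⋆ₙₐ[ℂ] I.Quot where
  toFun := I.cls
  map_smul' c x := I.cls_smul c x
  map_zero' := I.cls_zero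
  map_add' := I.cls_add
  map_mul' := I.cls_mul
  map_star' := I.cls_star

theorem proj_eq_iff (I : StarIdeal R) {x y : R} : I.proj x = I.proj y ↔ x - y ∈ I.toSubmodule :=
  I.cls_eq_iff

theorem proj_surjective (I : StarIdeal R) : Function.Surjective I.proj := I.cls_surjective

/-- The star-homomorphism `R / I → S / J` induced by `f : R → S` with `f(I) ⊆ J`. -/
def map (I : StarIdeal R) (J : StarIdeal S) (f : R →⋆ₙₐ[ℂ] S)
    (h : ∀ x ∈ I.toSubmodule, f x ∈ J.toSubmodule) : I.Quot →⋆ₙₐ[ℂ] J.Quot where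
  toFun a := Quotient.liftOn' a (fun x => J.proj (f x)) (by
    intro x x' hx
    have h1 : x - x' ∈ I.toSubmodule := (Submodule.quotientRel_def I.toSubmodule).1 hx
    refine (J.proj_eq_iff).2 ?_
    rw [← map_sub]
    exact h _ h1)
  map_smul' c a := by
    obtain ⟨x, rfl⟩ := I.cls_surjective a
    change J.proj (f (c • x)) = c • J.proj (f x)
    rw [map_smul, map_smul]
  map_zero' := by
    change J.proj (f 0) = 0
    rw [map_zero, map_zero]
  map_add' a b := by
    obtain ⟨x, rfl⟩ := I.cls_surjective a
    obtain ⟨y, rfl⟩ := I.cls_surjective b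
    change J.proj (f (x + y)) = J.proj (f x) + J.proj (f y)
    rw [map_add, map_add]
  map_mul' a b := by
    obtain ⟨x, rfl⟩ := I.cls_surjective a
    obtain ⟨y, rfl⟩ := I.cls_surjective b
    change J.proj (f (x * y)) = J.proj (f x) * J.proj (f y)
    rw [map_mul, map_mul]
  map_star' a := by
    obtain ⟨x, rfl⟩ := I.cls_surjective a
    change J.proj (f (star x)) = star (J.proj (f x))
    rw [map_star, map_star]

theorem map_proj (I : StarIdeal R) (J : StarIdeal S) (f : R →⋆ₙₐ[ℂ] S)
    (h : ∀ x ∈ I.toSubmodule, f x ∈ J.toSubmodule) (x : R) :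
    I.map J f h (I.proj x) = J.proj (f x) := rfl

end StarIdeal

/-! ### Sequence algebras -/

section Sequence

variable (B : ℕ → Type*) [∀ n, NonUnitalCStarAlgebra (B n)]

/-- The C*-algebra of all bounded sequences `(b n)` with `b n ∈ B n`, with the supremum norm. -/
abbrev BddSeq := lp B ∞

/-- The ideal of all sequences whose norms tend to zero. -/
def nullIdeal : StarIdeal (BddSeq B) where
  carrier := {x | Tendsto (fun n => ‖x n‖) atTop (𝓝 0)}
  zero_mem' := by simp
  add_mem' := by
    intro x y hx hy
    refine squeeze_zero (fun n => norm_nonneg _) (fun n => ?_) (by simpa using hx.add hy)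
    exact norm_add_le (x n) (y n)
  smul_mem' := by
    intro c x hx
    have h := (hx.const_mul ‖c‖)
    rw [mul_zero] at h
    refine h.congr (fun n => ?_)
    change ‖c‖ * ‖x n‖ = ‖c • x n‖
    rw [norm_smul]
  mul_left_mem := by
    intro r x hx
    have h := (hx.const_mul ‖r‖)
    rw [mul_zero] at h
    refine squeeze_zero (fun n => norm_nonneg _) (fun n => ?_) h
    change ‖r n * x n‖ ≤ _
    exact (norm_mul_le _ _).trans
      (mul_le_mul_of_nonneg_right (lp.norm_apply_le_norm ENNReal.top_ne_zero r n) (norm_nonneg _))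
  mul_right_mem := by
    intro r x hx
    have h := (hx.mul_const ‖r‖)
    rw [zero_mul] at h
    refine squeeze_zero (fun n => norm_nonneg _) (fun n => ?_) h
    change ‖x n * r n‖ ≤ _
    exact (norm_mul_le _ _).trans
      (mul_le_mul_of_nonneg_left (lp.norm_apply_le_norm ENNReal.top_ne_zero r n) (norm_nonneg _))
  star_mem := by
    intro x hx
    refine hx.congr (fun n => ?_)
    change ‖x n‖ = ‖star (x n)‖
    rw [norm_star]

/-- The sequence algebra `∏ B n / ⨁ B n`. Homomorphisms of C*-algebras are
star-homomorphisms, so only its star-algebra structure is recorded. -/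
abbrev SeqAlg := (nullIdeal B).Quot

/-- The quotient map `η` from bounded sequences to the sequence algebra. -/
abbrev seqMk : BddSeq B →⋆ₙₐ[ℂ] SeqAlg B := (nullIdeal B).proj

end Sequence

section Const

variable (A : Type*) [NonUnitalCStarAlgebra A]

/-- `ℓ^∞(ℕ, A)`. -/
abbrev EllInfty := BddSeq (fun _ : ℕ => A)

/-- `A_∞ = ℓ^∞(ℕ, A) / c₀(ℕ, A)`. -/
abbrev AInfty := SeqAlg (fun _ : ℕ => A)

variable {A} {B : Type*} [NonUnitalCStarAlgebra B]

/-- The constant sequence with value `a`. -/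
def constSeq (a : A) : EllInfty A :=
  ⟨fun _ => a, memℓp_infty ⟨‖a‖, by rintro _ ⟨n, rfl⟩; exact le_rfl⟩⟩

/-- The star-homomorphism `ℓ^∞(ℕ, A) → ℓ^∞(ℕ, B)` applying `f` to every entry. -/
def mapSeq (f : A →⋆ₙₐ[ℂ] B) : EllInfty A →⋆ₙₐ[ℂ] EllInfty B where
  toFun x := ⟨fun n => f (x n), memℓp_infty ⟨‖x‖, by
    rintro _ ⟨n, rfl⟩
    exact (NonUnitalStarAlgHom.norm_apply_le f (x n)).trans
      (lp.norm_apply_le_norm ENNReal.top_ne_zero x n)⟩⟩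
  map_smul' c x := by
    ext n
    exact map_smul f c (x n)
  map_zero' := by
    ext n
    exact map_zero f
  map_add' x y := by
    ext n
    exact map_add f (x n) (y n)
  map_mul' x y := by
    ext n
    exact map_mul f (x n) (y n)
  map_star' x := by
    ext n
    exact map_star f (x n)

theorem mapSeq_apply (f : A →⋆ₙₐ[ℂ] B) (x : EllInfty A) (n : ℕ) : mapSeq f x n = f (x n) := rfl

/-- The star-homomorphism `A_∞ → B_∞` induced by `f`. -/
def mapInfty (f : A →⋆ₙₐ[ℂ] B) : AInfty A →⋆ₙₐ[ℂ] AInfty B :=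
  (nullIdeal _).map (nullIdeal _) (mapSeq f) (by
    intro x hx
    exact squeeze_zero (fun n => norm_nonneg _)
      (fun n => NonUnitalStarAlgHom.norm_apply_le f (x n)) hx)

theorem mapInfty_mk (f : A →⋆ₙₐ[ℂ] B) (x : EllInfty A) :
    mapInfty f (seqMk _ x) = seqMk _ (mapSeq f x) := rfl

end Const

/-! ### Central sequence algebras -/

section Central

variable {A : Type*} [NonUnitalCStarAlgebra A] (D : NonUnitalStarSubalgebra ℂ A)

/-- The relative commutant `A_∞ ∩ D'`. -/
def commutant : NonUnitalStarSubalgebra ℂ (AInfty A) :=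
  NonUnitalStarSubalgebra.centralizer ℂ ((fun a : A => seqMk (fun _ : ℕ => A) (constSeq a)) '' D)

/-- The annihilator `Ann(D, A_∞)`, as an ideal of `A_∞ ∩ D'`. -/
def annIdeal : StarIdeal (commutant D) where
  carrier := {x | ∀ d ∈ D, (x : AInfty A) * seqMk _ (constSeq d) = 0 ∧
    seqMk _ (constSeq d) * (x : AInfty A) = 0}
  zero_mem' := by
    intro d _
    simp
  add_mem' := by
    intro x y hx hy d hd
    simp only [NonUnitalStarSubalgebra.coe_add, add_mul, mul_add, (hx d hd).1, (hx d hd).2,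
      (hy d hd).1, (hy d hd).2, add_zero, and_self]
  smul_mem' := by
    intro c x hx d hd
    simp only [NonUnitalStarSubalgebra.coe_smul, smul_mul_assoc, mul_smul_comm, (hx d hd).1,
      (hx d hd).2, smul_zero, and_self]
  mul_left_mem := by
    intro r x hx d hd
    have hr : seqMk (fun _ : ℕ => A) (constSeq d) * (r : AInfty A)
        = (r : AInfty A) * seqMk _ (constSeq d) :=
      ((NonUnitalStarSubalgebra.mem_centralizer_iff ℂ).1 r.2 _ ⟨d, hd, rfl⟩).1
    simp only [NonUnitalStarSubalgebra.coe_mul]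
    refine ⟨by rw [mul_assoc, (hx d hd).1, mul_zero], ?_⟩
    rw [← mul_assoc, hr, mul_assoc, (hx d hd).2, mul_zero]
  mul_right_mem := by
    intro r x hx d hd
    have hr : seqMk (fun _ : ℕ => A) (constSeq d) * (r : AInfty A)
        = (r : AInfty A) * seqMk _ (constSeq d) :=
      ((NonUnitalStarSubalgebra.mem_centralizer_iff ℂ).1 r.2 _ ⟨d, hd, rfl⟩).1
    simp only [NonUnitalStarSubalgebra.coe_mul]
    refine ⟨?_, by rw [← mul_assoc, (hx d hd).2, zero_mul]⟩
    rw [mul_assoc, ← hr, ← mul_assoc, (hx d hd).1, zero_mul]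
  star_mem := by
    intro x hx d hd
    have hs : seqMk (fun _ : ℕ => A) (constSeq d)
        = star (seqMk (fun _ : ℕ => A) (constSeq (star d))) := by
      rw [← map_star]
      congr 1
      ext n
      exact (star_star d).symm
    have h := hx (star d) (star_mem hd)
    change star (x : AInfty A) * _ = 0 ∧ _ * star (x : AInfty A) = 0
    rw [hs, ← star_mul, ← star_mul, h.1, h.2, star_zero]
    exact ⟨rfl, rfl⟩

/-- Kirchberg's algebra `F(D, A) = (A_∞ ∩ D') / Ann(D, A_∞)`. -/
abbrev KirchbergAlg := (annIdeal D).Quot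

/-- The quotient map `κ : A_∞ ∩ D' → F(D, A)`. -/
abbrev kappa : commutant D →⋆ₙₐ[ℂ] KirchbergAlg D := (annIdeal D).proj

end Central

/-! ### Actions and the Rokhlin property -/

/-- A continuous action of a topological group `G` on a C*-algebra `A`: a homomorphism
`G → Aut(A)` such that every orbit map `g ↦ α g a` is norm-continuous. -/
structure Action (G : Type*) [Group G] [TopologicalSpace G] (A : Type*)
    [NonUnitalCStarAlgebra A] where
  aut : G → (A ≃⋆ₐ[ℂ] A)
  aut_one : ∀ a, aut 1 a = a
  aut_mul : ∀ g h a, aut (g * h) a = aut g (aut h a)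
  continuous_orbit : ∀ a, Continuous fun g => aut g a

namespace Action

variable {G : Type*} [Group G] [TopologicalSpace G]

section General

variable {A : Type*} [NonUnitalCStarAlgebra A] (α : Action G A)

/-- The automorphism `α g`, as a star-homomorphism. -/
def hom (g : G) : A →⋆ₙₐ[ℂ] A where
  toFun := α.aut g
  map_smul' c x := map_smul (α.aut g) c x
  map_zero' := map_zero (α.aut g)
  map_add' := map_add (α.aut g)
  map_mul' := map_mul (α.aut g)
  map_star' := map_star (α.aut g)

theorem hom_apply (g : G) (a : A) : α.hom g a = α.aut g a := rfl

/-- The action `α^∞` on `ℓ^∞(ℕ, A)`. -/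
def seqHom (g : G) : EllInfty A →⋆ₙₐ[ℂ] EllInfty A := mapSeq (α.hom g)

/-- The action `α_∞` on `A_∞`. -/
def inftyHom (g : G) : AInfty A →⋆ₙₐ[ℂ] AInfty A := mapInfty (α.hom g)

/-- `ℓ^∞_α(ℕ, A)`: bounded sequences `x` for which `g ↦ α^∞_g(x)` is norm-continuous. -/
def contSeq : NonUnitalStarSubalgebra ℂ (EllInfty A) where
  carrier := {x | Continuous fun g => α.seqHom g x}
  zero_mem' := by
    change Continuous fun g => α.seqHom g 0
    simp only [map_zero]
    exact continuous_const
  add_mem' := by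
    intro x y hx hy
    change Continuous fun g => α.seqHom g (x + y)
    simp only [map_add]
    exact hx.add hy
  mul_mem' := by
    intro x y hx hy
    change Continuous fun g => α.seqHom g (x * y)
    simp only [map_mul]
    exact hx.mul hy
  smul_mem' := by
    intro c x hx
    change Continuous fun g => α.seqHom g (c • x)
    simp only [map_smul]
    exact hx.const_smul c
  star_mem' := by
    intro x hx
    change Continuous fun g => α.seqHom g (star x)
    simpa only [map_star] using hx.star

/-- `A_{∞,α}`, the image of `ℓ^∞_α(ℕ, A)` in `A_∞`. -/
def contInfty : NonUnitalStarSubalgebra ℂ (AInfty A) :=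
  α.contSeq.map (seqMk (fun _ : ℕ => A))

/-- A subalgebra `D` of `A` is `α`-invariant. -/
def Invariant (D : NonUnitalStarSubalgebra ℂ A) : Prop :=
  ∀ g, ∀ d ∈ D, α.aut g d ∈ D

variable {α} in
theorem Invariant.exists_eq {D : NonUnitalStarSubalgebra ℂ A} (hD : α.Invariant D) (g : G)
    {d : A} (hd : d ∈ D) : ∃ e ∈ D, α.inftyHom g (seqMk _ (constSeq e)) = seqMk _ (constSeq d) := by
  refine ⟨α.aut g⁻¹ d, hD _ _ hd, ?_⟩
  change seqMk _ (mapSeq (α.hom g) (constSeq (α.aut g⁻¹ d))) = _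
  congr 1
  ext n
  change α.aut g (α.aut g⁻¹ d) = d
  rw [← α.aut_mul, mul_inv_cancel, α.aut_one]

/-- The action `α_∞` restricted to `A_∞ ∩ D'`, for an invariant subalgebra `D`. -/
def commutantHom {D : NonUnitalStarSubalgebra ℂ A} (hD : α.Invariant D) (g : G) :
    commutant D →⋆ₙₐ[ℂ] commutant D :=
  NonUnitalStarAlgHom.codRestrict
    ((α.inftyHom g).comp (NonUnitalStarSubalgebraClass.subtype (commutant D))) (commutant D) (by
      intro x
      refine (NonUnitalStarSubalgebra.mem_centralizer_iff ℂ).2 ?_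
      rintro _ ⟨d, hd, rfl⟩
      obtain ⟨e, he, h⟩ := hD.exists_eq g hd
      have hx := (NonUnitalStarSubalgebra.mem_centralizer_iff ℂ).1 x.2 _ ⟨e, he, rfl⟩
      change _ * α.inftyHom g (x : AInfty A) = α.inftyHom g (x : AInfty A) * _ ∧
        _ * α.inftyHom g (x : AInfty A) = α.inftyHom g (x : AInfty A) * _
      dsimp only at hx ⊢
      rw [← h, ← map_star, ← map_mul, ← map_mul, ← map_mul, ← map_mul, hx.1, hx.2]
      exact ⟨rfl, rfl⟩)

/-- The action `F(α)` on `F(D, A)`, for an invariant subalgebra `D`. -/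
def kirchbergHom {D : NonUnitalStarSubalgebra ℂ A} (hD : α.Invariant D) (g : G) :
    KirchbergAlg D →⋆ₙₐ[ℂ] KirchbergAlg D :=
  (annIdeal D).map (annIdeal D) (α.commutantHom hD g) (by
    intro x hx d hd
    obtain ⟨e, he, h⟩ := hD.exists_eq g hd
    change α.inftyHom g (x : AInfty A) * _ = 0 ∧ _ * α.inftyHom g (x : AInfty A) = 0
    rw [← h, ← map_mul, ← map_mul, (hx e he).1, (hx e he).2, map_zero]
    exact ⟨rfl, rfl⟩)

/-- `F_α(D, A)`, the image of `A_{∞,α} ∩ D'` in `F(D, A)`. -/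
def contKirchberg (D : NonUnitalStarSubalgebra ℂ A) : NonUnitalStarSubalgebra ℂ (KirchbergAlg D) :=
  (α.contInfty.comap (NonUnitalStarSubalgebraClass.subtype (commutant D))).map (kappa D)

/-- Left translation on `C(G)`: `Lt g f h = f (g⁻¹ * h)`. -/
def leftTranslate [IsTopologicalGroup G] (g : G) (f : C(G, ℂ)) : C(G, ℂ) :=
  f.comp ⟨fun h => g⁻¹ * h, continuous_const.mul continuous_id⟩

/-- The Rokhlin property: for every separable `α`-invariant C*-subalgebra `D` of `A` there is a
unital equivariant star-homomorphism `(C(G), Lt) → (F_α(D, A), F(α))`. -/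
def Rokhlin [IsTopologicalGroup G] [CompactSpace G] : Prop :=
  ∀ (D : NonUnitalStarSubalgebra ℂ A) (hD : α.Invariant D), IsClosed (D : Set A) →
    TopologicalSpace.IsSeparable (D : Set A) →
    ∃ φ : C(G, ℂ) →⋆ₙₐ[ℂ] α.contKirchberg D,
      (∀ y : α.contKirchberg D, φ 1 * y = y ∧ y * φ 1 = y) ∧
      ∀ (g : G) (f : C(G, ℂ)), (φ (leftTranslate g f) : KirchbergAlg D) =
        α.kirchbergHom hD g (φ f : KirchbergAlg D)

/-- The fixed point algebra `A^α`. -/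
def fixed : NonUnitalStarSubalgebra ℂ A where
  carrier := {a | ∀ g, α.aut g a = a}
  zero_mem' := fun g => map_zero (α.aut g)
  add_mem' := fun {a b} ha hb g => by rw [map_add, ha g, hb g]
  mul_mem' := fun {a b} ha hb g => by rw [map_mul, ha g, hb g]
  smul_mem' := fun c a ha g => by rw [map_smul, ha g]
  star_mem' := fun {a} ha g => by
    rw [map_star, ha g]

theorem isClosed_setOf_fixed : IsClosed {a : A | ∀ g, α.aut g a = a} := by
  rw [Set.ofPred_forall]
  refine isClosed_iInter fun g => isClosed_eq ?_ continuous_id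
  have h : LipschitzWith 1 (α.hom g) := AddMonoidHomClass.lipschitz_of_bound_nnnorm (α.hom g) 1
    (fun a => by rw [one_mul]; exact NonUnitalStarAlgHom.nnnorm_apply_le (α.hom g) a)
  exact h.continuous

instance : IsClosed (α.fixed : Set A) := α.isClosed_setOf_fixed

end General

section Unital

variable {A : Type*} [CStarAlgebra A] (α : Action G A)

/-- The fixed point algebra `A^α` of an action on a unital C*-algebra, as a unital algebra. -/
def fixedUnital : StarSubalgebra ℂ A where
  carrier := {a | ∀ g, α.aut g a = a}
  zero_mem' := fun g => map_zero (α.aut g)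
  one_mem' := fun g => map_one (α.aut g)
  add_mem' := fun {a b} ha hb g => by rw [map_add, ha g, hb g]
  mul_mem' := fun {a b} ha hb g => by rw [map_mul, ha g, hb g]
  algebraMap_mem' := fun c g => by
    rw [Algebra.algebraMap_eq_smul_one, map_smul, map_one]
  star_mem' := fun {a} ha g => by
    change α.aut g (star a) = star a
    rw [map_star, ha g]

instance : IsClosed (α.fixedUnital : Set A) := α.isClosed_setOf_fixed

end Unital

end Action

/-! ### Classes of C*-algebras, limits and local approximation -/

/-- `E` is (isomorphic to) the direct limit of a sequence of C*-algebras from the class `C`: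
there is a direct system `(X n, γ)` of members of `C` with compatible maps `μ n : X n → E` which
identify `E` with the completion of the algebraic direct limit in the norm
`‖[x]‖ = lim_m ‖γ n m x‖`. -/
def IsApprox (C : ∀ (B : Type u) [NonUnitalCStarAlgebra B], Prop)
    (E : Type u) [NonUnitalCStarAlgebra E] : Prop :=
  ∃ (X : ℕ → Type u) (_ : ∀ n, NonUnitalCStarAlgebra (X n))
    (γ : ∀ n m, n ≤ m → (X n →⋆ₙₐ[ℂ] X m)) (μ : ∀ n, X n →⋆ₙₐ[ℂ] E),
    (∀ n, C (X n)) ∧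
    (∀ n x, γ n n le_rfl x = x) ∧
    (∀ n m k (h : n ≤ m) (h' : m ≤ k) x, γ m k h' (γ n m h x) = γ n k (h.trans h') x) ∧
    (∀ n m (h : n ≤ m) x, μ m (γ n m h x) = μ n x) ∧
    (∀ n x, Tendsto (fun k => ‖γ n (n + k) (Nat.le_add_right n k) x‖) atTop (𝓝 ‖μ n x‖)) ∧
    Dense (⋃ n, Set.range (μ n))

/-- `E` is (isomorphic to) the direct limit of a sequence of unital C*-algebras from the class `C`
with unital connecting maps. -/
def IsApproxUnital (C : ∀ (B : Type u) [CStarAlgebra B], Prop)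
    (E : Type u) [CStarAlgebra E] : Prop :=
  ∃ (X : ℕ → Type u) (_ : ∀ n, CStarAlgebra (X n))
    (γ : ∀ n m, n ≤ m → (X n →⋆ₐ[ℂ] X m)) (μ : ∀ n, X n →⋆ₐ[ℂ] E),
    (∀ n, C (X n)) ∧
    (∀ n x, γ n n le_rfl x = x) ∧
    (∀ n m k (h : n ≤ m) (h' : m ≤ k) x, γ m k h' (γ n m h x) = γ n k (h.trans h') x) ∧
    (∀ n m (h : n ≤ m) x, μ m (γ n m h x) = μ n x) ∧
    (∀ n x, Tendsto (fun k => ‖γ n (n + k) (Nat.le_add_right n k) x‖) atTop (𝓝 ‖μ n x‖)) ∧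
    Dense (⋃ n, Set.range (μ n))

/-- `A` is a local `C`-algebra: every finite subset of `A` is, up to any `ε > 0`, contained in
the image of a (not necessarily injective) homomorphism from a member of `C`. -/
def IsLocal (C : ∀ (B : Type u) [NonUnitalCStarAlgebra B], Prop)
    (A : Type u) [NonUnitalCStarAlgebra A] : Prop :=
  ∀ (F : Finset A) (ε : ℝ), 0 < ε →
    ∃ (B : Type u) (_ : NonUnitalCStarAlgebra B), C B ∧
      ∃ φ : B →⋆ₙₐ[ℂ] A, ∀ a ∈ F, Metric.infDist a (Set.range φ) < ε

/-- `A` is a unital local `C`-algebra. -/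
def IsLocalUnital (C : ∀ (B : Type u) [CStarAlgebra B], Prop)
    (A : Type u) [CStarAlgebra A] : Prop :=
  ∀ (F : Finset A) (ε : ℝ), 0 < ε →
    ∃ (B : Type u) (_ : CStarAlgebra B), C B ∧
      ∃ φ : B →⋆ₐ[ℂ] A, ∀ a ∈ F, Metric.infDist a (Set.range φ) < ε

/-- `C` has approximate quotients: every quotient of a member of `C` by a closed two-sided ideal
is a direct limit of members of `C`. The quotients of `B` are, up to isomorphism, exactly the
C*-algebras `Q` which admit a surjective homomorphism `B → Q`. -/
def HasApproxQuotients (C : ∀ (B : Type u) [NonUnitalCStarAlgebra B], Prop) : Prop :=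
  ∀ (B : Type u) [NonUnitalCStarAlgebra B], C B →
    ∀ (Q : Type u) [NonUnitalCStarAlgebra Q] (π : B →⋆ₙₐ[ℂ] Q),
      Function.Surjective π → IsApprox C Q

/-- `C` has unital approximate quotients: every quotient of a member of `C` by a proper closed
two-sided ideal is a direct limit of members of `C` with unital connecting maps. (The ideal is
proper exactly when the quotient is nonzero.) -/
def HasApproxQuotientsUnital (C : ∀ (B : Type u) [CStarAlgebra B], Prop) : Prop :=
  ∀ (B : Type u) [CStarAlgebra B], C B →
    ∀ (Q : Type u) [CStarAlgebra Q] [Nontrivial Q] (π : B →⋆ₐ[ℂ] Q),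
      Function.Surjective π → IsApproxUnital C Q

/-- Weak semiprojectivity: every homomorphism `A → B_∞` lifts to a homomorphism
`A → ℓ^∞(ℕ, B)`. -/
def WeaklySemiprojective (A : Type u) [NonUnitalCStarAlgebra A] : Prop :=
  ∀ (B : Type u) [NonUnitalCStarAlgebra B] (ψ : A →⋆ₙₐ[ℂ] AInfty B),
    ∃ φ : A →⋆ₙₐ[ℂ] EllInfty B, ∀ a, seqMk (fun _ : ℕ => B) (φ a) = ψ a

/-- Weak semiprojectivity in the unital category: for every sequence `(B n)` of unital
C*-algebras, every unital homomorphism `A → ∏ B n / ⨁ B n` lifts to a homomorphism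
`A → ∏ B n` all but finitely many of whose coordinates are unital. -/
def WeaklySemiprojectiveUnital (A : Type u) [CStarAlgebra A] : Prop :=
  ∀ (B : ℕ → Type u) [∀ n, CStarAlgebra (B n)] (ψ : A →⋆ₙₐ[ℂ] SeqAlg B),
    (∀ y : SeqAlg B, ψ 1 * y = y ∧ y * ψ 1 = y) →
    ∃ φ : A →⋆ₙₐ[ℂ] BddSeq B, (∀ a, seqMk B (φ a) = ψ a) ∧ ∃ N, ∀ n, N ≤ n → φ 1 n = 1

end CStarRokhlin

end

namespace CStarRokhlin

/-! ### Star-homomorphisms between C*-algebras -/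

section Hom

variable {A B : Type*} [NonUnitalCStarAlgebra A] [NonUnitalCStarAlgebra B]

/-! The argument has two halves. The first produces a homomorphism ψ : A → (A^α)_∞ that restricts to
the constant embedding on A^α (`Action.Rokhlin.exists_hom`). The Rokhlin property for D = A yields
an equivariant map C(G) ⊗ A → A_∞, f ⊗ a ↦ x_f a. The orbit function k ↦ α_k(a) in C(G, A) is
invariant under translation combined with α, depends multiplicatively on a, and is constant when a
is fixed; ψ(a) is morally its image. No tensor product is formed: the orbit function is replaced by
a finite sum Σ r_h² ⊗ α_h(a), where the r_h² are a partition of unity. It is represented by Σ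
(x_{r_h} e)* α_h(a) (x_{r_h} e) up to an approximate unit e of fixed elements, and such sums obey a
norm bound independent of the number of terms (`norm_sum_star_mul_mul_le`). One coordinate of this
representative, followed by Haar averaging, is a linear map A → A^α that is almost multiplicative on
a finite set and almost the identity on its fixed elements.

If B → A comes from a member of the class and its range almost contains a finite subset of A^α, then
composing with ψ, lifting to bounded sequences and taking one coordinate gives such a map B → A^α.
So A^α is again local (`IsLocalOf.fixed`).

The second half shows that a separable local algebra is a limit (`GoodClass.isApproxOf`). Images of
members are quotients of members, hence themselves limits of members. A homomorphism θ : B → A from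
a member is lifted first into one of a sequence of images that fill up A, then into a member X of a
system whose limit is that image. This gives γ : B → X and μ : X → A with μγ close to θ on a finite
set, ‖γ x‖ hardly larger than ‖θ x‖, and the range of μ as large as desired
(`GoodClass.exists_step`). Iteration with summable errors is a one-sided approximate intertwining.
The control of ‖γ x‖ makes the norms along the system converge to the norm in A although no map need
be injective. -/

theorem continuous_hom (φ : B →⋆ₙₐ[ℂ] A) : Continuous φ :=
  (AddMonoidHomClass.lipschitz_of_bound φ 1
    fun b => by rw [one_mul]; exact NonUnitalStarAlgHom.norm_apply_le φ b).continuous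

/-- Truncating `b` at ±‖φ b‖ by functional calculus does not change its image, because the spectrum
of `φ b` already lies in that interval. -/
theorem exists_norm_le_of_isSelfAdjoint (φ : B →⋆ₙₐ[ℂ] A) {b : B} (hb : IsSelfAdjoint b) :
    ∃ c, φ c = φ b ∧ ‖c‖ ≤ ‖φ b‖ := by
  set r := ‖φ b‖ with hr
  have hr0 : 0 ≤ r := norm_nonneg _
  let f : ℝ → ℝ := fun t => max (-r) (min r t)
  have hf : Continuous f := by fun_prop
  have hf0 : f 0 = 0 := by simp [f, hr0]
  refine ⟨cfcₙ f b, ?_, ?_⟩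
  · have hφ := continuous_hom φ
    rw [NonUnitalStarAlgHom.map_cfcₙ φ f b hf.continuousOn hf0 hφ hb (hb.map φ)]
    conv_rhs => rw [← cfcₙ_id' ℝ (φ b) (hb.map φ)]
    refine cfcₙ_congr fun x hx => ?_
    have := NonUnitalIsometricContinuousFunctionalCalculus.norm_quasispectrum_le (𝕜 := ℝ) (φ b) hx
      (hb.map φ)
    rw [Real.norm_eq_abs, abs_le] at this
    simp only [f]
    rw [min_eq_right this.2, max_eq_right this.1]
  · refine norm_cfcₙ_le fun x _ => ?_
    rw [Real.norm_eq_abs, abs_le]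
    exact ⟨le_max_left _ _, max_le (by linarith) (min_le_left _ _)⟩

theorem exists_norm_le (φ : B →⋆ₙₐ[ℂ] A) (b : B) : ∃ c, φ c = φ b ∧ ‖c‖ ≤ 2 * ‖φ b‖ := by
  have hre : φ (realPart b : B) = (realPart (φ b) : A) := by
    simp only [realPart_apply_coe]
    rw [← Complex.coe_smul, ← Complex.coe_smul, map_smul, map_add, map_star]
  have him : φ (imaginaryPart b : B) = (imaginaryPart (φ b) : A) := by
    simp only [imaginaryPart_apply_coe]
    rw [map_smul, ← Complex.coe_smul, ← Complex.coe_smul, map_smul, map_sub, map_star]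
  obtain ⟨c, hc, hc'⟩ := exists_norm_le_of_isSelfAdjoint φ (realPart b).2
  obtain ⟨d, hd, hd'⟩ := exists_norm_le_of_isSelfAdjoint φ (imaginaryPart b).2
  refine ⟨c + Complex.I • d, ?_, ?_⟩
  · rw [map_add, map_smul, hc, hd, hre, him, realPart_add_I_smul_imaginaryPart]
  · have h1 := realPart.norm_le (φ b)
    have h2 := imaginaryPart.norm_le (φ b)
    rw [hre] at hc'
    rw [him] at hd'
    calc ‖c + Complex.I • d‖ ≤ ‖c‖ + ‖Complex.I • d‖ := norm_add_le _ _
      _ = ‖c‖ + ‖d‖ := by rw [norm_smul, Complex.norm_I, one_mul]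
      _ ≤ ‖φ b‖ + ‖φ b‖ := add_le_add (hc'.trans h1) (hd'.trans h2)
      _ = _ := by ring

/-- Each element of the range has a preimage of at most twice its norm, so successive approximation
in the complete algebra `B` reaches every limit point. -/
theorem isClosed_range (φ : B →⋆ₙₐ[ℂ] A) : IsClosed (Set.range φ) := by
  let f : NormedAddGroupHom B A := AddMonoidHom.mkNormedAddGroupHom (φ : B →+ A) 1
    fun b => by rw [one_mul]; exact NonUnitalStarAlgHom.norm_apply_le φ b
  have h : f.SurjectiveOnWith (AddMonoidHom.range (φ : B →+ A)) 2 := by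
    rintro _ ⟨b, rfl⟩
    exact exists_norm_le φ b
  have h' := controlled_closure_of_complete two_pos one_pos h
  refine isClosed_of_closure_subset fun a ha => ?_
  obtain ⟨b, hb, -⟩ := h' a ha
  exact ⟨b, hb⟩

instance (φ : B →⋆ₙₐ[ℂ] A) : IsClosed (NonUnitalStarAlgHom.range φ : Set A) := by
  rw [NonUnitalStarAlgHom.coe_range]
  exact isClosed_range φ

theorem surjective_of_dense_range (φ : B →⋆ₙₐ[ℂ] A) (h : DenseRange φ) :
    Function.Surjective φ := by
  rw [← Set.range_eq_univ, ← (isClosed_range φ).closure_eq]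
  exact h.closure_range

/-- A homomorphism that vanishes on the kernel of a surjective one factors through it. -/
theorem exists_factor {P Q S : Type*} [NonUnitalRing P] [StarRing P] [Module ℂ P]
    [NonUnitalRing Q] [StarRing Q] [Module ℂ Q] [NonUnitalRing S] [StarRing S] [Module ℂ S]
    (π : P →⋆ₙₐ[ℂ] Q) (hπ : Function.Surjective π) (ρ : P →⋆ₙₐ[ℂ] S)
    (h : ∀ p, π p = 0 → ρ p = 0) : ∃ σ : Q →⋆ₙₐ[ℂ] S, ∀ p, σ (π p) = ρ p := by
  have key : ∀ p q, π p = π q → ρ p = ρ q := fun p q e => by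
    rw [← sub_eq_zero, ← map_sub]
    exact h _ (by rw [map_sub, e, sub_self])
  let s := Function.surjInv hπ
  have hs : ∀ q, π (s q) = q := Function.surjInv_eq hπ
  refine ⟨{ toFun := fun q => ρ (s q), map_smul' := ?_, map_zero' := ?_, map_add' := ?_,
            map_mul' := ?_, map_star' := ?_ }, fun p => key _ _ (hs _)⟩
  · intro c q
    rw [← map_smul]
    exact key _ _ (by simp only [map_smul, hs]; rfl)
  · exact h _ (hs 0)
  · intro a b
    rw [← map_add]
    exact key _ _ (by simp only [map_add, hs])
  · intro a b
    rw [← map_mul]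
    exact key _ _ (by simp only [map_mul, hs])
  · intro a
    rw [← map_star]
    exact key _ _ (by simp only [map_star, hs])

/-- With x the left-hand sum and p = Σ b* b, the order bounds -rp ≤ x ≤ rp give 0 ≤ x + rp ≤ 2rp,
whence the factor 2 + 1. It does not depend on the number of summands, so partitions of unity may be
refined freely. -/
theorem norm_sum_star_mul_mul_le_of_isSelfAdjoint {ι : Type*} (s : Finset ι) (b c : ι → A) {r : ℝ}
    (hr : 0 ≤ r) (hs : ∀ i ∈ s, IsSelfAdjoint (c i)) (hc : ∀ i ∈ s, ‖c i‖ ≤ r) :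
    ‖∑ i ∈ s, star (b i) * c i * b i‖ ≤ 3 * r * ‖∑ i ∈ s, star (b i) * b i‖ := by
  let _ := CStarAlgebra.spectralOrder A
  have _ := CStarAlgebra.spectralOrderedRing A
  set x := ∑ i ∈ s, star (b i) * c i * b i
  set p := ∑ i ∈ s, star (b i) * b i
  have h1 : ∀ i ∈ s, ‖c i‖ • (star (b i) * b i) ≤ r • (star (b i) * b i) := fun i hi =>
    smul_le_smul_of_nonneg_right (hc i hi) (star_mul_self_nonneg _)
  have hx : x ≤ r • p := by
    rw [Finset.smul_sum]
    exact Finset.sum_le_sum fun i hi =>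
      (CStarAlgebra.star_left_conjugate_le_norm_smul (hs i hi)).trans (h1 i hi)
  have hx' : -x ≤ r • p := by
    rw [Finset.smul_sum, ← Finset.sum_neg_distrib]
    refine Finset.sum_le_sum fun i hi => ?_
    have := CStarAlgebra.star_left_conjugate_le_norm_smul (a := b i) (hs i hi).neg
    rw [norm_neg, mul_neg, neg_mul] at this
    exact this.trans (h1 i hi)
  have h0 : 0 ≤ x + r • p := by
    simpa using add_le_add (le_refl x) hx'
  have h2 : x + r • p ≤ (2 * r) • p := by
    rw [two_mul, add_smul]
    exact add_le_add_left hx _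
  have h3 := CStarAlgebra.norm_le_norm_of_nonneg_of_le h0 h2
  rw [norm_smul, Real.norm_of_nonneg (by positivity)] at h3
  calc ‖x‖ = ‖x + r • p - r • p‖ := by rw [add_sub_cancel_right]
    _ ≤ ‖x + r • p‖ + ‖r • p‖ := norm_sub_le _ _
    _ ≤ 2 * r * ‖p‖ + r * ‖p‖ := add_le_add h3 (by rw [norm_smul, Real.norm_of_nonneg hr])
    _ = _ := by ring

theorem norm_sum_star_mul_mul_le {ι : Type*} (s : Finset ι) (b c : ι → A) {r : ℝ}
    (hr : 0 ≤ r) (hc : ∀ i ∈ s, ‖c i‖ ≤ r) :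
    ‖∑ i ∈ s, star (b i) * c i * b i‖ ≤ 6 * r * ‖∑ i ∈ s, star (b i) * b i‖ := by
  have h1 := norm_sum_star_mul_mul_le_of_isSelfAdjoint s b (fun i => (realPart (c i) : A)) hr
    (fun i _ => (realPart (c i)).2) (fun i hi => (realPart.norm_le (c i)).trans (hc i hi))
  have h2 := norm_sum_star_mul_mul_le_of_isSelfAdjoint s b (fun i => (imaginaryPart (c i) : A)) hr
    (fun i _ => (imaginaryPart (c i)).2)
    (fun i hi => (imaginaryPart.norm_le (c i)).trans (hc i hi))
  have e : ∑ i ∈ s, star (b i) * c i * b i = ∑ i ∈ s, star (b i) * (realPart (c i) : A) * b i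
      + Complex.I • ∑ i ∈ s, star (b i) * (imaginaryPart (c i) : A) * b i := by
    rw [Finset.smul_sum, ← Finset.sum_add_distrib]
    refine Finset.sum_congr rfl fun i _ => ?_
    rw [← smul_mul_assoc, ← mul_smul_comm, ← add_mul, ← mul_add, realPart_add_I_smul_imaginaryPart]
  rw [e]
  refine (norm_add_le _ _).trans ?_
  rw [norm_smul, Complex.norm_I, one_mul]
  linarith

end Hom

/-! ### The quotient norm of sequence algebras -/

section Norm

variable {B : ℕ → Type*} [∀ n, NonUnitalCStarAlgebra (B n)]

theorem seqMk_eq_iff {x y : BddSeq B} :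
    seqMk B x = seqMk B y ↔ Tendsto (fun n => ‖x n - y n‖) atTop (𝓝 0) :=
  (nullIdeal B).proj_eq_iff

theorem seqMk_eq_zero_iff {x : BddSeq B} :
    seqMk B x = 0 ↔ Tendsto (fun n => ‖x n‖) atTop (𝓝 0) := by
  rw [← map_zero (seqMk B), seqMk_eq_iff]
  simp

theorem seqMk_surjective : Function.Surjective (seqMk B) := (nullIdeal B).proj_surjective

/-- The quotient norm on `∏ B n / ⨁ B n`. -/
noncomputable def nrm (y : SeqAlg B) : ℝ :=
  ‖(show BddSeq B ⧸ (nullIdeal B).toSubmodule from y)‖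

theorem nrm_seqMk_le (x : BddSeq B) : nrm (seqMk B x) ≤ ‖x‖ :=
  Submodule.Quotient.norm_mk_le _ x

theorem nrm_nonneg (y : SeqAlg B) : 0 ≤ nrm y :=
  norm_nonneg (show BddSeq B ⧸ (nullIdeal B).toSubmodule from y)

theorem nrm_add_le (y z : SeqAlg B) : nrm (y + z) ≤ nrm y + nrm z :=
  norm_add_le (show BddSeq B ⧸ (nullIdeal B).toSubmodule from y) z

theorem nrm_sum_le {ι : Type*} (s : Finset ι) (f : ι → SeqAlg B) :
    nrm (∑ i ∈ s, f i) ≤ ∑ i ∈ s, nrm (f i) :=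
  norm_sum_le (E := BddSeq B ⧸ (nullIdeal B).toSubmodule) s f

theorem exists_seqMk_lt (y : SeqAlg B) {ε : ℝ} (hε : 0 < ε) :
    ∃ x, seqMk B x = y ∧ ‖x‖ < nrm y + ε :=
  Submodule.Quotient.norm_mk_lt (S := (nullIdeal B).toSubmodule) y hε

theorem nrm_mul_le (y z : SeqAlg B) : nrm (y * z) ≤ nrm y * nrm z := by
  have h : ∀ ε : ℝ, 0 < ε → nrm (y * z) ≤ (nrm y + ε) * (nrm z + ε) := fun ε hε => by
    obtain ⟨x, rfl, hx⟩ := exists_seqMk_lt y hε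
    obtain ⟨x', rfl, hx'⟩ := exists_seqMk_lt z hε
    rw [← map_mul]
    exact (nrm_seqMk_le _).trans ((norm_mul_le _ _).trans
      (mul_le_mul hx.le hx'.le (norm_nonneg _) ((norm_nonneg _).trans hx.le)))
  have ht : Tendsto (fun ε : ℝ => (nrm y + ε) * (nrm z + ε)) (𝓝[>] 0) (𝓝 (nrm y * nrm z)) := by
    have : Continuous fun ε : ℝ => (nrm y + ε) * (nrm z + ε) := by fun_prop
    have := this.tendsto 0
    simp only [add_zero] at this
    exact this.mono_left nhdsWithin_le_nhds
  exact ge_of_tendsto ht (eventually_nhdsWithin_of_forall fun ε hε => h ε hε)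

/-- The quotient norm is the limit superior of the coordinate norms. This lemma and
`nrm_le_of_eventually` are the two inequalities; they carry estimates between the sequence algebra
and single coordinates. -/
theorem eventually_norm_lt {x : BddSeq B} {r : ℝ} (h : nrm (seqMk B x) < r) :
    ∀ᶠ n in atTop, ‖x n‖ < r := by
  obtain ⟨x', hx', hlt⟩ := exists_seqMk_lt (seqMk B x) (ε := (r - nrm (seqMk B x)) / 2)
    (by linarith)
  have ht := seqMk_eq_iff.1 hx'
  filter_upwards [ht.eventually_lt_const (show (0 : ℝ) < (r - nrm (seqMk B x)) / 2 by linarith)]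
    with n hn
  have h1 : ‖x' n‖ ≤ ‖x'‖ := lp.norm_apply_le_norm ENNReal.top_ne_zero x' n
  have h2 : ‖x n‖ ≤ ‖x' n‖ + ‖x' n - x n‖ := by
    calc ‖x n‖ = ‖x' n - (x' n - x n)‖ := by rw [sub_sub_cancel]
      _ ≤ _ := norm_sub_le _ _
  linarith

theorem nrm_le_of_eventually {x : BddSeq B} {r : ℝ} (hr : 0 ≤ r)
    (h : ∀ᶠ n in atTop, ‖x n‖ ≤ r) : nrm (seqMk B x) ≤ r := by
  obtain ⟨N, hN⟩ := eventually_atTop.1 h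
  have hb : ∀ n, ‖(if N ≤ n then x n else 0 : B n)‖ ≤ r := fun n => by
    split_ifs with hn
    · exact hN n hn
    · rwa [norm_zero]
  let x' : BddSeq B := ⟨fun n => if N ≤ n then x n else 0,
    memℓp_infty ⟨r, by rintro _ ⟨n, rfl⟩; exact hb n⟩⟩
  have e : seqMk B x = seqMk B x' := by
    rw [seqMk_eq_iff]
    refine tendsto_const_nhds.congr' ?_
    filter_upwards [eventually_ge_atTop N] with n hn
    change 0 = ‖x n - (if N ≤ n then x n else 0)‖
    rw [if_pos hn, sub_self, norm_zero]
  rw [e]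
  exact (nrm_seqMk_le _).trans (lp.norm_le_of_forall_le hr hb)

end Norm

/-! ### Averaging over the group and fixed approximate units. -/

namespace Action

variable {G : Type*} [Group G] [TopologicalSpace G] {A : Type*} [NonUnitalCStarAlgebra A]
  (α : Action G A)

theorem norm_aut (g : G) (a : A) : ‖α.aut g a‖ = ‖a‖ :=
  NonUnitalStarAlgHom.norm_map (α.aut g) (α.aut g).injective a

theorem aut_aut_inv (g : G) (a : A) : α.aut g (α.aut g⁻¹ a) = a := by
  rw [← α.aut_mul, mul_inv_cancel, α.aut_one]

/-- The conditional expectation onto the fixed point algebra obtained by averaging over the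
compact group. -/
theorem exists_average [IsTopologicalGroup G] [CompactSpace G] [SecondCountableTopology G] :
    ∃ E : A →ₗ[ℂ] A, (∀ a, E a ∈ α.fixed) ∧ (∀ a, E (star a) = star (E a)) ∧
      ∀ (L : A →L[ℂ] A) (a y : A) (r : ℝ), (∀ g, ‖L (α.aut g a) - y‖ ≤ r) → ‖L (E a) - y‖ ≤ r := by
  let _ : MeasurableSpace G := borel G
  have : BorelSpace G := ⟨rfl⟩
  let μ : MeasureTheory.Measure G :=
    MeasureTheory.Measure.haarMeasure (⊤ : TopologicalSpace.PositiveCompacts G)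
  have : MeasureTheory.IsProbabilityMeasure μ :=
    ⟨MeasureTheory.Measure.haarMeasure_self (K₀ := (⊤ : TopologicalSpace.PositiveCompacts G))⟩
  have hint : ∀ f : G → A, Continuous f → MeasureTheory.Integrable f μ := fun f hf =>
    hf.integrable_of_hasCompactSupport (HasCompactSupport.of_compactSpace f)
  have hi : ∀ a, MeasureTheory.Integrable (fun g => α.aut g a) μ :=
    fun a => hint _ (α.continuous_orbit a)
  refine ⟨{ toFun := fun a => ∫ g, α.aut g a ∂μ, map_add' := ?_, map_smul' := ?_ }, ?_, ?_, ?_⟩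
  · intro a b
    simp only [map_add]
    exact MeasureTheory.integral_add (hi a) (hi b)
  · intro c a
    simp only [map_smul]
    exact MeasureTheory.integral_smul c _
  · intro a h
    let L : A →L[ℂ] A := ⟨(α.hom h : A →ₗ[ℂ] A), continuous_hom (α.hom h)⟩
    have h1 : α.aut h (∫ g, α.aut g a ∂μ) = ∫ g, α.aut (h * g) a ∂μ := by
      simp only [α.aut_mul]
      exact (L.integral_comp_comm (hi a)).symm
    change α.aut h (∫ g, α.aut g a ∂μ) = ∫ g, α.aut g a ∂μ
    rw [h1]
    exact MeasureTheory.integral_mul_left_eq_self (fun g => α.aut g a) h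
  · intro a
    change ∫ g, α.aut g (star a) ∂μ = star (∫ g, α.aut g a ∂μ)
    simp only [map_star]
    exact (((starL' ℝ : A ≃L[ℝ] A) : A →L[ℝ] A).integral_comp_comm (hi a))
  -- An average of values in a closed ball stays in the ball. Allowing `L` covers the identity and
  -- both one-sided multiplications.
  · intro L a y r h
    have h1 : L (∫ g, α.aut g a ∂μ) - y = ∫ g, (L (α.aut g a) - y) ∂μ := by
      rw [MeasureTheory.integral_sub (L.integrable_comp (hi a)) (MeasureTheory.integrable_const y),
        L.integral_comp_comm (hi a), MeasureTheory.integral_const]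
      simp
    change ‖L (∫ g, α.aut g a ∂μ) - y‖ ≤ r
    rw [h1]
    have := MeasureTheory.norm_integral_le_of_norm_le_const (μ := μ) (Eventually.of_forall h)
    simpa using this

/-- A compact group action admits approximate units consisting of fixed elements. -/
theorem exists_fixed_approximate_unit [IsTopologicalGroup G] [CompactSpace G]
    [SecondCountableTopology G] (F : Finset A) {ε : ℝ} (hε : 0 < ε) :
    ∃ e ∈ α.fixed, star e = e ∧ ‖e‖ ≤ 1 ∧ ∀ a ∈ F, ‖e * a - a‖ ≤ ε ∧ ‖a * e - a‖ ≤ ε := by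
  let _ := CStarAlgebra.spectralOrder A
  have _ := CStarAlgebra.spectralOrderedRing A
  obtain ⟨E, hE, hEs, hEL⟩ := α.exists_average
  -- Since averaging moves `e` by the group, `e` must act as a unit along whole orbits. These are
  -- compact, so finitely many ε/4-balls reduce the task to their centres.
  have hK : IsCompact (⋃ a ∈ F, Set.range fun g => α.aut g a) :=
    F.finite_toSet.isCompact_biUnion fun a _ => isCompact_range (α.continuous_orbit a)
  obtain ⟨t, -, ht, hcov⟩ := hK.finite_cover_balls (show 0 < ε / 4 by linarith)
  have hu := CStarAlgebra.increasingApproximateUnit A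
  have h1 : ∀ᶠ e in CStarAlgebra.approximateUnit A, ∀ c ∈ t, ‖e * c - c‖ < ε / 4 ∧
      ‖c * e - c‖ < ε / 4 := by
    rw [ht.eventually_all]
    intro c _
    have hl := (tendsto_iff_norm_sub_tendsto_zero.1 (hu.tendsto_mul_left c)).eventually_lt_const
      (show (0 : ℝ) < ε / 4 by linarith)
    have hr := (tendsto_iff_norm_sub_tendsto_zero.1 (hu.tendsto_mul_right c)).eventually_lt_const
      (show (0 : ℝ) < ε / 4 by linarith)
    filter_upwards [hl, hr] with e h h'
    exact ⟨h', h⟩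
  obtain ⟨e, he, hs, hn⟩ := (h1.and (hu.eventually_star_eq.and hu.eventually_norm)).exists
  have horb : ∀ a ∈ F, ∀ g, ‖e * α.aut g a - α.aut g a‖ ≤ ε ∧ ‖α.aut g a * e - α.aut g a‖ ≤ ε := by
    intro a ha g
    have hmem : α.aut g a ∈ ⋃ a ∈ F, Set.range fun g => α.aut g a :=
      Set.mem_biUnion ha ⟨g, rfl⟩
    obtain ⟨c, hc, hb⟩ := Set.mem_iUnion₂.1 (hcov hmem)
    rw [Metric.mem_ball, dist_eq_norm] at hb
    set x := α.aut g a
    have e1 : e * x - x = e * (x - c) + (e * c - c) - (x - c) := by noncomm_ring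
    have e2 : x * e - x = (x - c) * e + (c * e - c) - (x - c) := by noncomm_ring
    have n1 : ‖e * (x - c)‖ ≤ 1 * ‖x - c‖ := (norm_mul_le _ _).trans (by gcongr)
    have n2 : ‖(x - c) * e‖ ≤ ‖x - c‖ * 1 := (norm_mul_le _ _).trans (by gcongr)
    have hce := he c hc
    constructor
    · rw [e1]
      refine (norm_sub_le _ _).trans ?_
      linarith [norm_add_le (e * (x - c)) (e * c - c)]
    · rw [e2]
      refine (norm_sub_le _ _).trans ?_
      linarith [norm_add_le ((x - c) * e) (c * e - c)]
  refine ⟨E e, hE e, by rw [← hEs, hs], ?_, fun a ha => ⟨?_, ?_⟩⟩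
  · simpa using hEL (ContinuousLinearMap.id ℂ A) e 0 1 (fun g => by simpa [α.norm_aut] using hn)
  -- ‖α_g(e) a - a‖ = ‖e α_{g⁻¹}(a) - α_{g⁻¹}(a)‖ because α_g is isometric.
  · refine hEL ((ContinuousLinearMap.mul ℂ A).flip a) e a ε fun g => ?_
    rw [ContinuousLinearMap.flip_apply, ContinuousLinearMap.mul_apply']
    have := (horb a ha g⁻¹).1
    rw [← α.norm_aut g, map_sub, map_mul, α.aut_aut_inv] at this
    exact this
  · refine hEL (ContinuousLinearMap.mul ℂ A a) e a ε fun g => ?_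
    rw [ContinuousLinearMap.mul_apply']
    have := (horb a ha g⁻¹).2
    rw [← α.norm_aut g, map_sub, map_mul, α.aut_aut_inv] at this
    exact this

end Action

/-- The increments of `p n` are bounded uniformly in `n`, so convergence at a nearby point of `D`
suffices. This extends asymptotic identities from dense sets. -/
theorem tendsto_zero_of_dense {A : Type*} [SeminormedAddCommGroup A] {D : Set A} (hD : Dense D)
    {p : ℕ → A → ℝ} {K : ℝ} (hp : ∀ n a, 0 ≤ p n a)
    (hL : ∀ n a b, p n a ≤ p n b + K * ‖a - b‖)
    (h : ∀ a ∈ D, Tendsto (fun n => p n a) atTop (𝓝 0)) (a : A) :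
    Tendsto (fun n => p n a) atTop (𝓝 0) := by
  refine (tendsto_order.2 ⟨fun r hr => Eventually.of_forall fun n => hr.trans_le (hp n a),
    fun r hr => ?_⟩)
  -- `|K| + 1` because `K` carries no sign and may vanish.
  obtain ⟨c, hc, hi⟩ := hD.exists_dist_lt a (show 0 < r / (2 * (|K| + 1)) by positivity)
  filter_upwards [(h c hc).eventually_lt_const (show (0 : ℝ) < r / 2 by linarith)] with n hn
  have h1 : K * ‖a - c‖ ≤ (|K| + 1) * (r / (2 * (|K| + 1))) := by
    rw [dist_eq_norm] at hi
    exact mul_le_mul ((le_abs_self K).trans (by linarith)) hi.le (norm_nonneg _) (by positivity)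
  have h2 : (|K| + 1) * (r / (2 * (|K| + 1))) = r / 2 := by field_simp
  linarith [hL n a c]

theorem tendsto_zero_of_denseRange {A : Type*} [SeminormedAddCommGroup A] {d : ℕ → A}
    (hd : DenseRange d) {p : ℕ → A → ℝ} {K : ℝ} (hp : ∀ n a, 0 ≤ p n a)
    (hL : ∀ n a b, p n a ≤ p n b + K * ‖a - b‖)
    (h : ∀ i, Tendsto (fun n => p n (d i)) atTop (𝓝 0)) (a : A) :
    Tendsto (fun n => p n a) atTop (𝓝 0) :=
  tendsto_zero_of_dense hd hp hL (Set.forall_mem_range.2 h) a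

/-! ### Constant sequences. -/

section Const

variable {A : Type*} [NonUnitalCStarAlgebra A]

variable (A) in
/-- The embedding of `A` in `ℓ^∞(ℕ, A)` as constant sequences. -/
noncomputable def constHom : A →⋆ₙₐ[ℂ] EllInfty A where
  toFun := constSeq
  map_smul' _ _ := rfl
  map_zero' := rfl
  map_add' _ _ := rfl
  map_mul' _ _ := rfl
  map_star' _ := rfl

variable (A) in
/-- The embedding of `A` in `A_∞` as constant sequences. -/
noncomputable def constInfty : A →⋆ₙₐ[ℂ] AInfty A := (seqMk _).comp (constHom A)

theorem seqMk_constHom (a : A) : seqMk (fun _ => A) (constHom A a) = constInfty A a := rfl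

theorem nrm_constInfty_le (a : A) : nrm (constInfty A a) ≤ ‖a‖ :=
  (nrm_seqMk_le _).trans (lp.norm_le_of_forall_le (norm_nonneg a) fun _ => le_rfl)

end Const

/-! ### Representatives of the Rokhlin homomorphism. -/

namespace Action

variable {G : Type*} [Group G] [TopologicalSpace G] {A : Type*} [NonUnitalCStarAlgebra A]
  (α : Action G A)

theorem constHom_mem_contSeq (a : A) : constHom A a ∈ α.contSeq := by
  change Continuous fun g => constHom A (α.aut g a)
  exact (continuous_hom (constHom A)).comp (α.continuous_orbit a)

theorem inftyHom_constInfty (g : G) (a : A) :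
    α.inftyHom g (constInfty A a) = constInfty A (α.aut g a) := rfl

/-- A choice of representatives in `ℓ^∞_α(ℕ, A)` for a unital equivariant homomorphism
`C(G) → F_α(A, A)`. -/
structure RokhlinLift [IsTopologicalGroup G] where
  lift : C(G, ℂ) → EllInfty A
  lift_mem : ∀ f, lift f ∈ α.contSeq
  comm : ∀ f a, seqMk _ (lift f) * constInfty A a = constInfty A a * seqMk _ (lift f)
  add : ∀ f f' a, seqMk _ (lift (f + f')) * constInfty A a =
    seqMk _ (lift f) * constInfty A a + seqMk _ (lift f') * constInfty A a
  mul : ∀ f f' a, seqMk _ (lift (f * f')) * constInfty A a =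
    seqMk _ (lift f) * seqMk _ (lift f') * constInfty A a
  lift_star : ∀ f a, seqMk _ (lift (star f)) * constInfty A a =
    star (seqMk _ (lift f)) * constInfty A a
  one : ∀ a, seqMk _ (lift 1) * constInfty A a = constInfty A a
  equivariant : ∀ g f a, α.inftyHom g (seqMk _ (lift f)) * constInfty A a =
    seqMk _ (lift (leftTranslate g f)) * constInfty A a

/-- The class of `e` is a unit for the constants inside A_∞. Its entries being fixed, it also lies
in the continuous part, so it defines an element of F_α(A, A) on which unitality can be tested. -/
theorem exists_fixed_approximate_unit_seq [IsTopologicalGroup G] [CompactSpace G]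
    [SecondCountableTopology G] [TopologicalSpace.SeparableSpace A] :
    ∃ e : EllInfty A, (∀ n, e n ∈ α.fixed) ∧
      ∀ a, seqMk _ e * constInfty A a = constInfty A a ∧
        constInfty A a * seqMk _ e = constInfty A a := by
  obtain ⟨d, hd⟩ := TopologicalSpace.exists_dense_seq A
  classical
  choose e he hes hen hea using fun n : ℕ => α.exists_fixed_approximate_unit
    ((Finset.range (n + 1)).image d) (Nat.one_div_pos_of_nat (α := ℝ) (n := n))
  have hd' : ∀ i, ∀ᶠ n in atTop, ‖e n * d i - d i‖ ≤ 1 / ((n : ℝ) + 1) ∧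
      ‖d i * e n - d i‖ ≤ 1 / ((n : ℝ) + 1) := fun i => by
    filter_upwards [eventually_ge_atTop i] with n hn
    exact hea n (d i) (Finset.mem_image_of_mem _ (Finset.mem_range.2 (by omega)))
  have h0 := tendsto_one_div_add_atTop_nhds_zero_nat (𝕜 := ℝ)
  have hl := tendsto_zero_of_denseRange hd (p := fun n a => ‖e n * a - a‖) (K := 2)
    (fun _ _ => norm_nonneg _) (fun n a b => by
      have e1 : e n * a - a = e n * b - b + (e n * (a - b) - (a - b)) := by noncomm_ring
      have n1 : ‖e n * (a - b)‖ ≤ 1 * ‖a - b‖ :=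
        (norm_mul_le _ _).trans (mul_le_mul_of_nonneg_right (hen n) (norm_nonneg _))
      rw [e1]
      linarith [norm_add_le (e n * b - b) (e n * (a - b) - (a - b)),
        norm_sub_le (e n * (a - b)) (a - b)])
    (fun i => squeeze_zero' (Eventually.of_forall fun _ => norm_nonneg _)
      ((hd' i).mono fun n h => h.1) h0)
  have hr := tendsto_zero_of_denseRange hd (p := fun n a => ‖a * e n - a‖) (K := 2)
    (fun _ _ => norm_nonneg _) (fun n a b => by
      have e1 : a * e n - a = b * e n - b + ((a - b) * e n - (a - b)) := by noncomm_ring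
      have n1 : ‖(a - b) * e n‖ ≤ ‖a - b‖ * 1 :=
        (norm_mul_le _ _).trans (mul_le_mul_of_nonneg_left (hen n) (norm_nonneg _))
      rw [e1]
      linarith [norm_add_le (b * e n - b) ((a - b) * e n - (a - b)),
        norm_sub_le ((a - b) * e n) (a - b)])
    (fun i => squeeze_zero' (Eventually.of_forall fun _ => norm_nonneg _)
      ((hd' i).mono fun n h => h.2) h0)
  refine ⟨⟨e, memℓp_infty ⟨1, by rintro _ ⟨n, rfl⟩; exact hen n⟩⟩, he, fun a => ⟨?_, ?_⟩⟩
  · rw [← seqMk_constHom, ← map_mul, seqMk_eq_iff]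
    exact hl a
  · rw [← seqMk_constHom, ← map_mul, seqMk_eq_iff]
    exact hr a

/-- Equality in F(A, A) is equality in A_∞ after multiplication by constants, so every relation
satisfied by `φ` becomes a relation tested on elements of `A`. -/
theorem Rokhlin.nonempty_rokhlinLift [IsTopologicalGroup G] [CompactSpace G]
    [SecondCountableTopology G] [TopologicalSpace.SeparableSpace A] {α : Action G A}
    (hα : α.Rokhlin) : Nonempty (RokhlinLift α) := by
  obtain ⟨D, hD⟩ : ∃ D : NonUnitalStarSubalgebra ℂ A, ∀ a, a ∈ D :=
    ⟨⊤, fun _ => NonUnitalStarAlgebra.mem_top⟩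
  have hDu : (D : Set A) = Set.univ := Set.eq_univ_of_forall hD
  obtain ⟨φ, h1, hg⟩ := hα D (fun _ _ _ => hD _) (hDu ▸ isClosed_univ)
    (hDu ▸ TopologicalSpace.isSeparable_univ_iff.2 inferInstance)
  have hx : ∀ f, ∃ c : commutant D, ∃ x ∈ α.contSeq,
      kappa D c = (φ f : KirchbergAlg D) ∧
        seqMk _ x = (c : AInfty A) := fun f => by
    obtain ⟨c, ⟨x, hx, hxc⟩, hc⟩ := (φ f).2
    exact ⟨c, x, hx, hc, hxc⟩
  choose c x hxm hc hxc using hx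
  have key : ∀ c c' : commutant D, kappa D c = kappa D c' →
      ∀ a, (c : AInfty A) * constInfty A a = c' * constInfty A a := fun c c' h a => by
    have := ((annIdeal D).proj_eq_iff.1 h a (hD a)).1
    rw [← sub_eq_zero, ← sub_mul]
    exact this
  have hcomm : ∀ (c : commutant D) a,
      (c : AInfty A) * constInfty A a = constInfty A a * c := fun c a =>
    (((NonUnitalStarSubalgebra.mem_centralizer_iff ℂ).1 c.2 _
      ⟨a, hD a, rfl⟩).1).symm
  refine ⟨{ lift := x, lift_mem := hxm, comm := ?_, add := ?_, mul := ?_, lift_star := ?_,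
            one := ?_, equivariant := ?_ }⟩
  · intro f a
    rw [hxc]
    exact hcomm _ _
  · intro f f' a
    rw [hxc, hxc, hxc, ← add_mul]
    refine key (c (f + f')) (c f + c f') ?_ a
    rw [map_add, hc, hc, hc, map_add]
    rfl
  · intro f f' a
    rw [hxc, hxc, hxc]
    refine key (c (f * f')) (c f * c f') ?_ a
    rw [map_mul, hc, hc, hc, map_mul]
    rfl
  · intro f a
    rw [hxc, hxc]
    refine key (c (star f)) (star (c f)) ?_ a
    rw [map_star, hc, hc, map_star]
    rfl
  · intro a
    -- `φ 1` is only known to be a unit within F_α(A, A). Applied to the class of a fixed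
    -- approximate unit this says x_1 e a = e a, and e a = a in A_∞.
    obtain ⟨e, he, hea⟩ := α.exists_fixed_approximate_unit_seq
    have hec : seqMk _ e ∈ commutant D := by
      refine (NonUnitalStarSubalgebra.mem_centralizer_iff ℂ).2 ?_
      rintro _ ⟨d, -, rfl⟩
      have h' := hea (star d)
      rw [map_star (constInfty A)] at h'
      change constInfty A d * _ = _ * constInfty A d ∧
        star (constInfty A d) * _ = _ * star (constInfty A d)
      rw [(hea d).1, (hea d).2, h'.1, h'.2]
      exact ⟨rfl, rfl⟩
    have hem : e ∈ α.contSeq := by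
      change Continuous fun g => α.seqHom g e
      have : ∀ g, α.seqHom g e = e := fun g => by
        ext n
        exact he n g
      simp only [this]
      exact continuous_const
    have := (h1 ⟨kappa D ⟨seqMk _ e, hec⟩, ⟨⟨seqMk _ e, hec⟩, ⟨e, hem, rfl⟩, rfl⟩⟩).1
    have := congrArg Subtype.val this
    have h2 : kappa D (c 1 * ⟨seqMk _ e, hec⟩) = kappa D ⟨seqMk _ e, hec⟩ := by
      rw [map_mul, hc]
      exact this
    have h3 := key _ _ h2 a
    change (c 1 : AInfty A) * seqMk _ e * _ = seqMk _ e * _ at h3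
    rw [mul_assoc, (hea a).1] at h3
    rw [hxc]
    exact h3
  · intro g f a
    rw [hxc, hxc]
    have hk : kappa D (α.commutantHom (fun _ _ _ => hD _) g (c f)) =
        α.kirchbergHom (fun _ _ _ => hD _) g (kappa D (c f)) := rfl
    exact key (α.commutantHom (fun _ _ _ => hD _) g (c f)) (c (leftTranslate g f))
      (hk.trans ((congrArg _ (hc f)).trans ((hg g f).symm.trans (hc _).symm))) a

end Action

/-! ### Elementary tensors in the image of C(G) ⊗ A and their norm estimates. -/

namespace Action

variable {G : Type*} [Group G] [TopologicalSpace G] {A : Type*} [NonUnitalCStarAlgebra A]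
  {α : Action G A} [IsTopologicalGroup G]

theorem leftTranslate_mul (g : G) (f f' : C(G, ℂ)) :
    leftTranslate g (f * f') = leftTranslate g f * leftTranslate g f' := rfl

theorem leftTranslate_star (g : G) (f : C(G, ℂ)) :
    leftTranslate g (star f) = star (leftTranslate g f) := rfl

theorem leftTranslate_one (g : G) : leftTranslate g (1 : C(G, ℂ)) = 1 := rfl

theorem leftTranslate_sum (g : G) {ι : Type*} (s : Finset ι) (f : ι → C(G, ℂ)) :
    leftTranslate g (∑ i ∈ s, f i) = ∑ i ∈ s, leftTranslate g (f i) := by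
  ext k
  simp [leftTranslate]

namespace RokhlinLift

variable (x : RokhlinLift α)

/-- The image of `f ⊗ a` under the homomorphism `C(G) ⊗ A → A_∞`. -/
noncomputable def tmul (f : C(G, ℂ)) (a : A) : AInfty A := seqMk _ (x.lift f) * constInfty A a

theorem add_tmul (f f' : C(G, ℂ)) (a : A) : x.tmul (f + f') a = x.tmul f a + x.tmul f' a :=
  x.add f f' a

theorem tmul_add (f : C(G, ℂ)) (a b : A) : x.tmul f (a + b) = x.tmul f a + x.tmul f b := by
  simp only [tmul, map_add, mul_add]

theorem tmul_sub (f : C(G, ℂ)) (a b : A) : x.tmul f (a - b) = x.tmul f a - x.tmul f b := by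
  simp only [tmul, map_sub, mul_sub]

theorem zero_tmul (a : A) : x.tmul 0 a = 0 := by
  have := x.add_tmul 0 0 a
  rwa [add_zero, left_eq_add] at this

theorem sum_tmul {ι : Type*} (s : Finset ι) (f : ι → C(G, ℂ)) (a : A) :
    x.tmul (∑ i ∈ s, f i) a = ∑ i ∈ s, x.tmul (f i) a :=
  map_sum (AddMonoidHom.mk' (fun f => x.tmul f a) fun f f' => x.add_tmul f f' a) f s

theorem one_tmul (a : A) : x.tmul 1 a = constInfty A a := x.one a

theorem tmul_mul_tmul (f f' : C(G, ℂ)) (a a' : A) :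
    x.tmul f a * x.tmul f' a' = x.tmul (f * f') (a * a') := by
  simp only [tmul]
  rw [mul_assoc, ← mul_assoc (constInfty A a), ← x.comm, mul_assoc, ← mul_assoc,
    ← map_mul (constInfty A), ← x.mul]

theorem tmul_mul_constInfty (f : C(G, ℂ)) (a b : A) :
    x.tmul f a * constInfty A b = x.tmul f (a * b) := by
  simp only [tmul]
  rw [mul_assoc, ← map_mul]

theorem star_tmul (f : C(G, ℂ)) (a : A) : star (x.tmul f a) = x.tmul (star f) (star a) := by
  simp only [tmul]
  rw [x.lift_star, star_mul, ← map_star]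
  have h := congrArg star (x.comm f a)
  rw [star_mul, star_mul, ← map_star] at h
  exact h

theorem inftyHom_tmul (g : G) (f : C(G, ℂ)) (a : A) :
    α.inftyHom g (x.tmul f a) = x.tmul (leftTranslate g f) (α.aut g a) := by
  simp only [tmul]
  rw [map_mul, inftyHom_constInfty, x.equivariant]

theorem nrm_tmul_le (f : C(G, ℂ)) (a : A) : nrm (x.tmul f a) ≤ ‖x.lift f‖ * ‖a‖ :=
  (nrm_mul_le _ _).trans (mul_le_mul (nrm_seqMk_le _) (nrm_constInfty_le a) (nrm_nonneg _)
    (norm_nonneg _))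

/-- Sums over two different partitions are compared by writing both over the product partition. -/
theorem sum_tmul_eq {ι : Type*} (s : Finset ι) {u : ι → C(G, ℂ)} (hu : ∑ i ∈ s, u i = 1)
    (f : C(G, ℂ)) (a : A) : x.tmul f a = ∑ i ∈ s, x.tmul (u i * f) a := by
  rw [← x.sum_tmul, ← Finset.sum_mul, hu, one_mul]

/-- The compressions `∑ (x rᵢ e)* cᵢ (x rᵢ e)`. -/
noncomputable def compress {ι : Type*} (s : Finset ι) (r : ι → C(G, ℂ)) (e : A) (c : ι → A) :
    EllInfty A :=
  ∑ i ∈ s, star (x.lift (r i) * constHom A e) * constHom A (c i) * (x.lift (r i) * constHom A e)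

variable {ι : Type*} {s : Finset ι} {r : ι → C(G, ℂ)} {e : A}

theorem compress_apply (c : ι → A) (n : ℕ) :
    x.compress s r e c n = ∑ i ∈ s, star (x.lift (r i) n * e) * c i * (x.lift (r i) n * e) := by
  rw [compress, lp.coeFn_sum, Finset.sum_apply]
  rfl

theorem seqMk_compress (hr : ∀ i ∈ s, star (r i) = r i) (he : star e = e) (c : ι → A) :
    seqMk _ (x.compress s r e c) = ∑ i ∈ s, x.tmul (r i * r i) (e * c i * e) := by
  rw [compress, map_sum]
  refine Finset.sum_congr rfl fun i hi => ?_
  have h : seqMk (fun _ => A) (x.lift (r i) * constHom A e) = x.tmul (r i) e := by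
    rw [map_mul]
    rfl
  rw [map_mul, map_mul, map_star, h, star_tmul, hr i hi, he, seqMk_constHom,
    tmul_mul_constInfty, tmul_mul_tmul]

/-- In A_∞ the sum is Σ r_i² ⊗ e² = 1 ⊗ e². No coefficients occur, so one coordinate `n` bounds the
compressions of all coefficient families at once. -/
theorem eventually_norm_sum_lt (hr : ∀ i ∈ s, star (r i) = r i) (hs : ∑ i ∈ s, r i * r i = 1)
    (he : star e = e) (he1 : ‖e‖ ≤ 1) {δ : ℝ} (hδ : 0 < δ) :
    ∀ᶠ n in atTop,
      ‖∑ i ∈ s, star (x.lift (r i) n * e) * (x.lift (r i) n * e)‖ < 1 + δ := by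
  have h : seqMk (fun _ => A) (∑ i ∈ s, star (x.lift (r i) * constHom A e) *
      (x.lift (r i) * constHom A e)) = constInfty A (e * e) := by
    rw [← x.one_tmul, ← hs, sum_tmul, map_sum]
    refine Finset.sum_congr rfl fun i hi => ?_
    have h : seqMk (fun _ => A) (x.lift (r i) * constHom A e) = x.tmul (r i) e := by
      rw [map_mul]
      rfl
    rw [map_mul, map_star, h, star_tmul, hr i hi, he, tmul_mul_tmul]
  have hn : nrm (constInfty A (e * e)) < 1 + δ := by
    have h1 : ‖e * e‖ ≤ 1 := (norm_mul_le _ _).trans (mul_le_one₀ he1 (norm_nonneg _) he1)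
    linarith [nrm_constInfty_le (e * e)]
  rw [← h] at hn
  filter_upwards [eventually_norm_lt hn] with n h'
  rw [lp.coeFn_sum, Finset.sum_apply] at h'
  exact h'

/-- As a function on G, Σ r_i² c_i is pointwise a convex combination of those c_i with r_i nonzero
there. The constant 6 is the price of `norm_sum_star_mul_mul_le`, which applies once the c_i are
replaced by e c_i e for an approximate unit e. -/
theorem nrm_sum_tmul_le [CompactSpace G] [SecondCountableTopology G]
    (hr : ∀ i ∈ s, star (r i) = r i) (hs : ∑ i ∈ s, r i * r i = 1) (c : ι → A) {η : ℝ}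
    (hη : 0 ≤ η) (hc : ∀ i ∈ s, r i ≠ 0 → ‖c i‖ ≤ η) :
    nrm (∑ i ∈ s, x.tmul (r i * r i) (c i)) ≤ 6 * η := by
  classical
  wlog hc' : ∀ i ∈ s, ‖c i‖ ≤ η generalizing c
  · have := this (fun i => if r i = 0 then 0 else c i)
      (fun i hi hi0 => by simpa only [if_neg hi0] using hc i hi hi0)
      (fun i hi => by
        split_ifs with h0
        · rwa [norm_zero]
        · exact hc i hi h0)
    convert this using 3 with i hi
    split_ifs with h0
    · rw [h0, mul_zero, zero_tmul, zero_tmul]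
    · rfl
  set K := ∑ i ∈ s, ‖x.lift (r i * r i)‖ with hK
  have hK0 : 0 ≤ K := Finset.sum_nonneg fun _ _ => norm_nonneg _
  refine le_of_forall_pos_le_add fun ε hε => ?_
  -- Makes 6η(1 + δ) + 2Kδ ≤ 6η + ε. The crude bound `K` depends on the partition but not on `e`,
  -- which is chosen after it.
  set δ := ε / (6 * η + 2 * K + 1) with hδ
  have hδ0 : 0 < δ := by positivity
  have hδε : δ * (6 * η + 2 * K) ≤ ε := by
    have : δ * (6 * η + 2 * K + 1) = ε := by rw [hδ]; field_simp
    linarith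
  obtain ⟨e, -, he, he1, hec⟩ := α.exists_fixed_approximate_unit (s.image c) hδ0
  have h1 : nrm (∑ i ∈ s, x.tmul (r i * r i) (e * c i * e)) ≤ 6 * η * (1 + δ) := by
    rw [← x.seqMk_compress hr he]
    refine nrm_le_of_eventually (by positivity) ?_
    filter_upwards [x.eventually_norm_sum_lt hr hs he he1 hδ0] with n hn
    rw [compress_apply]
    exact (norm_sum_star_mul_mul_le s _ c hη hc').trans (by gcongr)
  have h2 : nrm (∑ i ∈ s, x.tmul (r i * r i) (c i - e * c i * e)) ≤ K * (2 * δ) := by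
    refine (nrm_sum_le _ _).trans ?_
    rw [hK, Finset.sum_mul]
    refine Finset.sum_le_sum fun i hi => (x.nrm_tmul_le _ _).trans ?_
    refine mul_le_mul_of_nonneg_left ?_ (norm_nonneg _)
    obtain ⟨n1, n2⟩ := hec (c i) (Finset.mem_image_of_mem c hi)
    have e1 : c i - e * c i * e = -(e * c i - c i) - e * (c i * e - c i) := by noncomm_ring
    have n3 : ‖e * (c i * e - c i)‖ ≤ 1 * δ :=
      (norm_mul_le _ _).trans (mul_le_mul he1 n2 (norm_nonneg _) zero_le_one)
    rw [e1]
    refine (norm_sub_le _ _).trans ?_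
    rw [norm_neg]
    linarith
  have h3 : ∑ i ∈ s, x.tmul (r i * r i) (c i) = ∑ i ∈ s, x.tmul (r i * r i) (e * c i * e) +
      ∑ i ∈ s, x.tmul (r i * r i) (c i - e * c i * e) := by
    rw [← Finset.sum_add_distrib]
    refine Finset.sum_congr rfl fun i _ => ?_
    rw [← tmul_add, add_sub_cancel]
  rw [h3]
  refine (nrm_add_le _ _).trans ?_
  linarith

end RokhlinLift

end Action

/-! ### Square partitions of unity and approximate orbit functions. -/

namespace Action

variable {G : Type*} [Group G] [TopologicalSpace G] {A : Type*} [NonUnitalCStarAlgebra A]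

/-- The bumps max(0, ε - Σ_a ‖α_k a - α_h a‖) vanish where the orbits of `F` have moved too far.
Finitely many cover the compact group, and dividing by the root of the sum of squares normalises
them. -/
theorem exists_partition [CompactSpace G] (α : Action G A) (F : Finset A) {ε : ℝ} (hε : 0 < ε) :
    ∃ (s : Finset G) (r : G → C(G, ℂ)), (∀ h ∈ s, star (r h) = r h) ∧
      ∑ h ∈ s, r h * r h = 1 ∧
      ∀ h ∈ s, ∀ k, r h k ≠ 0 → ∀ a ∈ F, ‖α.aut k a - α.aut h a‖ ≤ ε := by
  let v : G → G → ℝ := fun h k => max 0 (ε - ∑ a ∈ F, ‖α.aut k a - α.aut h a‖)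
  have hv : ∀ h, Continuous (v h) := fun h => by
    refine continuous_const.max (continuous_const.sub (continuous_finsetSum _ fun a _ => ?_))
    exact ((α.continuous_orbit a).sub continuous_const).norm
  have hvv : ∀ h, 0 < v h h := fun h => by simp [v, hε]
  obtain ⟨s, hs⟩ := CompactSpace.elim_nhds_subcover (fun h => {k | 0 < v h k})
    fun h => (isOpen_lt continuous_const (hv h)).mem_nhds (hvv h)
  have hS : ∀ k, 0 < ∑ h ∈ s, v h k * v h k := fun k => by
    have hk : k ∈ ⋃ h ∈ s, {k | 0 < v h k} := by rw [hs]; trivial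
    obtain ⟨h, hhs, hk⟩ := Set.mem_iUnion₂.1 hk
    exact Finset.sum_pos' (fun i _ => mul_self_nonneg _) ⟨h, hhs, mul_pos hk hk⟩
  have hcont : ∀ h, Continuous fun k => ((v h k / √(∑ h ∈ s, v h k * v h k) : ℝ) : ℂ) := fun h => by
    refine Complex.continuous_ofReal.comp ((hv h).div ?_ fun k => (Real.sqrt_pos.2 (hS k)).ne')
    exact (continuous_finsetSum _ fun h _ => (hv h).mul (hv h)).sqrt
  refine ⟨s, fun h => ⟨_, hcont h⟩, fun h _ => ?_, ?_, fun h _ k hk a ha => ?_⟩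
  · ext k
    exact Complex.conj_ofReal _
  · ext k
    rw [ContinuousMap.sum_apply]
    simp only [ContinuousMap.mul_apply, ContinuousMap.coe_mk, ContinuousMap.one_apply]
    rw [← Complex.ofReal_one]
    simp only [← Complex.ofReal_mul, ← Complex.ofReal_sum]
    congr 1
    simp only [div_mul_div_comm, Real.mul_self_sqrt (hS k).le]
    rw [← Finset.sum_div, div_self (hS k).ne']
  · have hvk : v h k ≠ 0 := fun h0 => hk (by simp [h0])
    have h1 : 0 < ε - ∑ a ∈ F, ‖α.aut k a - α.aut h a‖ := by
      by_contra hle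
      exact hvk (max_eq_left (not_lt.1 hle))
    have := Finset.single_le_sum (f := fun a => ‖α.aut k a - α.aut h a‖)
      (fun _ _ => norm_nonneg _) ha
    linarith

/-- Norm continuity of g ↦ α_g(y) in ℓ^∞ is uniform over coordinates, so compactness reduces all `g`
to a finite set, for which the quotient norm passes to coordinates. -/
theorem eventually_forall_norm_aut_sub_le [CompactSpace G] (α : Action G A) {y : EllInfty A}
    (hy : y ∈ α.contSeq) {r η : ℝ} (hη : 0 < η)
    (h : ∀ g, nrm (α.inftyHom g (seqMk _ y) - seqMk _ y) ≤ r) :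
    ∀ᶠ n in atTop, ∀ g, ‖α.aut g (y n) - y n‖ ≤ r + η := by
  have hc : Continuous fun g => α.seqHom g y := hy
  obtain ⟨t, ht⟩ := CompactSpace.elim_nhds_subcover
    (fun g => {k | ‖α.seqHom k y - α.seqHom g y‖ < η / 2})
    fun g => (isOpen_lt (hc.sub continuous_const).norm continuous_const).mem_nhds
      (by simpa using hη)
  have h1 : ∀ᶠ n in atTop, ∀ g ∈ t, ‖α.aut g (y n) - y n‖ < r + η / 2 := by
    refine (Filter.eventually_all_finset t).2 fun g _ => ?_
    have hlt : nrm (seqMk _ (α.seqHom g y - y)) < r + η / 2 := by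
      rw [map_sub]
      exact (h g).trans_lt (by linarith)
    exact eventually_norm_lt hlt
  filter_upwards [h1] with n hn k
  have hk : k ∈ ⋃ g ∈ t, {k | ‖α.seqHom k y - α.seqHom g y‖ < η / 2} := by rw [ht]; trivial
  obtain ⟨g, hg, hk⟩ := Set.mem_iUnion₂.1 hk
  have h2 : ‖α.aut k (y n) - α.aut g (y n)‖ < η / 2 :=
    (lp.norm_apply_le_norm ENNReal.top_ne_zero (α.seqHom k y - α.seqHom g y) n).trans_lt hk
  have e1 : α.aut k (y n) - y n = (α.aut k (y n) - α.aut g (y n)) + (α.aut g (y n) - y n) := by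
    abel
  rw [e1]
  linarith [norm_add_le (α.aut k (y n) - α.aut g (y n)) (α.aut g (y n) - y n), hn g hg]

namespace RokhlinLift

variable {α : Action G A} [IsTopologicalGroup G] (x : RokhlinLift α)

/-- The approximation of `g ↦ α g a` by elements of `C(G) ⊗ A`. -/
noncomputable def orbitSum (s : Finset G) (r : G → C(G, ℂ)) (a : A) : AInfty A :=
  ∑ h ∈ s, x.tmul (r h * r h) (α.aut h a)

variable {s : Finset G} {r : G → C(G, ℂ)}

theorem orbitSum_of_mem_fixed (hs : ∑ h ∈ s, r h * r h = 1) {a : A} (ha : a ∈ α.fixed) :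
    x.orbitSum s r a = constInfty A a := by
  rw [← x.one_tmul, ← hs, sum_tmul]
  exact Finset.sum_congr rfl fun h _ => by rw [ha h]

theorem orbitSum_sub (a b : A) : x.orbitSum s r (a - b) = x.orbitSum s r a - x.orbitSum s r b := by
  simp only [orbitSum, map_sub, tmul_sub, Finset.sum_sub_distrib]

theorem compress_mem_contSeq (e : A) (c : G → A) : x.compress s r e c ∈ α.contSeq := by
  refine sum_mem fun h _ => ?_
  have h1 : x.lift (r h) * constHom A e ∈ α.contSeq :=
    mul_mem (x.lift_mem _) (α.constHom_mem_contSeq e)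
  exact mul_mem (mul_mem (star_mem h1) (α.constHom_mem_contSeq _)) h1

theorem seqMk_compress_aut (hr : ∀ h ∈ s, star (r h) = r h) {e : A} (hef : e ∈ α.fixed)
    (he : star e = e) (a : A) :
    seqMk _ (x.compress s r e fun h => α.aut h a) = x.orbitSum s r (e * a * e) := by
  rw [x.seqMk_compress hr he, orbitSum]
  refine Finset.sum_congr rfl fun h _ => ?_
  rw [map_mul, map_mul, hef h]

variable [CompactSpace G] [SecondCountableTopology G]

theorem nrm_orbitSum_le (hr : ∀ h ∈ s, star (r h) = r h) (hs : ∑ h ∈ s, r h * r h = 1) (a : A) :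
    nrm (x.orbitSum s r a) ≤ 6 * ‖a‖ :=
  x.nrm_sum_tmul_le hr hs _ (norm_nonneg a) fun h _ _ => (α.norm_aut h a).le

/-- The products r_i r'_j again have squares summing to one. Only pairs that are nonzero at a common
point count, so both indices can be compared with that point. -/
theorem nrm_sum_product_le (hr : ∀ h ∈ s, star (r h) = r h) (hs : ∑ h ∈ s, r h * r h = 1)
    {r' : G → C(G, ℂ)} (hr' : ∀ h ∈ s, star (r' h) = r' h) (hs' : ∑ h ∈ s, r' h * r' h = 1)
    (c : G → G → A) {η : ℝ} (hη : 0 ≤ η)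
    (hc : ∀ i ∈ s, ∀ j ∈ s, ∀ k, r i k ≠ 0 → r' j k ≠ 0 → ‖c i j‖ ≤ η) :
    nrm (∑ i ∈ s, ∑ j ∈ s, x.tmul ((r i * r i) * (r' j * r' j)) (c i j)) ≤ 6 * η := by
  rw [← Finset.sum_product']
  have hp : ∑ p ∈ s ×ˢ s, (r p.1 * r' p.2) * (r p.1 * r' p.2) = 1 := by
    rw [Finset.sum_product]
    simp only [mul_mul_mul_comm, ← Finset.mul_sum, hs', mul_one, hs]
  convert x.nrm_sum_tmul_le (s := s ×ˢ s) (r := fun p => r p.1 * r' p.2)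
    (fun p hp => ?_) hp (fun p => c p.1 p.2) hη (fun p hp h0 => ?_) using 4 with p
  · exact mul_mul_mul_comm _ _ _ _
  · rw [Finset.mem_product] at hp
    rw [star_mul, hr _ hp.1, hr' _ hp.2, mul_comm]
  · rw [Finset.mem_product] at hp
    obtain ⟨k, hk⟩ := DFunLike.ne_iff.1 h0
    exact hc _ hp.1 _ hp.2 k (fun h => hk (by simp [h])) (fun h => hk (by simp [h]))

/-- α_g carries the term at j to the translate of r_j² tensored with α_{gj}(a). Over the product
partition, at a common point k both α_i(a) and α_{gj}(a) are within δ of α_k(a); hence 6 · 2δ. -/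
theorem nrm_inftyHom_orbitSum_sub_le (hr : ∀ h ∈ s, star (r h) = r h)
    (hs : ∑ h ∈ s, r h * r h = 1) {a : A} {δ : ℝ} (hδ : 0 ≤ δ)
    (ha : ∀ h ∈ s, ∀ k, r h k ≠ 0 → ‖α.aut k a - α.aut h a‖ ≤ δ) (g : G) :
    nrm (α.inftyHom g (x.orbitSum s r a) - x.orbitSum s r a) ≤ 12 * δ := by
  let r' : G → C(G, ℂ) := fun h => leftTranslate g (r h)
  have hr' : ∀ h ∈ s, star (r' h) = r' h := fun h hh => by
    rw [← leftTranslate_star, hr h hh]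
  have hs' : ∑ h ∈ s, r' h * r' h = 1 := by
    simp only [r', ← leftTranslate_mul, ← leftTranslate_sum, hs, leftTranslate_one]
  have h1 : α.inftyHom g (x.orbitSum s r a) =
      ∑ i ∈ s, ∑ j ∈ s, x.tmul ((r i * r i) * (r' j * r' j)) (α.aut (g * j) a) := by
    rw [orbitSum, map_sum, Finset.sum_comm]
    refine Finset.sum_congr rfl fun j _ => ?_
    rw [inftyHom_tmul, ← α.aut_mul, x.sum_tmul_eq s hs, leftTranslate_mul]
  have h2 : x.orbitSum s r a =
      ∑ i ∈ s, ∑ j ∈ s, x.tmul ((r i * r i) * (r' j * r' j)) (α.aut i a) := by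
    rw [orbitSum]
    refine Finset.sum_congr rfl fun i _ => ?_
    rw [x.sum_tmul_eq s hs']
    exact Finset.sum_congr rfl fun j _ => by rw [mul_comm]
  have h3 : α.inftyHom g (x.orbitSum s r a) - x.orbitSum s r a = ∑ i ∈ s, ∑ j ∈ s,
      x.tmul ((r i * r i) * (r' j * r' j)) (α.aut (g * j) a - α.aut i a) := by
    rw [h1]
    conv_lhs => rw [h2]
    simp only [tmul_sub, Finset.sum_sub_distrib]
  rw [h3]
  refine (x.nrm_sum_product_le hr hs hr' hs' _ (η := 2 * δ) (by positivity) ?_).trans_eq (by ring)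
  intro i hi j hj k hik hjk
  have n1 := ha i hi k hik
  have n2 := ha j hj (g⁻¹ * k) hjk
  rw [← α.norm_aut g, map_sub, ← α.aut_mul, ← α.aut_mul, mul_inv_cancel_left] at n2
  have e1 : α.aut (g * j) a - α.aut i a =
      (α.aut k a - α.aut i a) - (α.aut k a - α.aut (g * j) a) := by abel
  rw [e1]
  linarith [norm_sub_le (α.aut k a - α.aut i a) (α.aut k a - α.aut (g * j) a)]

/-- The defect has coefficients α_i(a)(α_i(b) - α_j(b)), and at a common point k both α_i(b) and
α_j(b) are within δ of α_k(b). -/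
theorem nrm_orbitSum_mul_sub_le (hr : ∀ h ∈ s, star (r h) = r h)
    (hs : ∑ h ∈ s, r h * r h = 1) (a : A) {b : A} {δ : ℝ} (hδ : 0 ≤ δ)
    (hb : ∀ h ∈ s, ∀ k, r h k ≠ 0 → ‖α.aut k b - α.aut h b‖ ≤ δ) :
    nrm (x.orbitSum s r (a * b) - x.orbitSum s r a * x.orbitSum s r b) ≤ 12 * ‖a‖ * δ := by
  have h1 : x.orbitSum s r a * x.orbitSum s r b = ∑ i ∈ s, ∑ j ∈ s,
      x.tmul ((r i * r i) * (r j * r j)) (α.aut i a * α.aut j b) := by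
    simp only [orbitSum, Finset.sum_mul_sum, tmul_mul_tmul]
  have h2 : x.orbitSum s r (a * b) = ∑ i ∈ s, ∑ j ∈ s,
      x.tmul ((r i * r i) * (r j * r j)) (α.aut i a * α.aut i b) := by
    rw [orbitSum]
    refine Finset.sum_congr rfl fun i _ => ?_
    rw [x.sum_tmul_eq s hs, map_mul]
    exact Finset.sum_congr rfl fun j _ => by rw [mul_comm]
  have h3 : x.orbitSum s r (a * b) - x.orbitSum s r a * x.orbitSum s r b = ∑ i ∈ s, ∑ j ∈ s,
      x.tmul ((r i * r i) * (r j * r j)) (α.aut i a * (α.aut i b - α.aut j b)) := by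
    rw [h1, h2]
    simp only [mul_sub, tmul_sub, Finset.sum_sub_distrib]
  rw [h3]
  refine (x.nrm_sum_product_le hr hs hr hs _ (η := ‖a‖ * (2 * δ)) (by positivity) ?_).trans_eq
    (by ring)
  intro i hi j hj k hik hjk
  have n1 := hb i hi k hik
  have n2 := hb j hj k hjk
  have e1 : α.aut i b - α.aut j b = (α.aut k b - α.aut j b) - (α.aut k b - α.aut i b) := by abel
  refine (norm_mul_le _ _).trans ?_
  rw [α.norm_aut, e1]
  refine mul_le_mul_of_nonneg_left ?_ (norm_nonneg _)
  linarith [norm_sub_le (α.aut k b - α.aut j b) (α.aut k b - α.aut i b)]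

end RokhlinLift

end Action

/-! ### An approximate left inverse of the inclusion of the fixed point algebra. -/

namespace Action

variable {G : Type*} [Group G] [TopologicalSpace G] [IsTopologicalGroup G] [CompactSpace G]
  [SecondCountableTopology G] {A : Type*} [NonUnitalCStarAlgebra A] {α : Action G A}

/-- Approximately multiplicative maps `A → A^α` that approximately fix `A^α`. -/
theorem RokhlinLift.exists_approx_map (x : RokhlinLift α) (F : Finset A) {ε : ℝ} (hε : 0 < ε) :
    ∃ T : A →ₗ[ℂ] A, (∀ a, T a ∈ α.fixed) ∧ (∀ a, T (star a) = star (T a)) ∧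
      (∀ a, ‖T a‖ ≤ 12 * ‖a‖) ∧ (∀ a ∈ F, ∀ b ∈ F, ‖T (a * b) - T a * T b‖ ≤ ε) ∧
      ∀ a ∈ F, a ∈ α.fixed → ‖T a - a‖ ≤ ε := by
  classical
  obtain ⟨E, hE, hEs, hEL⟩ := α.exists_average
  set M := ∑ a ∈ F, ‖a‖ with hM
  have hM0 : 0 ≤ M := Finset.sum_nonneg fun _ _ => norm_nonneg _
  have hMa : ∀ a ∈ F, ‖a‖ ≤ M := fun a ha =>
    Finset.single_le_sum (f := fun a => ‖a‖) (fun _ _ => norm_nonneg _) ha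
  -- The errors below add up to at most (336M + 14)δ for products and 16δ on fixed elements.
  set δ := ε / (360 * M + 17) with hδ
  have hδ0 : 0 < δ := by positivity
  have hδε : δ * (360 * M + 17) = ε := by rw [hδ]; field_simp
  obtain ⟨e, hef, he, he1, hea⟩ := α.exists_fixed_approximate_unit F hδ0
  -- Products are included because `Y (a * b)` must be almost invariant as well.
  set F' := F ∪ (F ×ˢ F).image fun p => p.1 * p.2 with hF'
  obtain ⟨s, r, hr, hs, hrF⟩ := α.exists_partition F' hδ0
  -- A lift of the orbit sum of e a e. In this form every coordinate is linear in `a`, and for large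
  -- `n` it is bounded by 12‖a‖ with `n` independent of `a`.
  set Y : A → EllInfty A := fun a => x.compress s r e fun h => α.aut h a with hY
  have hYmk : ∀ a, seqMk _ (Y a) = x.orbitSum s r (e * a * e) :=
    fun a => x.seqMk_compress_aut hr hef he a
  have heae : ∀ c, ‖e * c * e‖ ≤ ‖c‖ := fun c => by
    calc ‖e * c * e‖ ≤ ‖e‖ * ‖c‖ * ‖e‖ := norm_mul₃_le
      _ ≤ 1 * ‖c‖ * 1 := by gcongr
      _ = ‖c‖ := by ring
  have hadapt : ∀ a ∈ F', ∀ h ∈ s, ∀ k, r h k ≠ 0 →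
      ‖α.aut k (e * a * e) - α.aut h (e * a * e)‖ ≤ δ := fun a ha h hh k hk => by
    rw [map_mul, map_mul, map_mul, map_mul, hef h, hef k, ← sub_mul, ← mul_sub]
    exact (heae _).trans (hrF h hh k hk a ha)
  have hev1 : ∀ a ∈ F', ∀ᶠ n in atTop, ∀ g, ‖α.aut g (Y a n) - Y a n‖ ≤ 12 * δ + δ :=
    fun a ha => α.eventually_forall_norm_aut_sub_le (x.compress_mem_contSeq e _) hδ0 fun g => by
      rw [x.seqMk_compress_aut hr hef he]
      exact x.nrm_inftyHom_orbitSum_sub_le hr hs hδ0.le (hadapt a ha) g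
  have hev2 : ∀ a ∈ F, ∀ b ∈ F, ∀ᶠ n in atTop,
      ‖Y (a * b) n - Y a n * Y b n‖ < 24 * M * δ + δ := fun a ha b hb => by
    have h1 := x.nrm_orbitSum_mul_sub_le hr hs (e * a * e) hδ0.le
      (hadapt b (Finset.mem_union_left _ hb))
    have h2 := x.nrm_orbitSum_le hr hs (e * (a * b) * e - (e * a * e) * (e * b * e))
    rw [orbitSum_sub] at h2
    have n0 := (hea b hb).1
    have n1 : ‖e * (a * b) * e - (e * a * e) * (e * b * e)‖ ≤ 2 * ‖a‖ * δ := by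
      have e1 : e * (a * b) * e - (e * a * e) * (e * b * e) =
          -(e * a * (e * b - b) * e) - e * (a * (e * (e * b - b))) * e := by noncomm_ring
      have n2 : ‖e * a * (e * b - b) * e‖ ≤ ‖a‖ * δ := by
        rw [mul_assoc e a]
        refine (heae _).trans ((norm_mul_le _ _).trans ?_)
        gcongr
      have n3 : ‖e * (a * (e * (e * b - b))) * e‖ ≤ ‖a‖ * (1 * δ) := by
        refine (heae _).trans ((norm_mul_le _ _).trans ?_)
        refine mul_le_mul_of_nonneg_left ((norm_mul_le _ _).trans ?_) (norm_nonneg _)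
        gcongr
      rw [e1]
      refine (norm_sub_le _ _).trans ?_
      rw [norm_neg]
      linarith
    have h3 : nrm (seqMk _ (Y (a * b) - Y a * Y b)) < 24 * M * δ + δ := by
      rw [map_sub, map_mul, hYmk, hYmk, hYmk]
      have e2 : x.orbitSum s r (e * (a * b) * e) -
          x.orbitSum s r (e * a * e) * x.orbitSum s r (e * b * e) =
          (x.orbitSum s r (e * (a * b) * e) - x.orbitSum s r ((e * a * e) * (e * b * e))) +
          (x.orbitSum s r ((e * a * e) * (e * b * e)) -
            x.orbitSum s r (e * a * e) * x.orbitSum s r (e * b * e)) := by abel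
      rw [e2]
      refine (nrm_add_le _ _).trans_lt ?_
      have m1 : ‖e * a * e‖ * δ ≤ M * δ :=
        mul_le_mul_of_nonneg_right ((heae a).trans (hMa a ha)) hδ0.le
      have m2 : ‖a‖ * δ ≤ M * δ := mul_le_mul_of_nonneg_right (hMa a ha) hδ0.le
      linarith
    exact eventually_norm_lt h3
  have hev3 := x.eventually_norm_sum_lt hr hs he he1 one_pos
  have hev4 : ∀ a ∈ F, a ∈ α.fixed → ∀ᶠ n in atTop, ‖Y a n - a‖ < 3 * δ := fun a ha haf => by
    have h1 : nrm (seqMk _ (Y a - constHom A a)) < 3 * δ := by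
      rw [map_sub, hYmk, x.orbitSum_of_mem_fixed hs (mul_mem (mul_mem hef haf) hef),
        seqMk_constHom, ← map_sub]
      refine (nrm_constInfty_le _).trans_lt ?_
      have e1 : e * a * e - a = e * (a * e - a) + (e * a - a) := by noncomm_ring
      have n1 : ‖e * (a * e - a)‖ ≤ 1 * δ :=
        (norm_mul_le _ _).trans (mul_le_mul he1 (hea a ha).2 (norm_nonneg _) zero_le_one)
      rw [e1]
      refine (norm_add_le _ _).trans_lt ?_
      linarith [(hea a ha).1]
    exact eventually_norm_lt h1
  obtain ⟨n, hn1, hn2, hn3, hn4⟩ := (((Filter.eventually_all_finset F').2 hev1).and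
    (((Filter.eventually_all_finset F).2 fun a ha => (Filter.eventually_all_finset F).2
      (hev2 a ha)).and (hev3.and ((Filter.eventually_all_finset F).2
        fun a ha => Filter.eventually_all.2 (hev4 a ha))))).exists
  have hYb : ∀ a, ‖Y a n‖ ≤ 12 * ‖a‖ := fun a => by
    rw [hY]
    dsimp only
    rw [compress_apply]
    refine (norm_sum_star_mul_mul_le s _ _ (norm_nonneg a)
      fun h _ => (α.norm_aut h a).le).trans ?_
    calc _ ≤ 6 * ‖a‖ * (1 + 1) := by gcongr
      _ = 12 * ‖a‖ := by ring
  have hEn : ∀ a, ‖E a‖ ≤ ‖a‖ := fun a => by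
    simpa using hEL (ContinuousLinearMap.id ℂ A) a 0 ‖a‖ fun g => by simp [α.norm_aut]
  let y : A →ₗ[ℂ] A :=
    { toFun := fun a => Y a n
      map_add' := fun a b => by
        simp only [hY, compress_apply, map_add, mul_add, add_mul, Finset.sum_add_distrib]
      map_smul' := fun c a => by
        simp only [hY, compress_apply, map_smul, mul_smul_comm, smul_mul_assoc, Finset.smul_sum,
          RingHom.id_apply] }
  let T : A →ₗ[ℂ] A := E ∘ₗ y
  have hT : ∀ a, T a = E (Y a n) := fun _ => rfl
  have hTb : ∀ a, ‖T a‖ ≤ 12 * ‖a‖ := fun a => (hEn _).trans (hYb a)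
  -- 12δ comes from the near invariance of the orbit sum and δ from passing to a coordinate;
  -- averaging moves a nearly fixed element no further than that.
  have hTY : ∀ a ∈ F', ‖T a - Y a n‖ ≤ 13 * δ := fun a ha => by
    refine hEL (ContinuousLinearMap.id ℂ A) (Y a n) (Y a n) (13 * δ) fun g => ?_
    refine (hn1 a ha g).trans_eq (by ring)
  refine ⟨T, fun a => hE _, fun a => ?_, hTb, fun a ha b hb => ?_, fun a ha haf => ?_⟩
  · rw [hT, hT, ← hEs]
    congr 1
    simp only [hY, compress_apply, star_sum, star_mul, star_star, map_star, mul_assoc]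
  · have m1 := hTY a (Finset.mem_union_left _ ha)
    have m2 := hTY b (Finset.mem_union_left _ hb)
    have m3 := hTY (a * b) (Finset.mem_union_right _ (Finset.mem_image.2
      ⟨(a, b), Finset.mem_product.2 ⟨ha, hb⟩, rfl⟩))
    have m4 := hn2 a ha b hb
    have e1 : T (a * b) - T a * T b = (T (a * b) - Y (a * b) n) +
        (Y (a * b) n - Y a n * Y b n) - Y a n * (T b - Y b n) - (T a - Y a n) * T b := by
      noncomm_ring
    have m5 : ‖Y a n * (T b - Y b n)‖ ≤ (12 * M) * (13 * δ) :=
      (norm_mul_le _ _).trans (mul_le_mul ((hYb a).trans (by gcongr; exact hMa a ha)) m2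
        (norm_nonneg _) (by positivity))
    have m6 : ‖(T a - Y a n) * T b‖ ≤ (13 * δ) * (12 * M) :=
      (norm_mul_le _ _).trans (mul_le_mul m1 ((hTb b).trans (by gcongr; exact hMa b hb))
        (norm_nonneg _) (by positivity))
    rw [e1]
    refine (norm_sub_le _ _).trans ?_
    have m7 := norm_sub_le ((T (a * b) - Y (a * b) n) + (Y (a * b) n - Y a n * Y b n))
      (Y a n * (T b - Y b n))
    have m8 := norm_add_le (T (a * b) - Y (a * b) n) (Y (a * b) n - Y a n * Y b n)
    nlinarith [mul_nonneg hM0 hδ0.le]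
  · have m1 := hTY a (Finset.mem_union_left _ ha)
    have m2 := hn4 a ha haf
    have e1 : T a - a = (T a - Y a n) + (Y a n - a) := by abel
    rw [e1]
    refine (norm_add_le _ _).trans ?_
    nlinarith [mul_nonneg hM0 hδ0.le]

/-- For a Rokhlin action, the inclusion `A^α → A` admits an approximate left inverse
`A → (A^α)_∞`. -/
theorem Rokhlin.exists_hom [TopologicalSpace.SeparableSpace A] (hα : α.Rokhlin) :
    ∃ ψ : A →⋆ₙₐ[ℂ] AInfty α.fixed, (∀ a, nrm (ψ a) ≤ 12 * ‖a‖) ∧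
      ∀ a : α.fixed, ψ a = constInfty α.fixed a := by
  classical
  obtain ⟨x⟩ := hα.nonempty_rokhlinLift
  have : SecondCountableTopology A := UniformSpace.secondCountable_of_separable A
  obtain ⟨d, hd⟩ := TopologicalSpace.exists_dense_seq A
  -- A separate sequence, since a dense sequence in `A` need not contain any nonzero fixed element.
  obtain ⟨d', hd'⟩ := TopologicalSpace.exists_dense_seq α.fixed
  choose T hTf hTs hTb hTm hTi using fun n : ℕ => x.exists_approx_map
    ((Finset.range (n + 1)).image d ∪ (Finset.range (n + 1)).image fun i => (d' i : A))
    (Nat.one_div_pos_of_nat (α := ℝ) (n := n))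
  have h0 := tendsto_one_div_add_atTop_nhds_zero_nat (𝕜 := ℝ)
  have hmem : ∀ i n, i ≤ n → i ∈ Finset.range (n + 1) := fun i n h =>
    Finset.mem_range.2 (by omega)
  have hK : ∀ n a b, ‖T n (a - b)‖ ≤ 12 * ‖a - b‖ := fun n a b => hTb n _
  -- Multiplicativity leaves the dense sequence in two passes: first in the left factor, with the
  -- right one still in the sequence, then in the right one.
  have hmul1 : ∀ i a, Tendsto (fun n => ‖T n (a * d i) - T n a * T n (d i)‖) atTop (𝓝 0) :=
    fun i => tendsto_zero_of_denseRange hd (p := fun n a => ‖T n (a * d i) - T n a * T n (d i)‖)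
      (K := 12 * ‖d i‖ + 12 * (12 * ‖d i‖)) (fun _ _ => norm_nonneg _) (fun n a b => by
        have e1 : T n (a * d i) - T n a * T n (d i) = (T n (b * d i) - T n b * T n (d i)) +
            (T n ((a - b) * d i) - T n (a - b) * T n (d i)) := by
          rw [sub_mul, map_sub, map_sub]
          noncomm_ring
        rw [e1]
        have n1 : ‖T n ((a - b) * d i)‖ ≤ 12 * (‖a - b‖ * ‖d i‖) :=
          (hTb n _).trans (by gcongr; exact norm_mul_le _ _)
        have n2 : ‖T n (a - b) * T n (d i)‖ ≤ (12 * ‖a - b‖) * (12 * ‖d i‖) :=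
          (norm_mul_le _ _).trans (mul_le_mul (hTb n _) (hTb n _) (norm_nonneg _) (by positivity))
        have n3 := norm_add_le (T n (b * d i) - T n b * T n (d i))
          (T n ((a - b) * d i) - T n (a - b) * T n (d i))
        have n4 := norm_sub_le (T n ((a - b) * d i)) (T n (a - b) * T n (d i))
        linarith)
      (fun j => squeeze_zero' (Eventually.of_forall fun _ => norm_nonneg _) (by
        filter_upwards [eventually_ge_atTop i, eventually_ge_atTop j] with n hi hj
        exact hTm n _ (Finset.mem_union_left _ (Finset.mem_image_of_mem _ (hmem j n hj)))
          _ (Finset.mem_union_left _ (Finset.mem_image_of_mem _ (hmem i n hi)))) h0)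
  have hmul : ∀ a b, Tendsto (fun n => ‖T n (a * b) - T n a * T n b‖) atTop (𝓝 0) := fun a =>
    tendsto_zero_of_denseRange hd (p := fun n b => ‖T n (a * b) - T n a * T n b‖)
      (K := 12 * ‖a‖ + 12 * (12 * ‖a‖)) (fun _ _ => norm_nonneg _) (fun n b c => by
        have e1 : T n (a * b) - T n a * T n b = (T n (a * c) - T n a * T n c) +
            (T n (a * (b - c)) - T n a * T n (b - c)) := by
          rw [mul_sub, map_sub, map_sub]
          noncomm_ring
        rw [e1]
        have n1 : ‖T n (a * (b - c))‖ ≤ 12 * (‖a‖ * ‖b - c‖) :=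
          (hTb n _).trans (by gcongr; exact norm_mul_le _ _)
        have n2 : ‖T n a * T n (b - c)‖ ≤ (12 * ‖a‖) * (12 * ‖b - c‖) :=
          (norm_mul_le _ _).trans (mul_le_mul (hTb n _) (hTb n _) (norm_nonneg _) (by positivity))
        have n3 := norm_add_le (T n (a * c) - T n a * T n c)
          (T n (a * (b - c)) - T n a * T n (b - c))
        have n4 := norm_sub_le (T n (a * (b - c))) (T n a * T n (b - c))
        linarith)
      (fun i => hmul1 i a)
  have hid : ∀ a : α.fixed, Tendsto (fun n => ‖T n a - a‖) atTop (𝓝 0) :=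
    tendsto_zero_of_denseRange hd' (p := fun n (a : α.fixed) => ‖T n a - a‖)
      (K := 13) (fun _ _ => norm_nonneg _) (fun n a b => by
        have e1 : T n a - (a : A) = (T n b - b) + (T n ((a : A) - b) - ((a : A) - b)) := by
          rw [map_sub]
          abel
        rw [e1]
        have n3 := norm_add_le (T n b - b) (T n ((a : A) - b) - ((a : A) - b))
        have n4 := norm_sub_le (T n ((a : A) - b)) ((a : A) - b)
        have n5 : ‖a - b‖ = ‖(a : A) - b‖ := rfl
        linarith [hTb n ((a : A) - b)])
      (fun i => squeeze_zero' (Eventually.of_forall fun _ => norm_nonneg _) (by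
        filter_upwards [eventually_ge_atTop i] with n hi
        exact hTi n _ (Finset.mem_union_right _ (Finset.mem_image_of_mem _ (hmem i n hi)))
          (d' i).2) h0)
  let t : A → EllInfty α.fixed := fun a => ⟨fun n => ⟨T n a, hTf n a⟩,
    memℓp_infty ⟨12 * ‖a‖, by rintro _ ⟨n, rfl⟩; exact hTb n a⟩⟩
  refine ⟨{ toFun := fun a => seqMk _ (t a), map_smul' := ?_, map_zero' := ?_, map_add' := ?_,
            map_mul' := ?_, map_star' := ?_ }, fun a => (nrm_seqMk_le _).trans
            (lp.norm_le_of_forall_le (by positivity) fun n => hTb n a), ?_⟩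
  · intro c a
    have : t (c • a) = c • t a := by
      ext n
      exact map_smul (T n) c a
    rw [this, map_smul]
    rfl
  · have : t 0 = 0 := by
      ext n
      exact map_zero (T n)
    rw [this, map_zero]
  · intro a b
    have : t (a + b) = t a + t b := by
      ext n
      exact map_add (T n) a b
    rw [this, map_add]
  · intro a b
    rw [← map_mul, seqMk_eq_iff]
    exact hmul a b
  · intro a
    have : t (star a) = star (t a) := by
      ext n
      exact hTs n a
    rw [this, map_star]
  · intro a
    change seqMk _ (t a) = seqMk _ (constSeq a)
    rw [seqMk_eq_iff]
    exact hid a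

end Action

/-! ### Units and lifting in a uniform setting

A proposition `b` records whether the unital (`b` true) or the general (`b` false) case is meant. -/

/-- `u` is a two-sided unit. -/
def IsOne {R : Type*} [Mul R] (u : R) : Prop := ∀ y, u * y = y ∧ y * u = y

/-- `f` maps units to units. -/
def PreservesOne {R S : Type*} [Mul R] [Mul S] (f : R → S) : Prop := ∀ u, IsOne u → IsOne (f u)

theorem IsOne.eq {R : Type*} [Mul R] {u v : R} (hu : IsOne u) (hv : IsOne v) : u = v := by
  rw [← (hv u).2, (hu v).1]

theorem IsOne.norm_le {B : Type*} [NonUnitalCStarAlgebra B] {u : B} (hu : IsOne u) : ‖u‖ ≤ 1 := by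
  have h : ‖u‖ = ‖u‖ * ‖u‖ := by
    rw [← CStarRing.norm_star_mul_self, (hu _).2, norm_star]
  nlinarith [norm_nonneg u]

theorem isOne_one {R : Type*} [MulOneClass R] : IsOne (1 : R) := fun y => ⟨one_mul y, mul_one y⟩

theorem preservesOne_iff {R S : Type*} [MulOneClass R] [MulOneClass S] {f : R → S} :
    PreservesOne f ↔ f 1 = 1 := by
  refine ⟨fun h => (h 1 isOne_one).eq isOne_one, fun h u hu => ?_⟩
  rw [hu.eq isOne_one, h]
  exact isOne_one

theorem PreservesOne.comp {R S T : Type*} [Mul R] [Mul S] [Mul T] {f : R → S} {g : S → T}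
    (hg : PreservesOne g) (hf : PreservesOne f) : PreservesOne (g ∘ f) :=
  fun u hu => hg _ (hf u hu)

theorem IsOne.map_of_surjective {R S F : Type*} [Mul R] [Mul S] [FunLike F R S] [MulHomClass F R S]
    (f : F) (hf : Function.Surjective f) {u : R} (hu : IsOne u) : IsOne (f u) := fun y => by
  obtain ⟨y, rfl⟩ := hf y
  rw [← map_mul, ← map_mul, (hu y).1, (hu y).2]
  exact ⟨rfl, rfl⟩

/-- Homomorphisms from `B` into sequence algebras lift to bounded sequences. -/
def Liftable (b : Prop) (B : Type u) [NonUnitalCStarAlgebra B] : Prop :=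
  ∀ (D : ℕ → Type u) [∀ n, NonUnitalCStarAlgebra (D n)], (b → ∀ n, ∃ u : D n, IsOne u) →
    ∀ ψ : B →⋆ₙₐ[ℂ] SeqAlg D, (b → PreservesOne ψ) →
      ∃ φ : B →⋆ₙₐ[ℂ] BddSeq D, (∀ a, seqMk D (φ a) = ψ a) ∧
        (b → ∀ᶠ n in atTop, PreservesOne fun a => φ a n)

/-! ### Coordinates of sequences and the lifting property. -/

section Coordinates

variable (D : ℕ → Type*) [∀ n, NonUnitalCStarAlgebra (D n)]

/-- The `n`-th coordinate. -/
def evalHom (n : ℕ) : BddSeq D →⋆ₙₐ[ℂ] D n where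
  toFun x := x n
  map_smul' _ _ := rfl
  map_zero' := rfl
  map_add' _ _ := rfl
  map_mul' _ _ := rfl
  map_star' _ := rfl

/-- The embedding of the `n`-th factor. -/
def singleHom (n : ℕ) : D n →⋆ₙₐ[ℂ] BddSeq D where
  toFun a := ⟨Pi.single n a, memℓp_infty ⟨‖a‖, by
    rintro _ ⟨m, rfl⟩
    rcases eq_or_ne m n with rfl | h
    · simp
    · simp [h]⟩⟩
  map_smul' c a := by
    ext m
    exact congrFun (Pi.single_smul n c a) m
  map_zero' := by
    ext m
    exact congrFun (Pi.single_zero n) m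
  map_add' a b := by
    ext m
    exact congrFun (Pi.single_add n a b) m
  map_mul' a b := by
    ext m
    exact congrFun (Pi.single_mul n a b) m
  map_star' a := by
    ext m
    exact congrFun (Pi.single_star n a) m

theorem singleHom_apply_self (n : ℕ) (a : D n) : singleHom D n a n = a := Pi.single_eq_same n a

/-- The coordinatewise application of homomorphisms. -/
def seqMap {D E : ℕ → Type*} [∀ n, NonUnitalCStarAlgebra (D n)]
    [∀ n, NonUnitalCStarAlgebra (E n)] (f : ∀ n, D n →⋆ₙₐ[ℂ] E n) :
    BddSeq D →⋆ₙₐ[ℂ] BddSeq E where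
  toFun x := ⟨fun n => f n (x n), memℓp_infty ⟨‖x‖, by
    rintro _ ⟨n, rfl⟩
    exact (NonUnitalStarAlgHom.norm_apply_le (f n) (x n)).trans
      (lp.norm_apply_le_norm ENNReal.top_ne_zero x n)⟩⟩
  map_smul' c x := by
    ext n
    exact map_smul (f n) c (x n)
  map_zero' := by
    ext n
    exact map_zero (f n)
  map_add' x y := by
    ext n
    exact map_add (f n) (x n) (y n)
  map_mul' x y := by
    ext n
    exact map_mul (f n) (x n) (y n)
  map_star' x := by
    ext n
    exact map_star (f n) (x n)

end Coordinates

/-- A varying sequence reduces to the single algebra ∏ D_n: place the n-th entry in the n-th factor,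
lift, and read off the diagonal. The embeddings of the factors are not unital, so this reduction
serves the general case only. -/
theorem WeaklySemiprojective.liftable {B : Type u} [NonUnitalCStarAlgebra B]
    (h : WeaklySemiprojective B) : Liftable False B := by
  intro D _ _ ψ _
  let J : BddSeq D →⋆ₙₐ[ℂ] EllInfty (BddSeq D) := seqMap (singleHom D)
  let K : EllInfty (BddSeq D) →⋆ₙₐ[ℂ] BddSeq D := seqMap (evalHom D)
  let j : SeqAlg D →⋆ₙₐ[ℂ] AInfty (BddSeq D) := (nullIdeal _).map (nullIdeal _) J fun x hx =>
    squeeze_zero (fun n => norm_nonneg _)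
      (fun n => NonUnitalStarAlgHom.norm_apply_le (singleHom D n) (x n)) hx
  obtain ⟨φ, hφ⟩ := h (BddSeq D) (j.comp ψ)
  refine ⟨K.comp φ, fun a => ?_, False.elim⟩
  obtain ⟨x, hx⟩ := seqMk_surjective (ψ a)
  have h1 : seqMk _ (φ a) = seqMk _ (J x) := by
    rw [hφ]
    change j (ψ a) = _
    rw [← hx]
    rfl
  rw [← hx, seqMk_eq_iff]
  refine squeeze_zero (fun n => norm_nonneg _) (fun n => ?_) (seqMk_eq_iff.1 h1)
  have h2 : K (φ a) n - x n = (φ a n - J x n) n := by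
    change _ = φ a n n - singleHom D n (x n) n
    rw [singleHom_apply_self]
    rfl
  change ‖K (φ a) n - x n‖ ≤ _
  rw [h2]
  exact lp.norm_apply_le_norm ENNReal.top_ne_zero _ n

/-- A non-unital normed ring with a unit is a normed ring. -/
@[reducible] def normedRingOfIsOne {D : Type u} [i : NonUnitalNormedRing D] {u : D}
    (hu : IsOne u) : NormedRing D :=
  { i with
    one := u
    one_mul := fun y => (hu y).1
    mul_one := fun y => (hu y).2 }

/-- A C*-algebra with a unit is a unital C*-algebra. -/
@[reducible] def cstarAlgebraOfIsOne {D : Type u} [i : NonUnitalCStarAlgebra D] {u : D}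
    (hu : IsOne u) : CStarAlgebra D :=
  letI := normedRingOfIsOne hu
  { i, normedRingOfIsOne hu with
    algebraMap :=
      { toFun := fun c => c • u
        map_one' := one_smul ℂ u
        map_mul' := fun c d => by
          change (c * d) • u = (c • u) * (d • u)
          rw [smul_mul_smul_comm, (hu u).1]
        map_zero' := zero_smul ℂ u
        map_add' := fun c d => add_smul c d u }
    commutes' := fun c y => by
      change (c • u) * y = y * (c • u)
      rw [smul_mul_assoc, mul_smul_comm, (hu y).1, (hu y).2]
    smul_def' := fun c y => by
      change c • y = (c • u) * y
      rw [smul_mul_assoc, (hu y).1]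
    norm_smul_le := fun c y => norm_smul_le c y }

theorem WeaklySemiprojectiveUnital.liftable {B : Type u} [CStarAlgebra B]
    (h : WeaklySemiprojectiveUnital B) : Liftable True B := by
  intro D i hD ψ hψ
  choose u hu using hD trivial
  obtain ⟨φ, hφ, N, hN⟩ := @h D (fun n => cstarAlgebraOfIsOne (hu n)) ψ (hψ trivial 1 isOne_one)
  refine ⟨φ, hφ, fun _ => ?_⟩
  filter_upwards [eventually_ge_atTop N] with n hn v hv
  have h1 : φ 1 n = u n := hN n hn
  rw [hv.eq isOne_one]
  change IsOne (φ 1 n)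
  exact h1 ▸ hu n

/-- Lifting along a correspondence between `Q` and bounded sequences. -/
theorem Liftable.exists_lift {b : Prop} {B Q : Type u} [NonUnitalCStarAlgebra B]
    [NonUnitalCStarAlgebra Q] (hB : Liftable b B) {D : ℕ → Type u}
    [∀ n, NonUnitalCStarAlgebra (D n)] (hD : b → ∀ n, ∃ u : D n, IsOne u)
    (S : NonUnitalStarSubalgebra ℂ (Q × BddSeq D)) (hS : ∀ q, ∃ x, (q, x) ∈ S)
    (hker : ∀ x, ((0 : Q), x) ∈ S → seqMk D x = 0)
    (hone : b → ∀ v : Q, IsOne v → ∃ x, (v, x) ∈ S ∧ IsOne (seqMk D x))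
    (θ : B →⋆ₙₐ[ℂ] Q) (hθ : b → PreservesOne θ) :
    ∃ φ : B →⋆ₙₐ[ℂ] BddSeq D,
      (∀ a x, (θ a, x) ∈ S → Tendsto (fun n => ‖φ a n - x n‖) atTop (𝓝 0)) ∧
        (b → ∀ᶠ n in atTop, PreservesOne fun a => φ a n) := by
  let π : S →⋆ₙₐ[ℂ] Q :=
    (NonUnitalStarAlgHom.fst ℂ Q (BddSeq D)).comp (NonUnitalStarSubalgebraClass.subtype S)
  let ρ : S →⋆ₙₐ[ℂ] SeqAlg D := (seqMk D).comp
    ((NonUnitalStarAlgHom.snd ℂ Q (BddSeq D)).comp (NonUnitalStarSubalgebraClass.subtype S))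
  -- `S` acts as a multivalued homomorphism from `Q` to sequences. By `hker` its ambiguity is a null
  -- sequence, so it induces `σ : Q → SeqAlg D`, and the map to be lifted is σ ∘ θ.
  obtain ⟨σ, hσ⟩ := exists_factor π
    (fun q => by obtain ⟨x, hx⟩ := hS q; exact ⟨⟨(q, x), hx⟩, rfl⟩) ρ (by
      rintro ⟨⟨q, x⟩, hp⟩ (rfl : q = 0)
      exact hker x hp)
  have hσ' : ∀ q x, (q, x) ∈ S → σ q = seqMk D x := fun q x h => hσ ⟨(q, x), h⟩
  obtain ⟨φ, hφ, hφ1⟩ := hB D hD (σ.comp θ) (fun hb u hu => by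
    obtain ⟨x, hx, hx1⟩ := hone hb _ (hθ hb u hu)
    change IsOne (σ (θ u))
    rwa [hσ' _ _ hx])
  refine ⟨φ, fun a x hx => ?_, hφ1⟩
  rw [← seqMk_eq_iff, hφ, ← hσ' _ _ hx]
  rfl

/-! ### Lifting homomorphisms to members of the class -/

/-- `E` is the direct limit of a sequence of algebras in `C`, with unital connecting maps
if `b` holds. -/
def IsApproxOf (b : Prop) (C : ∀ (B : Type u) [NonUnitalCStarAlgebra B], Prop)
    (E : Type u) [NonUnitalCStarAlgebra E] : Prop :=
  ∃ (X : ℕ → Type u) (_ : ∀ n, NonUnitalCStarAlgebra (X n))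
    (γ : ∀ n m, n ≤ m → (X n →⋆ₙₐ[ℂ] X m)) (μ : ∀ n, X n →⋆ₙₐ[ℂ] E),
    (∀ n, C (X n)) ∧
    (∀ n x, γ n n le_rfl x = x) ∧
    (∀ n m k (h : n ≤ m) (h' : m ≤ k) x, γ m k h' (γ n m h x) = γ n k (h.trans h') x) ∧
    (∀ n m (h : n ≤ m) x, μ m (γ n m h x) = μ n x) ∧
    (∀ n x, Tendsto (fun k => ‖γ n (n + k) (Nat.le_add_right n k) x‖) atTop (𝓝 ‖μ n x‖)) ∧
    Dense (⋃ n, Set.range (μ n)) ∧ (b → ∀ n m h, PreservesOne (γ n m h))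

/-! ### A direct limit seen through sequences in its building blocks. -/

section Limit

variable {X : ℕ → Type u} [∀ n, NonUnitalCStarAlgebra (X n)] {E : Type u}
  [NonUnitalCStarAlgebra E]

/-- The sequence `k ↦ γ j k y`, started at `j`. -/
def tailHom (γ : ∀ n m, n ≤ m → (X n →⋆ₙₐ[ℂ] X m)) (j : ℕ) : X j →⋆ₙₐ[ℂ] BddSeq X where
  toFun y := ⟨fun k => if h : j ≤ k then γ j k h y else 0, memℓp_infty ⟨‖y‖, by
    rintro _ ⟨k, rfl⟩
    dsimp only
    split_ifs with h
    · exact NonUnitalStarAlgHom.norm_apply_le (γ j k h) y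
    · rw [norm_zero]
      exact norm_nonneg y⟩⟩
  map_smul' c y := by
    ext k
    change (if h : j ≤ k then γ j k h (c • y) else 0) = c • (if h : j ≤ k then γ j k h y else 0)
    split_ifs with h
    · exact map_smul (γ j k h) c y
    · exact (smul_zero c).symm
  map_zero' := by
    ext k
    change (if h : j ≤ k then γ j k h 0 else 0) = 0
    split_ifs with h
    · exact map_zero (γ j k h)
    · rfl
  map_add' y z := by
    ext k
    change (if h : j ≤ k then γ j k h (y + z) else 0) =
      (if h : j ≤ k then γ j k h y else 0) + (if h : j ≤ k then γ j k h z else 0)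
    split_ifs with h
    · exact map_add (γ j k h) y z
    · exact (add_zero 0).symm
  map_mul' y z := by
    ext k
    change (if h : j ≤ k then γ j k h (y * z) else 0) =
      (if h : j ≤ k then γ j k h y else 0) * (if h : j ≤ k then γ j k h z else 0)
    split_ifs with h
    · exact map_mul (γ j k h) y z
    · exact (mul_zero 0).symm
  map_star' y := by
    ext k
    change (if h : j ≤ k then γ j k h (star y) else 0) =
      star (if h : j ≤ k then γ j k h y else 0)
    split_ifs with h
    · exact map_star (γ j k h) y
    · exact (star_zero _).symm

theorem tailHom_apply (γ : ∀ n m, n ≤ m → (X n →⋆ₙₐ[ℂ] X m)) {j k : ℕ} (h : j ≤ k) (y : X j) :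
    tailHom γ j y k = γ j k h y := dif_pos h

variable {γ : ∀ n m, n ≤ m → (X n →⋆ₙₐ[ℂ] X m)} {μ : ∀ n, X n →⋆ₙₐ[ℂ] E}

theorem seqMk_tailHom
    (hγ : ∀ n m k (h : n ≤ m) (h' : m ≤ k) x, γ m k h' (γ n m h x) = γ n k (h.trans h') x)
    {j i : ℕ} (h : j ≤ i) (y : X j) :
    seqMk X (tailHom γ i (γ j i h y)) = seqMk X (tailHom γ j y) := by
  rw [seqMk_eq_iff]
  refine tendsto_const_nhds.congr' ?_
  filter_upwards [eventually_ge_atTop i] with k hk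
  rw [tailHom_apply γ hk, tailHom_apply γ (h.trans hk), hγ, sub_self, norm_zero]

theorem eventually_norm_tailHom_lt
    (hμ : ∀ n x, Tendsto (fun k => ‖γ n (n + k) (Nat.le_add_right n k) x‖) atTop (𝓝 ‖μ n x‖))
    {j : ℕ} (y : X j) {ε : ℝ} (hε : 0 < ε) :
    ∀ᶠ k in atTop, ‖tailHom γ j y k‖ < ‖μ j y‖ + ε := by
  obtain ⟨N, hN⟩ := eventually_atTop.1 ((hμ j y).eventually_lt_const
    (show ‖μ j y‖ < ‖μ j y‖ + ε by linarith))
  filter_upwards [eventually_ge_atTop (j + N)] with k hk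
  obtain ⟨i, rfl⟩ := Nat.exists_eq_add_of_le (show j ≤ k by omega)
  rw [tailHom_apply γ (Nat.le_add_right j i)]
  exact hN i (by omega)

/-- The correspondence between the limit and sequences given by the connecting maps. -/
def limitSubalgebra (γ : ∀ n m, n ≤ m → (X n →⋆ₙₐ[ℂ] X m)) (μ : ∀ n, X n →⋆ₙₐ[ℂ] E)
    (hγ : ∀ n m k (h : n ≤ m) (h' : m ≤ k) x, γ m k h' (γ n m h x) = γ n k (h.trans h') x)
    (hμγ : ∀ n m (h : n ≤ m) x, μ m (γ n m h x) = μ n x) :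
    NonUnitalStarSubalgebra ℂ (E × BddSeq X) where
  carrier := {p | ∃ j y, μ j y = p.1 ∧ seqMk X (tailHom γ j y) = seqMk X p.2}
  zero_mem' := ⟨0, 0, map_zero _, by rw [map_zero]; rfl⟩
  add_mem' := by
    rintro p p' ⟨j, y, h1, h2⟩ ⟨j', y', h1', h2'⟩
    refine ⟨max j j', γ j _ (le_max_left _ _) y + γ j' _ (le_max_right _ _) y', ?_, ?_⟩
    · rw [map_add, hμγ, hμγ, h1, h1']
      rfl
    · rw [map_add, map_add, seqMk_tailHom hγ, seqMk_tailHom hγ, h2, h2', ← map_add]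
      rfl
  mul_mem' := by
    rintro p p' ⟨j, y, h1, h2⟩ ⟨j', y', h1', h2'⟩
    refine ⟨max j j', γ j _ (le_max_left _ _) y * γ j' _ (le_max_right _ _) y', ?_, ?_⟩
    · rw [map_mul, hμγ, hμγ, h1, h1']
      rfl
    · rw [map_mul, map_mul, seqMk_tailHom hγ, seqMk_tailHom hγ, h2, h2', ← map_mul]
      rfl
  smul_mem' := by
    rintro c p ⟨j, y, h1, h2⟩
    refine ⟨j, c • y, by rw [map_smul, h1]; rfl, ?_⟩
    rw [map_smul, map_smul, h2, ← map_smul]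
    rfl
  star_mem' := by
    rintro p ⟨j, y, h1, h2⟩
    refine ⟨j, star y, by rw [map_star, h1]; rfl, ?_⟩
    rw [map_star, map_star, h2, ← map_star]
    rfl

/-- Passing to a common later index, `μ n u` acts as a unit on the dense union of the ranges, and
acting as a unit on `z` is a closed condition on `z`. -/
theorem preservesOne_of_isLimit
    (hμγ : ∀ n m (h : n ≤ m) x, μ m (γ n m h x) = μ n x) (hd : Dense (⋃ n, Set.range (μ n)))
    (h1 : ∀ n m h, PreservesOne (γ n m h)) (n : ℕ) : PreservesOne (μ n) := by
  intro u hu z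
  have hc : IsClosed {z | μ n u * z = z ∧ z * μ n u = z} :=
    (isClosed_eq (continuous_const.mul continuous_id) continuous_id).inter
      (isClosed_eq (continuous_id.mul continuous_const) continuous_id)
  have hs : (⋃ n, Set.range (μ n)) ⊆ {z | μ n u * z = z ∧ z * μ n u = z} := by
    refine Set.iUnion_subset fun m => ?_
    rintro _ ⟨y, rfl⟩
    rw [← hμγ n (max n m) (le_max_left _ _), ← hμγ m (max n m) (le_max_right _ _)]
    change _ * _ = _ ∧ _ * _ = _
    have := h1 n _ (le_max_left n m) u hu (γ m _ (le_max_right n m) y)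
    rw [← map_mul, ← map_mul, this.1, this.2]
    exact ⟨rfl, rfl⟩
  exact (hc.closure_subset_iff.2 hs) (hd z)

/-- The closure is a C*-algebra whose projection to `E` has dense range; ranges of homomorphisms are
closed, so the projection is onto. -/
theorem exists_mem_closure_limitSubalgebra
    (hγ : ∀ n m k (h : n ≤ m) (h' : m ≤ k) x, γ m k h' (γ n m h x) = γ n k (h.trans h') x)
    (hμγ : ∀ n m (h : n ≤ m) x, μ m (γ n m h x) = μ n x)
    (hd : Dense (⋃ n, Set.range (μ n))) (q : E) :
    ∃ x, (q, x) ∈ (limitSubalgebra γ μ hγ hμγ).topologicalClosure := by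
  set S := (limitSubalgebra γ μ hγ hμγ).topologicalClosure with hS
  have : IsClosed (S : Set (E × BddSeq X)) :=
    NonUnitalStarSubalgebra.isClosed_topologicalClosure _
  let π : S →⋆ₙₐ[ℂ] E :=
    (NonUnitalStarAlgHom.fst ℂ E (BddSeq X)).comp (NonUnitalStarSubalgebraClass.subtype S)
  have hπ : DenseRange π := by
    refine hd.mono (Set.iUnion_subset fun j => ?_)
    rintro _ ⟨y, rfl⟩
    exact ⟨⟨(μ j y, tailHom γ j y), NonUnitalStarSubalgebra.le_topologicalClosure _
      ⟨j, y, rfl, rfl⟩⟩, rfl⟩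
  obtain ⟨⟨⟨q', x⟩, hx⟩, rfl⟩ := surjective_of_dense_range π hπ q
  exact ⟨x, hx⟩

theorem exists_of_mem_closure_limitSubalgebra
    (hγ : ∀ n m k (h : n ≤ m) (h' : m ≤ k) x, γ m k h' (γ n m h x) = γ n k (h.trans h') x)
    (hμγ : ∀ n m (h : n ≤ m) x, μ m (γ n m h x) = μ n x) {q : E} {x : BddSeq X}
    (h : (q, x) ∈ (limitSubalgebra γ μ hγ hμγ).topologicalClosure) {ε : ℝ} (hε : 0 < ε) :
    ∃ j y, ‖μ j y - q‖ < ε ∧ ∀ᶠ k in atTop, ‖tailHom γ j y k - x k‖ < ε := by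
  obtain ⟨⟨q', x'⟩, ⟨j, y, hq, hx⟩, hlt⟩ := Metric.mem_closure_iff.1 h (ε / 2) (by linarith)
  rw [dist_eq_norm, Prod.mk_sub_mk, Prod.norm_mk, max_lt_iff] at hlt
  dsimp only at hq hx
  refine ⟨j, y, ?_, ?_⟩
  · rw [hq, norm_sub_rev]
    linarith [hlt.1]
  · filter_upwards [(seqMk_eq_iff.1 hx).eventually_lt_const
      (show (0 : ℝ) < ε / 2 by linarith)] with k hk
    have h1 : ‖x k - x' k‖ < ε / 2 :=
      (lp.norm_apply_le_norm ENNReal.top_ne_zero (x - x') k).trans_lt hlt.2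
    have e1 : tailHom γ j y k - x k = (tailHom γ j y k - x' k) - (x k - x' k) := by abel
    rw [e1]
    linarith [norm_sub_le (tailHom γ j y k - x' k) (x k - x' k)]

end Limit

section Classes

variable {b : Prop} {C : ∀ (B : Type u) [NonUnitalCStarAlgebra B], Prop}

/-- Homomorphisms into a limit of algebras in `C` lift approximately to members of `C`. -/
theorem IsApproxOf.exists_lift {E : Type u} [NonUnitalCStarAlgebra E] (hE : IsApproxOf b C E)
    (hC1 : b → ∀ (B : Type u) [NonUnitalCStarAlgebra B], C B → ∃ u : B, IsOne u)
    {B : Type u} [NonUnitalCStarAlgebra B] (hB : Liftable b B) (θ : B →⋆ₙₐ[ℂ] E)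
    (hθ : b → PreservesOne θ) (F : Finset B) (H : Finset E) {ε : ℝ} (hε : 0 < ε) :
    ∃ (X : Type u) (_ : NonUnitalCStarAlgebra X) (γ : B →⋆ₙₐ[ℂ] X) (μ : X →⋆ₙₐ[ℂ] E), C X ∧
      (b → PreservesOne γ ∧ PreservesOne μ) ∧
      (∀ x ∈ F, ‖μ (γ x) - θ x‖ < ε ∧ ‖γ x‖ < ‖θ x‖ + ε) ∧ ∀ q ∈ H, ∃ y, ‖μ y - q‖ < ε := by
  obtain ⟨X, _, γ, μ, hX, -, hγ, hμγ, hμ, hd, h1⟩ := hE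
  have hX1 : b → ∀ n, ∃ u : X n, IsOne u := fun hb n => hC1 hb _ (hX n)
  have hμ1 : b → ∀ n, PreservesOne (μ n) := fun hb => preservesOne_of_isLimit hμγ hd (h1 hb)
  obtain ⟨φ, hφ, hφ1⟩ := hB.exists_lift hX1 (limitSubalgebra γ μ hγ hμγ).topologicalClosure
    (exists_mem_closure_limitSubalgebra hγ hμγ hd) (fun x hx => by
      rw [seqMk_eq_zero_iff]
      refine tendsto_order.2 ⟨fun r hr => Eventually.of_forall fun n =>
        hr.trans_le (norm_nonneg _), fun r hr => ?_⟩
      -- A sequence paired with 0 is null: it is eventually r/3-close to the tail of some `y` with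
      -- ‖μ_j y‖ < r/3, and the norms along that tail tend to ‖μ_j y‖.
      obtain ⟨j, y, hy, hyx⟩ := exists_of_mem_closure_limitSubalgebra hγ hμγ hx
        (show 0 < r / 3 by linarith)
      rw [sub_zero] at hy
      filter_upwards [hyx, eventually_norm_tailHom_lt hμ y (show 0 < r / 3 by linarith)]
        with k hk hk'
      have e1 : x k = tailHom γ j y k - (tailHom γ j y k - x k) := by abel
      rw [e1]
      linarith [norm_sub_le (tailHom γ j y k) (tailHom γ j y k - x k)])
    (fun hb v hv => by
      choose u hu using hX1 hb
      refine ⟨⟨u, memℓp_infty ⟨1, by rintro _ ⟨n, rfl⟩; exact (hu n).norm_le⟩⟩,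
        NonUnitalStarSubalgebra.le_topologicalClosure _ ⟨0, u 0, (hμ1 hb 0 _ (hu 0)).eq hv, ?_⟩,
        IsOne.map_of_surjective (seqMk X) seqMk_surjective fun y => ?_⟩
      · congr 1
        ext k
        rw [tailHom_apply γ (Nat.zero_le k)]
        exact (h1 hb 0 k _ _ (hu 0)).eq (hu k)
      · exact ⟨by ext n; exact (hu n (y n)).1, by ext n; exact (hu n (y n)).2⟩) θ hθ
  have hF : ∀ a ∈ F, ∀ᶠ k in atTop, ‖μ k (φ a k) - θ a‖ < ε ∧ ‖φ a k‖ < ‖θ a‖ + ε := by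
    intro a _
    obtain ⟨x, hx⟩ := exists_mem_closure_limitSubalgebra hγ hμγ hd (θ a)
    obtain ⟨j, y, hy, hyx⟩ := exists_of_mem_closure_limitSubalgebra hγ hμγ hx
      (show 0 < ε / 4 by linarith)
    filter_upwards [hyx, eventually_norm_tailHom_lt hμ y (show 0 < ε / 4 by linarith),
      (hφ a x hx).eventually_lt_const (show 0 < ε / 4 by linarith), eventually_ge_atTop j]
      with k hk1 hk2 hk3 hk4
    have n1 : ‖φ a k - tailHom γ j y k‖ < ε / 2 := by
      have e1 : φ a k - tailHom γ j y k = (φ a k - x k) - (tailHom γ j y k - x k) := by abel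
      rw [e1]
      linarith [norm_sub_le (φ a k - x k) (tailHom γ j y k - x k)]
    constructor
    · have n2 : ‖μ k (φ a k - tailHom γ j y k)‖ < ε / 2 :=
        (NonUnitalStarAlgHom.norm_apply_le (μ k) _).trans_lt n1
      have e2 : μ k (φ a k) - θ a = μ k (φ a k - tailHom γ j y k) + (μ j y - θ a) := by
        rw [map_sub, tailHom_apply γ hk4, hμγ]
        abel
      rw [e2]
      linarith [norm_add_le (μ k (φ a k - tailHom γ j y k)) (μ j y - θ a)]
    · have e3 : φ a k = (φ a k - tailHom γ j y k) + tailHom γ j y k := by abel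
      have e4 : μ j y = (μ j y - θ a) + θ a := by abel
      rw [e3]
      have n3 := norm_add_le (μ j y - θ a) (θ a)
      rw [← e4] at n3
      linarith [norm_add_le (φ a k - tailHom γ j y k) (tailHom γ j y k)]
  have hH : ∀ q ∈ H, ∀ᶠ k in atTop, ∃ y, ‖μ k y - q‖ < ε := by
    intro q _
    obtain ⟨p, hp, hpq⟩ := hd.exists_dist_lt q hε
    obtain ⟨j, y, rfl⟩ := Set.mem_iUnion.1 hp
    filter_upwards [eventually_ge_atTop j] with k hk
    refine ⟨γ j k hk y, ?_⟩
    rw [hμγ, ← dist_eq_norm, dist_comm]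
    exact hpq
  have h1' : ∀ᶠ k in atTop, b → PreservesOne fun a => φ a k := by
    by_cases hb : b
    · exact (hφ1 hb).mono fun _ h _ => h
    · exact Eventually.of_forall fun _ h => absurd h hb
  obtain ⟨k, hk1, hk2, hk3⟩ := (((Filter.eventually_all_finset F).2 hF).and
    (((Filter.eventually_all_finset H).2 hH).and h1')).exists
  exact ⟨X k, inferInstance, (evalHom X k).comp φ, μ k, hX k, fun hb => ⟨hk3 hb, hμ1 hb k⟩,
    hk1, hk2⟩

/-! ### Lifting into an asymptotically dense sequence of subalgebras. -/

section Subalgebras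

variable {A : Type u} [NonUnitalCStarAlgebra A] (Q : ℕ → NonUnitalStarSubalgebra ℂ A)
  [∀ n, IsClosed (Q n : Set A)]

/-- The inclusion of sequences in the subalgebras `Q n` into `ℓ^∞(ℕ, A)`. -/
noncomputable def inclSeq : BddSeq (fun n => Q n) →⋆ₙₐ[ℂ] EllInfty A :=
  seqMap fun n => NonUnitalStarSubalgebraClass.subtype (Q n)

theorem exists_inclSeq_eq (hQ : ∀ a, Tendsto (fun n => Metric.infDist a (Q n : Set A)) atTop (𝓝 0))
    (a : A) : ∃ x, seqMk _ (inclSeq Q x) = constInfty A a := by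
  have h : ∀ n : ℕ, ∃ y ∈ (Q n : Set A), dist a y < Metric.infDist a (Q n) + 1 / ((n : ℝ) + 1) :=
    fun n => (Metric.infDist_lt_iff ⟨0, zero_mem (Q n)⟩).1
      (by linarith [Nat.one_div_pos_of_nat (α := ℝ) (n := n)])
  choose y hy hya using h
  have hb : ∀ n, ‖y n‖ ≤ 2 * ‖a‖ + 1 := fun n => by
    have h1 : Metric.infDist a (Q n) ≤ ‖a‖ := by
      simpa using Metric.infDist_le_dist_of_mem (x := a) (zero_mem (Q n))
    have h2 : 1 / ((n : ℝ) + 1) ≤ 1 := by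
      rw [div_le_one (by positivity)]
      linarith [n.cast_nonneg (α := ℝ)]
    have h3 := hya n
    rw [dist_eq_norm] at h3
    have h4 := norm_sub_le a (a - y n)
    rw [sub_sub_cancel] at h4
    linarith
  refine ⟨⟨fun n => ⟨y n, hy n⟩, memℓp_infty ⟨2 * ‖a‖ + 1, by rintro _ ⟨n, rfl⟩; exact hb n⟩⟩, ?_⟩
  change _ = seqMk _ (constSeq a)
  rw [seqMk_eq_iff]
  have h0 := (hQ a).add (tendsto_one_div_add_atTop_nhds_zero_nat (𝕜 := ℝ))
  rw [add_zero] at h0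
  refine squeeze_zero (fun _ => norm_nonneg _) (fun n => ?_) h0
  have := (hya n).le
  rwa [dist_comm, dist_eq_norm] at this

/-- Homomorphisms into `A` lift approximately to an asymptotically dense sequence of
subalgebras. -/
theorem Liftable.exists_lift_subalgebras {b : Prop}
    (hQ : ∀ a, Tendsto (fun n => Metric.infDist a (Q n : Set A)) atTop (𝓝 0))
    (hQ1 : b → ∀ n, ∃ u ∈ Q n, IsOne u)
    {B : Type u} [NonUnitalCStarAlgebra B] (hB : Liftable b B) (θ : B →⋆ₙₐ[ℂ] A)
    (hθ : b → PreservesOne θ) :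
    ∃ φ : ∀ n, B →⋆ₙₐ[ℂ] Q n,
      (∀ a, Tendsto (fun n => ‖(φ n a : A) - θ a‖) atTop (𝓝 0)) ∧
        (b → ∀ᶠ n in atTop, PreservesOne (φ n)) := by
  have hQ1' : b → ∀ n, ∃ u : Q n, IsOne u := fun hb n => by
    obtain ⟨u, hu, hu1⟩ := hQ1 hb n
    exact ⟨⟨u, hu⟩, fun y => ⟨Subtype.ext (hu1 y).1, Subtype.ext (hu1 y).2⟩⟩
  -- The pairs (a, x) with x_n → a in norm.
  let S : NonUnitalStarSubalgebra ℂ (A × BddSeq fun n => Q n) := NonUnitalStarAlgHom.equalizer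
    ((constInfty A).comp (NonUnitalStarAlgHom.fst ℂ A (BddSeq fun n => Q n)))
    (((seqMk _).comp (inclSeq Q)).comp (NonUnitalStarAlgHom.snd ℂ A (BddSeq fun n => Q n)))
  have hS : ∀ a x, (a, x) ∈ S ↔ constInfty A a = seqMk _ (inclSeq Q x) := fun _ _ => Iff.rfl
  obtain ⟨φ, hφ, hφ1⟩ := hB.exists_lift hQ1' S
    (fun a => by
      obtain ⟨x, hx⟩ := exists_inclSeq_eq Q hQ a
      exact ⟨x, hx.symm⟩)
    (fun x hx => by
      rw [hS, map_zero, eq_comm, seqMk_eq_zero_iff] at hx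
      rw [seqMk_eq_zero_iff]
      exact hx)
    (fun hb v hv => by
      have hvQ : ∀ n, v ∈ Q n := fun n => by
        obtain ⟨u, hu, hu1⟩ := hQ1 hb n
        rwa [hv.eq hu1]
      refine ⟨⟨fun n => ⟨v, hvQ n⟩, memℓp_infty ⟨‖v‖, by rintro _ ⟨n, rfl⟩; exact le_rfl⟩⟩, rfl,
        IsOne.map_of_surjective (seqMk _) seqMk_surjective fun y => ⟨?_, ?_⟩⟩
      · ext n
        exact (hv _).1
      · ext n
        exact (hv _).2) θ hθ
  refine ⟨fun n => (evalHom _ n).comp φ, fun a => ?_, hφ1⟩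
  obtain ⟨x, hx⟩ := exists_inclSeq_eq Q hQ (θ a)
  have h1 := (hφ a x hx.symm).add (seqMk_eq_iff.1 hx)
  rw [add_zero] at h1
  refine squeeze_zero (fun _ => norm_nonneg _) (fun n => ?_) h1
  change ‖(φ a n : A) - θ a‖ ≤ ‖(φ a n : A) - x n‖ + ‖(x n : A) - θ a‖
  exact norm_sub_le_norm_sub_add_norm_sub _ _ _

end Subalgebras

/-- `A` is a local `C`-algebra, in the unital sense if `b` holds. -/
def IsLocalOf (b : Prop) (C : ∀ (B : Type u) [NonUnitalCStarAlgebra B], Prop)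
    (A : Type u) [NonUnitalCStarAlgebra A] : Prop :=
  ∀ (F : Finset A) (ε : ℝ), 0 < ε →
    ∃ (B : Type u) (_ : NonUnitalCStarAlgebra B), C B ∧
      ∃ φ : B →⋆ₙₐ[ℂ] A, (b → PreservesOne φ) ∧ ∀ a ∈ F, Metric.infDist a (Set.range φ) < ε

/-- The hypotheses on a class of C*-algebras, in the unital case if `b` holds. -/
structure GoodClass (b : Prop) (C : ∀ (B : Type u) [NonUnitalCStarAlgebra B], Prop) : Prop where
  separable : ∀ (B : Type u) [NonUnitalCStarAlgebra B], C B → TopologicalSpace.SeparableSpace B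
  liftable : ∀ (B : Type u) [NonUnitalCStarAlgebra B], C B → Liftable b B
  exists_isOne : b → ∀ (B : Type u) [NonUnitalCStarAlgebra B], C B → ∃ u : B, IsOne u
  quotient : ∀ (B : Type u) [NonUnitalCStarAlgebra B], C B →
    ∀ (Q : Type u) [NonUnitalCStarAlgebra Q] (π : B →⋆ₙₐ[ℂ] Q), (b → Nontrivial Q) →
      Function.Surjective π → IsApproxOf b C Q

/-- The subalgebras are the images of the locally approximating maps. As these need not be
injective, the images are quotients of members, and the quotient hypothesis makes them limits. In
the unital case they contain the unit of A ≠ 0, so they are nonzero. -/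
theorem GoodClass.exists_subalgebras (hC : GoodClass b C) {A : Type u} [NonUnitalCStarAlgebra A]
    [TopologicalSpace.SeparableSpace A] (hA : IsLocalOf b C A) (hAn : b → Nontrivial A) :
    ∃ (Q : ℕ → NonUnitalStarSubalgebra ℂ A) (_ : ∀ n, IsClosed (Q n : Set A)),
      (∀ a, Tendsto (fun n => Metric.infDist a (Q n : Set A)) atTop (𝓝 0)) ∧
      (b → ∀ n, ∃ u ∈ Q n, IsOne u) ∧ ∀ n, IsApproxOf b C (Q n) := by
  classical
  obtain ⟨d, hd⟩ := TopologicalSpace.exists_dense_seq A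
  choose Y _ hY φ hφ1 hφ using fun n : ℕ => hA ((Finset.range (n + 1)).image d) (1 / ((n : ℝ) + 1))
    (Nat.one_div_pos_of_nat (α := ℝ) (n := n))
  have hQ1 : b → ∀ n, ∃ u ∈ NonUnitalStarAlgHom.range (φ n), IsOne u := fun hb n => by
    obtain ⟨u, hu⟩ := hC.exists_isOne hb (Y n) (hY n)
    exact ⟨φ n u, ⟨u, rfl⟩, hφ1 n hb u hu⟩
  refine ⟨fun n => NonUnitalStarAlgHom.range (φ n), fun n => inferInstance, ?_, hQ1, fun n => ?_⟩
  · refine tendsto_zero_of_denseRange hd (K := 1) (fun _ _ => Metric.infDist_nonneg)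
      (fun n a c => ?_) (fun i => squeeze_zero' (Eventually.of_forall fun _ =>
        Metric.infDist_nonneg) ?_ (tendsto_one_div_add_atTop_nhds_zero_nat (𝕜 := ℝ)))
    · rw [one_mul, ← dist_eq_norm]
      exact Metric.infDist_le_infDist_add_dist
    · filter_upwards [eventually_ge_atTop i] with n hn
      rw [NonUnitalStarAlgHom.coe_range]
      exact (hφ n (d i) (Finset.mem_image_of_mem _ (Finset.mem_range.2 (by omega)))).le
  · have hQn : b → Nontrivial (NonUnitalStarAlgHom.range (φ n)) := fun hb => by
      have := hAn hb
      obtain ⟨u, hu, hu1⟩ := hQ1 hb n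
      refine ⟨⟨u, hu⟩, 0, fun h => ?_⟩
      obtain ⟨a, ha⟩ := exists_ne (0 : A)
      have h0 : u = 0 := congrArg Subtype.val h
      exact ha (by rw [← (hu1 a).1, h0, zero_mul])
    refine hC.quotient (Y n) (hY n) _ (NonUnitalStarAlgHom.rangeRestrict (φ n)) hQn ?_
    rintro ⟨_, y, rfl⟩
    exact ⟨y, rfl⟩

/-- The lifting property of `B` is used twice: to move `θ` into some `Q n`, then into an algebra of
a system with limit `Q n`. The bound on ‖γ x‖ makes up for the possible failure of `μ` to be
injective. -/
theorem GoodClass.exists_step (hC : GoodClass b C) {A : Type u} [NonUnitalCStarAlgebra A]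
    [TopologicalSpace.SeparableSpace A] (hA : IsLocalOf b C A) (hAn : b → Nontrivial A)
    {B : Type u} [NonUnitalCStarAlgebra B] (hB : C B) (θ : B →⋆ₙₐ[ℂ] A) (hθ : b → PreservesOne θ)
    (F : Finset B) (H : Finset A) {ε : ℝ} (hε : 0 < ε) :
    ∃ (X : Type u) (_ : NonUnitalCStarAlgebra X) (γ : B →⋆ₙₐ[ℂ] X) (μ : X →⋆ₙₐ[ℂ] A), C X ∧
      (b → PreservesOne γ ∧ PreservesOne μ) ∧
      (∀ x ∈ F, ‖μ (γ x) - θ x‖ < ε ∧ ‖γ x‖ < ‖θ x‖ + ε) ∧ ∀ a ∈ H, ∃ y, ‖μ y - a‖ < ε := by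
  classical
  obtain ⟨Q, _, hQ, hQ1, hQa⟩ := hC.exists_subalgebras hA hAn
  obtain ⟨ψ, hψ, hψ1⟩ := (hC.liftable B hB).exists_lift_subalgebras Q hQ hQ1 θ hθ
  have hψ1' : ∀ᶠ n in atTop, b → PreservesOne (ψ n) := by
    by_cases hb : b
    · exact (hψ1 hb).mono fun _ h _ => h
    · exact Eventually.of_forall fun _ h => absurd h hb
  have hε2 : 0 < ε / 2 := by linarith
  obtain ⟨n, hn1, hn2, hn3⟩ := (((Filter.eventually_all_finset F).2
    fun x _ => (hψ x).eventually_lt_const hε2).and (((Filter.eventually_all_finset H).2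
    fun a _ => (hQ a).eventually_lt_const hε2).and hψ1')).exists
  have hH : ∀ a, ∃ q : Q n, a ∈ H → dist a q < ε / 2 := fun a => by
    by_cases ha : a ∈ H
    · obtain ⟨q, hq, hlt⟩ := (Metric.infDist_lt_iff ⟨0, zero_mem (Q n)⟩).1 (hn2 a ha)
      exact ⟨⟨q, hq⟩, fun _ => hlt⟩
    · exact ⟨0, fun h => absurd h ha⟩
  choose q hq using hH
  obtain ⟨X, _, γ, μ, hX, h1, hF, hG⟩ := (hQa n).exists_lift
    hC.exists_isOne (hC.liftable B hB) (ψ n) hn3 F (H.image q) hε2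
  refine ⟨X, inferInstance, γ, (NonUnitalStarSubalgebraClass.subtype (Q n)).comp μ, hX,
    fun hb => ⟨(h1 hb).1, ?_⟩, fun x hx => ?_, fun a ha => ?_⟩
  · intro u hu
    obtain ⟨v, hv, hv1⟩ := hQ1 hb n
    have h2 := ((h1 hb).2 u hu ⟨v, hv⟩).1
    have h3 : (μ u : A) * v = v := congrArg Subtype.val h2
    have h4 : (μ u : A) = v := by rw [← h3, (hv1 _).2]
    change IsOne (μ u : A)
    rwa [h4]
  · have m1 := hF x hx
    have m2 := hn1 x hx
    have m3 : ‖(μ (γ x) : A) - ψ n x‖ < ε / 2 := m1.1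
    have m4 : ‖(ψ n x : A)‖ ≤ ‖(ψ n x : A) - θ x‖ + ‖θ x‖ := by
      simpa using norm_add_le ((ψ n x : A) - θ x) (θ x)
    have m5 : ‖γ x‖ < ‖(ψ n x : A)‖ + ε / 2 := m1.2
    constructor
    · change ‖(μ (γ x) : A) - θ x‖ < ε
      linarith [norm_sub_le_norm_sub_add_norm_sub (μ (γ x) : A) (ψ n x) (θ x)]
    · linarith
  · obtain ⟨y, hy⟩ := hG (q a) (Finset.mem_image_of_mem _ ha)
    have m1 : ‖(μ y : A) - q a‖ < ε / 2 := hy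
    have m2 := hq a ha
    rw [dist_comm, dist_eq_norm] at m2
    refine ⟨y, ?_⟩
    change ‖(μ y : A) - a‖ < ε
    linarith [norm_sub_le_norm_sub_add_norm_sub (μ y : A) (q a) a]

/-! ### Construction of the direct system -/

/-- A pointwise Cauchy sequence of homomorphisms converges to a homomorphism. -/
theorem exists_limit_hom {X A : Type*} [NonUnitalCStarAlgebra X] [NonUnitalCStarAlgebra A]
    (f : ℕ → X →⋆ₙₐ[ℂ] A) {D : Set X} (hD : Dense D)
    (hf : ∀ x ∈ D, ∃ a, Tendsto (fun n => f n x) atTop (𝓝 a)) :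
    ∃ μ : X →⋆ₙₐ[ℂ] A, ∀ x, Tendsto (fun n => f n x) atTop (𝓝 (μ x)) := by
  have h : ∀ x, ∃ a, Tendsto (fun n => f n x) atTop (𝓝 a) := fun x => by
    refine cauchySeq_tendsto_of_complete (Metric.cauchySeq_iff'.2 fun ε hε => ?_)
    obtain ⟨y, hy, hxy⟩ := hD.exists_dist_lt x (show 0 < ε / 4 by linarith)
    obtain ⟨a, ha⟩ := hf y hy
    obtain ⟨N, hN⟩ := Metric.cauchySeq_iff'.1 ha.cauchySeq (ε / 4) (by linarith)
    refine ⟨N, fun n hn => ?_⟩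
    have h1 : ∀ m, dist (f m x) (f m y) < ε / 4 := fun m => by
      rw [dist_eq_norm] at hxy ⊢
      rw [← map_sub]
      exact (NonUnitalStarAlgHom.norm_apply_le (f m) _).trans_lt hxy
    have h2 := h1 N
    rw [dist_comm] at h2
    linarith [dist_triangle4 (f n x) (f n y) (f N y) (f N x), h1 n, hN n hn]
  choose μ hμ using h
  refine ⟨{ toFun := μ, map_smul' := ?_, map_zero' := ?_, map_add' := ?_, map_mul' := ?_,
            map_star' := ?_ }, hμ⟩
  · intro c x
    refine tendsto_nhds_unique (hμ (c • x)) ?_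
    simp only [map_smul]
    exact (hμ x).const_smul c
  · refine tendsto_nhds_unique (hμ 0) ?_
    simp only [map_zero]
    exact tendsto_const_nhds
  · intro x y
    refine tendsto_nhds_unique (hμ (x + y)) ?_
    simp only [map_add]
    exact (hμ x).add (hμ y)
  · intro x y
    refine tendsto_nhds_unique (hμ (x * y)) ?_
    simp only [map_mul]
    exact (hμ x).mul (hμ y)
  · intro x
    refine tendsto_nhds_unique (hμ (star x)) ?_
    simp only [map_star]
    exact (hμ x).star

/-- A member of `C` over `A`, together with an increasing sequence of finite subsets whose union
is dense. -/
structure Stage (b : Prop) (C : ∀ (B : Type u) [NonUnitalCStarAlgebra B], Prop)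
    (A : Type u) [NonUnitalCStarAlgebra A] where
  carrier : Type u
  [inst : NonUnitalCStarAlgebra carrier]
  mem : C carrier
  toHom : carrier →⋆ₙₐ[ℂ] A
  preservesOne : b → PreservesOne toHom
  finset : ℕ → Finset carrier
  monotone : Monotone finset
  dense : Dense (⋃ i, (finset i : Set carrier))

attribute [instance] Stage.inst

variable {A : Type u} [NonUnitalCStarAlgebra A]

/-- The requirements on the `k`-th connecting map. -/
structure Stage.Step (a : ℕ → A) (k : ℕ) (s t : Stage b C A)
    (γ : s.carrier →⋆ₙₐ[ℂ] t.carrier) : Prop where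
  preservesOne : b → PreservesOne γ
  map_mem : ∀ i, ∀ x ∈ s.finset i, γ x ∈ t.finset i
  norm_sub_lt : ∀ x ∈ s.finset k, ‖t.toHom (γ x) - s.toHom x‖ < (1 / 2) ^ k
  norm_lt : ∀ x ∈ s.finset k, ‖γ x‖ < ‖s.toHom x‖ + (1 / 2) ^ k
  exists_near : ∀ i ≤ k, ∃ y ∈ t.finset 0, ‖t.toHom y - a i‖ < (1 / 2) ^ k

/-- Finite subsets with dense union that contain prescribed finite subsets. -/
theorem exists_monotone_finsets {X : Type u} [NonUnitalCStarAlgebra X]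
    [TopologicalSpace.SeparableSpace X] (E : ℕ → Finset X) (hE : Monotone E) :
    ∃ F : ℕ → Finset X, Monotone F ∧ Dense (⋃ i, (F i : Set X)) ∧ ∀ i, E i ⊆ F i := by
  classical
  obtain ⟨d, hd⟩ := TopologicalSpace.exists_dense_seq X
  refine ⟨fun i => E i ∪ (Finset.range (i + 1)).image d, fun i j hij => ?_, ?_,
    fun i => Finset.subset_union_left⟩
  · exact Finset.union_subset_union (hE hij)
      (Finset.image_subset_image (Finset.range_subset_range.2 (by omega)))
  · refine hd.mono ?_
    rintro _ ⟨i, rfl⟩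
    refine Set.mem_iUnion.2 ⟨i, ?_⟩
    exact Finset.mem_union_right _ (Finset.mem_image_of_mem d (Finset.mem_range.2 (by omega)))

theorem GoodClass.nonempty_stage (hC : GoodClass b C) (hA : IsLocalOf b C A) :
    Nonempty (Stage b C A) := by
  obtain ⟨B, _, hB, φ, hφ, -⟩ := hA ∅ 1 one_pos
  have := hC.separable B hB
  obtain ⟨F, hF, hd, -⟩ := exists_monotone_finsets (fun _ => (∅ : Finset B)) monotone_const
  exact ⟨⟨B, hB, φ, hφ, F, hF, hd⟩⟩

theorem GoodClass.exists_next [TopologicalSpace.SeparableSpace A] (hC : GoodClass b C)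
    (hA : IsLocalOf b C A) (hAn : b → Nontrivial A) (a : ℕ → A) (k : ℕ) (s : Stage b C A) :
    ∃ (t : Stage b C A) (γ : s.carrier →⋆ₙₐ[ℂ] t.carrier), Stage.Step a k s t γ := by
  classical
  obtain ⟨X, _, γ, μ, hX, h1, hF, hH⟩ := hC.exists_step hA hAn s.mem s.toHom s.preservesOne
    (s.finset k) ((Finset.range (k + 1)).image a) (show (0 : ℝ) < (1 / 2) ^ k by positivity)
  have hy : ∀ i, ∃ y, i ≤ k → ‖μ y - a i‖ < (1 / 2) ^ k := fun i => by
    by_cases hi : i ≤ k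
    · obtain ⟨y, hy⟩ := hH (a i) (Finset.mem_image_of_mem a (Finset.mem_range.2 (by omega)))
      exact ⟨y, fun _ => hy⟩
    · exact ⟨0, fun h => absurd h hi⟩
  choose y hy using hy
  have := hC.separable X hX
  -- The approximate preimages `y` enter already the 0-th finite set, so that every later estimate
  -- applies to them.
  obtain ⟨F, hFm, hd, hsub⟩ := exists_monotone_finsets
    (fun i => (s.finset i).image γ ∪ (Finset.range (k + 1)).image y)
    (fun i j hij => Finset.union_subset_union (Finset.image_subset_image (s.monotone hij))
      subset_rfl)
  refine ⟨⟨X, hX, μ, fun hb => (h1 hb).2, F, hFm, hd⟩, γ, fun hb => (h1 hb).1, ?_,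
    fun x hx => (hF x hx).1, fun x hx => (hF x hx).2, fun i hi => ⟨y i, ?_, hy i hi⟩⟩
  · exact fun i x hx => hsub i (Finset.mem_union_left _ (Finset.mem_image_of_mem γ hx))
  · exact hsub 0 (Finset.mem_union_right _
      (Finset.mem_image_of_mem y (Finset.mem_range.2 (by omega))))

section Connect

variable {X : ℕ → Type u} [∀ n, NonUnitalCStarAlgebra (X n)]

/-- The connecting maps generated by `γ n : X n → X (n + 1)`. -/
noncomputable def connect (γ : ∀ n, X n →⋆ₙₐ[ℂ] X (n + 1)) (n m : ℕ) (h : n ≤ m) :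
    X n →⋆ₙₐ[ℂ] X m :=
  Nat.leRec (motive := fun m _ => X n →⋆ₙₐ[ℂ] X m) (NonUnitalStarAlgHom.id ℂ (X n))
    (fun k _ f => (γ k).comp f) h

variable (γ : ∀ n, X n →⋆ₙₐ[ℂ] X (n + 1))

theorem connect_self (n : ℕ) (x : X n) : connect γ n n le_rfl x = x := by
  rw [connect, Nat.leRec_self]
  rfl

theorem connect_succ (n m : ℕ) (h : n ≤ m) (x : X n) :
    connect γ n (m + 1) (h.trans (Nat.le_succ m)) x = γ m (connect γ n m h x) := by
  rw [connect, Nat.leRec_succ _ _ h]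
  rfl

theorem connect_connect (n m k : ℕ) (h : n ≤ m) (h' : m ≤ k) (x : X n) :
    connect γ m k h' (connect γ n m h x) = connect γ n k (h.trans h') x := by
  induction k, h' using Nat.le_induction with
  | base => rw [connect_self]
  | succ k hk ih => rw [connect_succ γ m k hk, ih, connect_succ γ n k (h.trans hk)]

end Connect

/-- A separable local `C`-algebra is a direct limit of members of `C`. -/
theorem GoodClass.isApproxOf [TopologicalSpace.SeparableSpace A] (hC : GoodClass b C)
    (hA : IsLocalOf b C A) (hAn : b → Nontrivial A) : IsApproxOf b C A := by
  obtain ⟨a, ha⟩ := TopologicalSpace.exists_dense_seq A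
  obtain ⟨s0⟩ := hC.nonempty_stage hA
  choose next γ' hγ' using hC.exists_next hA hAn a
  obtain ⟨s, γ, hγ⟩ : ∃ (s : ℕ → Stage b C A)
      (γ : ∀ n, (s n).carrier →⋆ₙₐ[ℂ] (s (n + 1)).carrier),
      ∀ n, Stage.Step a n (s n) (s (n + 1)) (γ n) :=
    ⟨fun n => Nat.rec s0 (fun k t => next k t) n, fun n => γ' n _, fun n => hγ' n _⟩
  let Γ := connect γ
  have hmem : ∀ n m (h : n ≤ m) i, ∀ x ∈ (s n).finset i, Γ n m h x ∈ (s m).finset i := by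
    intro n m h i x hx
    induction m, h using Nat.le_induction with
    | base => rwa [connect_self]
    | succ m hm ih =>
      rw [connect_succ γ n m hm]
      exact (hγ m).map_mem i _ ih
  let f : ∀ n, ℕ → (s n).carrier →⋆ₙₐ[ℂ] A := fun n m =>
    if h : n ≤ m then (s m).toHom.comp (Γ n m h) else 0
  have hf : ∀ n m (h : n ≤ m) x, f n m x = (s m).toHom (Γ n m h x) := fun n m h x => by
    simp only [f, dif_pos h]
    rfl
  -- Once the stage is past both `n` and `i`, the image of `x` lies in the finite set controlled
  -- there, so successive values in `A` differ by a geometric sequence.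
  have hfs : ∀ n i, ∀ x ∈ (s n).finset i, ∀ N, n ≤ N → i ≤ N →
      ∀ j, dist (f n (N + j) x) (f n (N + (j + 1)) x) ≤ (1 / 2) ^ N * (1 / 2) ^ j := by
    intro n i x hx N hn hi j
    rw [hf n (N + j) (by omega), hf n (N + (j + 1)) (by omega), ← pow_add, dist_comm, dist_eq_norm]
    have := (hγ (N + j)).norm_sub_lt (Γ n (N + j) (by omega) x)
      ((s (N + j)).monotone (show i ≤ N + j by omega) (hmem _ _ _ _ _ hx))
    rw [← connect_succ γ n (N + j) (by omega)] at this
    exact this.le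
  have hex : ∀ n, ∃ μ : (s n).carrier →⋆ₙₐ[ℂ] A, ∀ x, Tendsto (fun m => f n m x) atTop (𝓝 (μ x)) :=
    fun n => exists_limit_hom (f n) (s n).dense fun x hx => by
      obtain ⟨i, hi⟩ := Set.mem_iUnion.1 hx
      have h1 := hfs n i x hi (max n i) (le_max_left _ _) (le_max_right _ _)
      obtain ⟨a, ha⟩ := cauchySeq_tendsto_of_complete
        (cauchySeq_of_le_geometric (1 / 2) _ (by norm_num) h1)
      refine ⟨a, (tendsto_add_atTop_iff_nat (max n i)).1 ?_⟩
      simpa only [add_comm] using ha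
  choose μ hμ using hex
  have hμΓ : ∀ n m (h : n ≤ m) x, μ m (Γ n m h x) = μ n x := by
    intro n m h x
    refine tendsto_nhds_unique ((hμ m _).congr' ?_) (hμ n x)
    filter_upwards [eventually_ge_atTop m] with k hk
    rw [hf m k hk, hf n k (h.trans hk)]
    exact congrArg _ (connect_connect γ n m k h hk x)
  refine ⟨fun n => (s n).carrier, fun n => inferInstance, Γ, μ, fun n => (s n).mem,
    connect_self γ, connect_connect γ, hμΓ, fun n => ?_, ?_, ?_⟩
  · have hle : ∀ k x, ‖μ n x‖ ≤ ‖Γ n (n + k) (Nat.le_add_right n k) x‖ := fun k x => by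
      rw [← hμΓ n (n + k) (Nat.le_add_right n k)]
      exact NonUnitalStarAlgHom.norm_apply_le (μ (n + k)) _
    have hlim : ∀ x, Tendsto (fun k => ‖Γ n (n + k) (Nat.le_add_right n k) x‖ - ‖μ n x‖)
        atTop (𝓝 0) := by
      refine tendsto_zero_of_dense (s n).dense
        (p := fun k x => ‖Γ n (n + k) (Nat.le_add_right n k) x‖ - ‖μ n x‖) (K := 2)
        (fun k x => sub_nonneg.2 (hle k x)) (fun k x y => ?_) (fun x hx => ?_)
      · have h1 := NonUnitalStarAlgHom.norm_apply_le (Γ n (n + k) (Nat.le_add_right n k)) (x - y)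
        have h2 := NonUnitalStarAlgHom.norm_apply_le (μ n) (y - x)
        rw [map_sub] at h1 h2
        rw [norm_sub_rev y x] at h2
        linarith [norm_sub_norm_le (Γ n (n + k) (Nat.le_add_right n k) x)
          (Γ n (n + k) (Nat.le_add_right n k) y), norm_sub_norm_le (μ n y) (μ n x)]
      · obtain ⟨i, hi⟩ := Set.mem_iUnion.1 hx
        -- The shift matches `norm_lt`, which bounds the norm at stage n + k + 1 by that of the
        -- image in `A` from stage n + k; the latter tends to ‖μ_n x‖.
        rw [← tendsto_add_atTop_iff_nat 1]
        have h0 : Tendsto (fun k : ℕ => ‖f n (n + k) x‖ + (1 / 2 : ℝ) ^ (n + k) - ‖μ n x‖)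
            atTop (𝓝 0) := by
          have t1 := (tendsto_add_atTop_iff_nat n).2 (hμ n x).norm
          have t2 := (tendsto_add_atTop_iff_nat n).2 (tendsto_pow_atTop_nhds_zero_of_lt_one
            (show (0 : ℝ) ≤ 1 / 2 by norm_num) (by norm_num))
          have := (t1.add t2).sub_const ‖μ n x‖
          simpa only [add_comm n, add_zero, sub_self] using this
        refine squeeze_zero' (Eventually.of_forall fun k => sub_nonneg.2 (hle (k + 1) x)) ?_ h0
        filter_upwards [eventually_ge_atTop i] with k hk
        have h1 := (hγ (n + k)).norm_lt (Γ n (n + k) (Nat.le_add_right n k) x)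
          ((s (n + k)).monotone (show i ≤ n + k by omega) (hmem _ _ _ _ _ hi))
        rw [← connect_succ γ n (n + k) (Nat.le_add_right n k),
          ← hf n (n + k) (Nat.le_add_right n k)] at h1
        exact sub_le_sub_right h1.le _
    intro x
    simpa using (hlim x).add_const ‖μ n x‖
  · refine Metric.dense_iff.2 fun z r hr => ?_
    obtain ⟨i, hi⟩ := ha.exists_dist_lt z (show 0 < r / 2 by linarith)
    obtain ⟨k0, hk0⟩ := exists_pow_lt_of_lt_one (show 0 < r / 4 by linarith)
      (show (1 / 2 : ℝ) < 1 by norm_num)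
    set k := max i k0 with hk
    have hkr : (1 / 2 : ℝ) ^ k < r / 4 :=
      (pow_le_pow_of_le_one (by norm_num) (by norm_num) (le_max_right i k0)).trans_lt hk0
    -- `y` lives at stage k + 1, so in the limit its image moves by at most Σ_{j > k} 2^{-j} =
    -- 2^{-k}. The total error is below 2 · 2^{-k} + r/2 < r.
    obtain ⟨y, hy, hya⟩ := (hγ k).exists_near i (le_max_left i k0)
    have h1 := hfs (k + 1) 0 y hy (k + 1) le_rfl (Nat.zero_le _)
    have h2 : Tendsto (fun j => f (k + 1) (k + 1 + j) y) atTop (𝓝 (μ (k + 1) y)) := by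
      have := (tendsto_add_atTop_iff_nat (k + 1)).2 (hμ (k + 1) y)
      simpa only [add_comm] using this
    have h3 := dist_le_of_le_geometric_of_tendsto₀ (1 / 2) _ (by norm_num) h1 h2
    rw [add_zero, hf (k + 1) (k + 1) le_rfl] at h3
    change dist ((s (k + 1)).toHom (connect γ (k + 1) (k + 1) le_rfl y)) _ ≤ _ at h3
    rw [connect_self, pow_succ] at h3
    rw [← dist_eq_norm] at hya
    refine ⟨μ (k + 1) y, ?_, Set.mem_iUnion.2 ⟨k + 1, y, rfl⟩⟩
    rw [Metric.mem_ball]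
    have h4 := dist_triangle4 (μ (k + 1) y) ((s (k + 1)).toHom y) (a i) z
    rw [dist_comm] at h3
    rw [dist_comm] at hi
    have h5 : (1 / 2 : ℝ) ^ k * (1 / 2) / (1 - 1 / 2) = (1 / 2) ^ k := by ring
    rw [h5] at h3
    linarith
  · intro hb n m h
    induction m, h using Nat.le_induction with
    | base =>
      intro u hu
      rwa [show Γ n n le_rfl u = u from connect_self γ n u]
    | succ m hm ih =>
      intro u hu
      rw [show Γ n (m + 1) _ u = γ m (Γ n m hm u) from connect_succ γ n m hm u]
      exact (hγ m).preservesOne hb _ (ih u hu)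

end Classes

/-! ### Fixed point algebras of Rokhlin actions -/

theorem IsOne.mem_fixed {G : Type*} [Group G] [TopologicalSpace G] {A : Type*}
    [NonUnitalCStarAlgebra A] (α : Action G A) {u : A} (hu : IsOne u) : u ∈ α.fixed := fun g =>
  (IsOne.map_of_surjective (α.aut g) (α.aut g).surjective hu).eq hu

/-- Composing B → A with ψ : A → (A^α)_∞ leaves the approximated fixed elements in place; the
composite lifts, and a late coordinate is the required map B → A^α. -/
theorem IsLocalOf.fixed {b : Prop} {C : ∀ (B : Type u) [NonUnitalCStarAlgebra B], Prop}
    (hC : GoodClass b C) {G : Type v} [Group G] [TopologicalSpace G] [IsTopologicalGroup G]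
    [CompactSpace G] [SecondCountableTopology G] {A : Type u} [NonUnitalCStarAlgebra A]
    [TopologicalSpace.SeparableSpace A] (hA : IsLocalOf b C A) (hA1 : b → ∃ u : A, IsOne u)
    {α : Action G A} (hα : α.Rokhlin) : IsLocalOf b C α.fixed := by
  classical
  intro F ε hε
  obtain ⟨ψ, hψ, hψc⟩ := hα.exists_hom
  -- ε/13 because ψ is only known to enlarge distances by a factor of at most 12.
  obtain ⟨B, _, hB, φ, hφ1, hφ⟩ := hA (F.image (Subtype.val : α.fixed → A)) (ε / 13) (by linarith)
  have hone : ∀ u (hu : IsOne u), IsOne (⟨u, hu.mem_fixed α⟩ : α.fixed) := fun u hu y =>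
    ⟨Subtype.ext (hu y).1, Subtype.ext (hu y).2⟩
  have hψ1 : PreservesOne ψ := fun u hu => by
    rw [hψc ⟨u, hu.mem_fixed α⟩]
    refine IsOne.map_of_surjective (seqMk _) seqMk_surjective fun y => ⟨?_, ?_⟩
    · ext n
      exact (hu _).1
    · ext n
      exact (hu _).2
  obtain ⟨χ, hχ, hχ1⟩ := hC.liftable B hB (fun _ => α.fixed)
    (fun hb _ => by
      obtain ⟨u, hu⟩ := hA1 hb
      exact ⟨_, hone u hu⟩)
    (ψ.comp φ) (fun hb => hψ1.comp (hφ1 hb))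
  have hF : ∀ a ∈ F, ∀ᶠ n in atTop, Metric.infDist a (Set.range fun x => χ x n) < ε := by
    intro a ha
    obtain ⟨_, ⟨y, rfl⟩, hy⟩ := (Metric.infDist_lt_iff (Set.range_nonempty φ)).1
      (hφ a (Finset.mem_image_of_mem Subtype.val ha))
    have h1 : nrm (seqMk _ (constHom α.fixed a - χ y)) < ε := by
      rw [map_sub, hχ, seqMk_constHom, ← hψc]
      change nrm (ψ a - ψ (φ y)) < ε
      rw [← map_sub]
      rw [dist_eq_norm] at hy
      linarith [hψ (a - φ y)]
    filter_upwards [eventually_norm_lt h1] with n hn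
    have hmem : χ y n ∈ Set.range fun x => χ x n := ⟨y, rfl⟩
    refine (Metric.infDist_le_dist_of_mem hmem).trans_lt ?_
    rw [dist_eq_norm]
    exact hn
  have hχ1' : ∀ᶠ n in atTop, b → PreservesOne fun a => χ a n := by
    by_cases hb : b
    · exact (hχ1 hb).mono fun _ h _ => h
    · exact Eventually.of_forall fun _ h => absurd h hb
  obtain ⟨n, hn, hn1⟩ := (((Filter.eventually_all_finset F).2 hF).and hχ1').exists
  exact ⟨B, inferInstance, hB, (evalHom _ n).comp χ, hn1, hn⟩

theorem GoodClass.isApproxOf_fixed {b : Prop}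
    {C : ∀ (B : Type u) [NonUnitalCStarAlgebra B], Prop}
    (hC : GoodClass b C) {G : Type v} [Group G] [TopologicalSpace G] [IsTopologicalGroup G]
    [CompactSpace G] [SecondCountableTopology G] {A : Type u} [NonUnitalCStarAlgebra A]
    [TopologicalSpace.SeparableSpace A] (hA : IsLocalOf b C A) (hA1 : b → ∃ u : A, IsOne u)
    (hAn : b → Nontrivial A) {α : Action G A} (hα : α.Rokhlin) : IsApproxOf b C α.fixed := by
  have : SecondCountableTopology A := UniformSpace.secondCountable_of_separable A
  refine hC.isApproxOf (hA.fixed hC hA1 hα) fun hb => ?_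
  have := hAn hb
  obtain ⟨u, hu⟩ := hA1 hb
  refine ⟨⟨u, hu.mem_fixed α⟩, 0, fun h => ?_⟩
  obtain ⟨a, ha⟩ := exists_ne (0 : A)
  have h0 : u = 0 := congrArg Subtype.val h
  exact ha (by rw [← (hu a).1, h0, zero_mul])

theorem IsApproxOf.of_isometry {b : Prop} {C : ∀ (B : Type u) [NonUnitalCStarAlgebra B], Prop}
    {E E' : Type u} [NonUnitalCStarAlgebra E] [NonUnitalCStarAlgebra E'] (h : IsApproxOf b C E)
    (e : E →⋆ₙₐ[ℂ] E') (he : ∀ x, ‖e x‖ = ‖x‖) (hs : Function.Surjective e) :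
    IsApproxOf b C E' := by
  obtain ⟨X, _, γ, μ, hX, h1, h2, h3, h4, h5, h6⟩ := h
  refine ⟨X, inferInstance, γ, fun n => e.comp (μ n), hX, h1, h2,
    fun n m h x => congrArg e (h3 n m h x), fun n x => ?_, ?_, h6⟩
  · change Tendsto _ atTop (𝓝 ‖e (μ n x)‖)
    rw [he]
    exact h4 n x
  · refine (hs.denseRange.dense_image (continuous_hom e) h5).mono ?_
    rintro _ ⟨_, hx, rfl⟩
    obtain ⟨n, y, rfl⟩ := Set.mem_iUnion.1 hx
    exact Set.mem_iUnion.2 ⟨n, y, rfl⟩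

/-! ### Specialisation to the general case. -/

section Nonunital

variable {C : ∀ (B : Type u) [NonUnitalCStarAlgebra B], Prop}

theorem isApproxOf_false_iff {E : Type u} [NonUnitalCStarAlgebra E] :
    IsApproxOf False C E ↔ IsApprox C E := by
  constructor
  · rintro ⟨X, i, γ, μ, hX, h1, h2, h3, h4, h5, -⟩
    exact ⟨X, i, γ, μ, hX, h1, h2, h3, h4, h5⟩
  · rintro ⟨X, i, γ, μ, hX, h1, h2, h3, h4, h5⟩
    exact ⟨X, i, γ, μ, hX, h1, h2, h3, h4, h5, False.elim⟩

theorem goodClass_false (h : ∀ (B : Type u) [NonUnitalCStarAlgebra B], C B →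
    TopologicalSpace.SeparableSpace B ∧ WeaklySemiprojective B) (hq : HasApproxQuotients C) :
    GoodClass False C where
  separable B _ hB := (h B hB).1
  liftable B _ hB := (h B hB).2.liftable
  exists_isOne := False.elim
  quotient B _ hB Q _ π _ hπ := isApproxOf_false_iff.2 (hq B hB Q π hπ)

theorem IsLocal.isLocalOf {A : Type u} [NonUnitalCStarAlgebra A] (h : IsLocal C A) :
    IsLocalOf False C A := fun F ε hε => by
  obtain ⟨B, i, hB, φ, hφ⟩ := h F ε hε
  exact ⟨B, i, hB, φ, False.elim, hφ⟩

end Nonunital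

/-! ### Specialisation to the unital case. -/

section Unital

variable {C : ∀ (B : Type u) [CStarAlgebra B], Prop}

/-- The class of C*-algebras underlying a class of unital C*-algebras. -/
def Underlying (C : ∀ (B : Type u) [CStarAlgebra B], Prop) (B : Type u)
    [i : NonUnitalCStarAlgebra B] : Prop :=
  ∃ j : CStarAlgebra B, j.toNonUnitalCStarAlgebra = i ∧ C B

/-- A unit-preserving homomorphism as a unital homomorphism. -/
noncomputable def unitalHom {A B : Type*} [CStarAlgebra A] [CStarAlgebra B] (f : A →⋆ₙₐ[ℂ] B)
    (hf : PreservesOne f) : A →⋆ₐ[ℂ] B where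
  toFun := f
  map_one' := preservesOne_iff.1 hf
  map_mul' := map_mul f
  map_zero' := map_zero f
  map_add' := map_add f
  commutes' c := by
    rw [Algebra.algebraMap_eq_smul_one, Algebra.algebraMap_eq_smul_one, map_smul,
      preservesOne_iff.1 hf]
  map_star' := map_star f

theorem IsApproxUnital.isApproxOf {E : Type u} [CStarAlgebra E] (h : IsApproxUnital C E) :
    IsApproxOf True (Underlying C) E := by
  obtain ⟨X, i, γ, μ, hX, h1, h2, h3, h4, h5⟩ := h
  exact ⟨X, fun n => (i n).toNonUnitalCStarAlgebra, fun n m h => (γ n m h).toNonUnitalStarAlgHom,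
    fun n => (μ n).toNonUnitalStarAlgHom, fun n => ⟨i n, rfl, hX n⟩, h1, h2, h3, h4, h5,
    fun _ n m h => preservesOne_iff.2 (map_one (γ n m h))⟩

theorem IsApproxOf.isApproxUnital {E : Type u} [CStarAlgebra E]
    (h : IsApproxOf True (Underlying C) E) : IsApproxUnital C E := by
  obtain ⟨X, i, γ, μ, hX, h1, h2, h3, h4, h5, h6⟩ := h
  choose j hj hjC using hX
  -- Replaces the given structures by those underlying the chosen unital ones, so that
  -- unit-preserving maps become unital homomorphisms.
  obtain rfl : (fun n => (j n).toNonUnitalCStarAlgebra) = i := funext hj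
  have hμ := preservesOne_of_isLimit h3 h5 (h6 trivial)
  exact ⟨X, j, fun n m h => unitalHom (γ n m h) (h6 trivial n m h),
    fun n => unitalHom (μ n) (hμ n), hjC, h1, h2, h3, h4, h5⟩

theorem goodClass_true (h : ∀ (B : Type u) [CStarAlgebra B], C B →
    TopologicalSpace.SeparableSpace B ∧ WeaklySemiprojectiveUnital B)
    (hq : HasApproxQuotientsUnital C) : GoodClass True (Underlying C) where
  separable := by
    rintro B _ ⟨j, rfl, hB⟩
    exact (h B hB).1
  liftable := by
    rintro B _ ⟨j, rfl, hB⟩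
    exact (h B hB).2.liftable
  exists_isOne := by
    rintro - B _ ⟨j, rfl, hB⟩
    exact ⟨1, isOne_one⟩
  quotient := by
    rintro B _ ⟨j, rfl, hB⟩ Q i π hQ hπ
    have h1 : IsOne (π 1) := isOne_one.map_of_surjective π hπ
    -- The unit π(1) makes the quotient a unital C*-algebra without altering its underlying
    -- structure.
    obtain ⟨k, rfl⟩ : ∃ k : CStarAlgebra Q, k.toNonUnitalCStarAlgebra = i :=
      ⟨cstarAlgebraOfIsOne h1, rfl⟩
    have := hQ trivial
    exact (hq B hB Q (unitalHom π fun u hu => hu.map_of_surjective π hπ) hπ).isApproxOf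

theorem IsLocalUnital.isLocalOf {A : Type u} [CStarAlgebra A] (h : IsLocalUnital C A) :
    IsLocalOf True (Underlying C) A := fun F ε hε => by
  obtain ⟨B, i, hB, φ, hφ⟩ := h F ε hε
  exact ⟨B, i.toNonUnitalCStarAlgebra, ⟨i, rfl, hB⟩, φ.toNonUnitalStarAlgHom,
    fun _ => preservesOne_iff.2 (map_one φ), hφ⟩

/-- The identity map from `A^α` to `A^α` as a unital algebra. -/
def fixedHom {G : Type*} [Group G] [TopologicalSpace G] {A : Type*} [CStarAlgebra A]
    (α : Action G A) : α.fixed →⋆ₙₐ[ℂ] α.fixedUnital where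
  toFun a := ⟨a, a.2⟩
  map_smul' _ _ := rfl
  map_zero' := rfl
  map_add' _ _ := rfl
  map_mul' _ _ := rfl
  map_star' _ := rfl

end Unital

end CStarRokhlin

theorem mainTheorem4 {G : Type v} [Group G] [TopologicalSpace G] [IsTopologicalGroup G]
    [CompactSpace G] [T2Space G] [SecondCountableTopology G] :
    (∀ C : (∀ (B : Type u) [NonUnitalCStarAlgebra B], Prop),
      (∀ (B : Type u) [NonUnitalCStarAlgebra B], C B →
        TopologicalSpace.SeparableSpace B ∧ CStarRokhlin.WeaklySemiprojective B) →
      CStarRokhlin.HasApproxQuotients C →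
      ∀ (A : Type u) [NonUnitalCStarAlgebra A] [TopologicalSpace.SeparableSpace A],
        CStarRokhlin.IsLocal C A →
        ∀ α : CStarRokhlin.Action G A, α.Rokhlin → CStarRokhlin.IsApprox C α.fixed) ∧
    (∀ C : (∀ (B : Type u) [CStarAlgebra B], Prop),
      (∀ (B : Type u) [CStarAlgebra B], C B →
        TopologicalSpace.SeparableSpace B ∧ CStarRokhlin.WeaklySemiprojectiveUnital B) →
      CStarRokhlin.HasApproxQuotientsUnital C →
      ∀ (A : Type u) [CStarAlgebra A] [Nontrivial A] [TopologicalSpace.SeparableSpace A],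
        CStarRokhlin.IsLocalUnital C A →
        ∀ α : CStarRokhlin.Action G A, α.Rokhlin →
          CStarRokhlin.IsApproxUnital C α.fixedUnital) := by
  open CStarRokhlin in
  refine ⟨fun C hC hq A _ _ hA α hα => ?_, fun C hC hq A _ _ _ hA α hα => ?_⟩
  · exact isApproxOf_false_iff.1 ((goodClass_false hC hq).isApproxOf_fixed hA.isLocalOf
      False.elim False.elim hα)
  -- `α.fixed` and `α.fixedUnital` have the same elements but separately defined structures, so the
  -- limit is transported along the identity.
  · exact (((goodClass_true hC hq).isApproxOf_fixed hA.isLocalOf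
      (fun _ => ⟨1, isOne_one⟩) (fun _ => inferInstance) hα).of_isometry (fixedHom α)
      (fun _ => rfl) fun a => ⟨⟨a, a.2⟩, rfl⟩).isApproxUnital
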